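/- **Notation.** Let $\mathfrak a=1/\sqrt2$, $\varphi(t)=2^{1/4}e^{-\pi t^2}$, $\pi(x,\omega)g(t)=e^{2\pi i\omega t}g(t-x)$. For $f\in L^2(\mathbb R)$ let $\mathcal Gf(p)=\langle f,\pi(p)\varphi\rangle_{L^2}$ for $p\in\mathbb R^2$, let $\mathcal Sf=|\mathcal Gf|^2$, and for $S>0$ let $$\kappa_S(f)=\sup_{x\in\mathbb R}\Big(\int_{|\omega|>S}|\mathcal Gf(x,\omega)|^2\,d\omega\Big)^{1/2}.$$ Let $\psi\in L^2(\mathbb R)$ be the canonical dual window of the Gabor frame $(\pi(\lambda)\varphi)_{\lambda\in\mathfrak a\mathbb Z^2}$, i.e. $\sum_{\lambda\in\mathfrak a\mathbb Z^2}\langle\psi,\pi(\lambda)\varphi\rangle\,\pi(\lambda)\varphi=\varphi$ (unconditional convergence in $L^2(\mathbb R)$). Given $T,S,R,s>0$ put $$\Lambda=([-T,T]\times[-S,S])\cap\mathfrak a\mathbb Z^2,\quad \Omega=([-T-R,T+R]\times[-S-R,S+R])\cap s\mathbb Z^2,\quad \Gamma=([-T-2R,T+2R]\times[-S-2R,S+2R])\cap\mathfrak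 a\mathbb Z^2.$$ *Spectral gap.* For $r>0$ let $\mathcal L\in\mathbb R^{\Lambda\times\Lambda}$ be given by $\mathcal L_{u,u}=\sum_{z\sim u}\mathcal Sf(z)$, $\mathcal L_{u,v}=-\sqrt{\mathcal Sf(u)\,\mathcal Sf(v)}$ if $u\sim v$, and $\mathcal L_{u,v}=0$ otherwise, where $u\sim v$ means $0<|u-v|<r$. Let $\lambda_2(f,\Lambda,r)$ be its second smallest eigenvalue, counted with multiplicity. Write $\|\mathcal Gf\|_{\ell^2(\Lambda)}^2=\sum_{\lambda\in\Lambda}|\mathcal Gf(\lambda)|^2$. *Well calibrated.* The parameters $T,S,R,r,s,\varepsilon,\varepsilon'>0$ are well calibrated for $f$ if $$\varepsilon\le\Big[\frac{e^{-\frac{17\pi}{32}r^2}}{1.33\times10^5}\min\Big\{\frac{\|\mathcal Gf\|_{\ell^2(\Lambda)}^2}{|\Lambda|^2},\frac{\lambda_2(f,\Lambda,r)}{192r^2}\Big\}\Big]^2,\qquad \varepsilon'=(3.1\times10^4)\sqrt\varepsilon\,e^{\frac{17\pi}{32}r^2},$$ $$s\le\frac{0.3}{\sqrt{\ln(\frac2{3\varepsilon})}},\qquad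 R\ge\max\Big\{2.1+0.9\sqrt{\ln(\tfrac1\varepsilon)},\ \frac{r+s^{-1}}2\Big\}.$$ *Algorithm.* For $\lambda,\mu\in\mathbb R^2$ and $z\in\mathbb C^2$, with $w^2:=w_1^2+w_2^2$, let $$\Phi_{\lambda,\mu}(z)=e^{-\frac\pi4|\lambda-\mu|^2+\pi i(\lambda_1\lambda_2-\mu_1\mu_2)}\,e^{i\pi(z_1(\lambda_2-\mu_2)-z_2(\lambda_1-\mu_1))}\,e^{-\pi(z-\frac{\lambda+\mu}2)^2},$$ and for $A\in\mathbb C^{\Gamma\times\Gamma}$ let $F_A=\sum_{\lambda,\mu\in\Gamma}A_{\lambda,\mu}\Phi_{\lambda,\mu}$. For $p,u\in\mathbb R^2$ let $$\mathcal E[F](p,u)=F\Big(p+\tfrac12\begin{pmatrix}1&-i\\ i&1\end{pmatrix}u\Big)\,e^{-\frac\pi2|u|^2-\pi i(2p_1+u_1)u_2}.$$ The algorithm with input $\sigma\in\mathbb R^\Omega$ runs as follows. (1) Let $A_*$ be a minimizer of $\max_{\lambda\in\Gamma}A_{\lambda,\lambda}$ among the positive semidefinite $A\in\mathbb C^{\Gamma\times\Gamma}$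 with $|F_A(\omega)-\sigma_\omega|\le\varepsilon$ for all $\omega\in\Omega$. (2) Find a positive semidefinite $Y\in\mathbb C^{\Lambda\times\Lambda}$ with $|Y_{\lambda',\lambda}-\mathcal E[F_{A_*}](\lambda,\lambda'-\lambda)|\le\varepsilon'$ for all $\lambda,\lambda'\in\Lambda$ with $|\lambda-\lambda'|\le r$. (3) Let $v\in\mathbb C^\Lambda$ be an eigenvector of $Y$ for its largest eigenvalue, normalized by $|v|=1$, and output $f_*=\sqrt{\operatorname{trace}(Y)}\sum_{\lambda\in\Lambda}v_\lambda\,\pi(\lambda)\psi$. **Theorem.** Let $f\in L^2(\mathbb R)$ with $\|\mathcal Sf\|_{L^\infty(\mathbb R^2)}\le1$, let $T,S,R,r,s,\varepsilon,\varepsilon'>0$ be well calibrated for $f$, with $T,S\in\mathfrak a\mathbb N$, let $0<\tau<T$, and let $\sigma\in\mathbb R^\Omega$ satisfy $|\sigma_\omega-\mathcal Sf(\omega)|\le\varepsilon/2$ for all $\omega\in\Omega$. Then the algorithm with input $\sigma$ has an output (all its steps can be carried out), and every output $f_*$ satisfies $$\min_{\theta\in\mathbb R}\|f_*-e^{i\theta}f\|_{L^2(-\tau,\tau)}\le18\Bigg[177\,e^{0.84r^2}\Bigg(1+20r\sqrt{\frac{\|\mathcal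 Gf\|_{\ell^2(\Lambda)}^2}{\lambda_2(f,\Lambda,r)}}\Bigg)\sqrt[4]{\varepsilon}+(2T+2)\,\kappa_S(f)+2\sqrt S\,(\tau+1)\,e^{-\frac\pi2(T-\tau)}\Bigg].$$ -/

import Mathlib

open MeasureTheory Filter Topology
open scoped ENNReal ComplexConjugate ComplexOrder

namespace GaborPR

noncomputable section

/-! ### Time-frequency analysis on the real line -/

/-- The Gaussian window `φ(t) = 2^{1/4} e^{-π t²}`. -/
def gaussian (t : ℝ) : ℂ := (((2 : ℝ) ^ (1 / 4 : ℝ) * Real.exp (-Real.pi * t ^ 2) : ℝ) : ℂ)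

/-- The time-frequency shift `π(x,ω) g = M_ω T_x g`, i.e. `t ↦ e^{2πiωt} g(t - x)`. -/
def tfShift (p : ℝ × ℝ) (g : ℝ → ℂ) (t : ℝ) : ℂ :=
  Complex.exp (2 * Real.pi * Complex.I * p.2 * t) * g (t - p.1)

/-- The Gabor transform `𝒢 f(x,ω) = ⟨f, M_ω T_x φ⟩ = ∫ f(t) conj(M_ω T_x φ(t)) dt`. -/
def gabor (f : ℝ → ℂ) (p : ℝ × ℝ) : ℂ := ∫ t : ℝ, f t * conj (tfShift p gaussian t)

/-- The spectrogram `𝒮 f = |𝒢 f|²`. -/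
def spectrogram (f : ℝ → ℂ) (p : ℝ × ℝ) : ℝ := ‖gabor f p‖ ^ 2

/-- `κ_S(f) = sup_x (∫_{|ω|>S} |𝒢 f(x,ω)|² dω)^{1/2}`. -/
def kappa (S : ℝ) (f : ℝ → ℂ) : ℝ≥0∞ :=
  ⨆ x : ℝ, eLpNorm (fun ω : ℝ => gabor f (x, ω)) 2 (volume.restrict {ω : ℝ | S < |ω|})

/-! ### Lattices and finite lattice rectangles -/

/-- The mesh size `𝔞 = 1/√2`. -/
def mesh : ℝ := 1 / √2

/-- The point of the lattice `c ℤ²` with integer coordinates `k`. -/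
def latticePt (c : ℝ) (k : ℤ × ℤ) : ℝ × ℝ := (c * k.1, c * k.2)

/-- The finite set `([-X,X] × [-Y,Y]) ∩ c ℤ²`, points being recorded by their integer coordinates
(see `mem_latticeRect` and `image_latticeRect`). -/
def latticeRect (c X Y : ℝ) : Finset (ℤ × ℤ) :=
  Finset.Icc ⌈-X / c⌉ ⌊X / c⌋ ×ˢ Finset.Icc ⌈-Y / c⌉ ⌊Y / c⌋

theorem mem_latticeRect {c X Y : ℝ} (hc : 0 < c) (k : ℤ × ℤ) :
    k ∈ latticeRect c X Y ↔ latticePt c k ∈ Set.Icc (-X) X ×ˢ Set.Icc (-Y) Y := by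
  simp only [latticeRect, latticePt, Finset.mem_product, Finset.mem_Icc, Int.ceil_le,
    Int.le_floor, Set.mem_prod, Set.mem_Icc, div_le_iff₀ hc, le_div_iff₀ hc, mul_comm c]

theorem image_latticeRect {c X Y : ℝ} (hc : 0 < c) :
    latticePt c '' (latticeRect c X Y : Set (ℤ × ℤ)) =
      (Set.Icc (-X) X ×ˢ Set.Icc (-Y) Y) ∩ Set.range (latticePt c) := by
  ext p
  constructor
  · rintro ⟨k, hk, rfl⟩
    exact ⟨(mem_latticeRect hc k).1 hk, k, rfl⟩
  · rintro ⟨hp, k, rfl⟩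
    exact ⟨k, (mem_latticeRect hc k).2 hp, rfl⟩

/-- Euclidean distance in the plane. -/
def dist₂ (p q : ℝ × ℝ) : ℝ := √((p.1 - q.1) ^ 2 + (p.2 - q.2) ^ 2)

/-- The squared norm `‖𝒢 f‖²_{ℓ²(Λ)}` for a finite `Λ ⊆ 𝔞 ℤ²`. -/
def gaborEnergy (f : ℝ → ℂ) (Λ : Finset (ℤ × ℤ)) : ℝ :=
  ∑ k ∈ Λ, ‖gabor f (latticePt mesh k)‖ ^ 2

/-- `ψ` is (a representative of) the canonical dual window `S⁻¹ φ` of the Gabor frame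
`(π(λ) φ)_{λ ∈ 𝔞ℤ²}`: `ψ ∈ L²(ℝ)` and the frame operator maps `ψ` to `φ`, i.e. the series
`∑_λ ⟨ψ, π(λ)φ⟩ π(λ)φ` converges unconditionally in `L²(ℝ)` to `φ`. -/
def IsCanonicalDualWindow (ψ : ℝ → ℂ) : Prop :=
  MemLp ψ 2 volume ∧
    Tendsto
      (fun F : Finset (ℤ × ℤ) =>
        eLpNorm (fun t : ℝ => gaussian t -
          ∑ k ∈ F, gabor ψ (latticePt mesh k) * tfShift (latticePt mesh k) gaussian t) 2 volume)
      atTop (𝓝 0)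

/-! ### Vertex-weighted graphs and the spectral gap -/

open Classical in
/-- The Laplacian of a vertex-weighted graph `(V, E, α)`. -/
def vwLaplacian {V : Type*} [Fintype V] (G : SimpleGraph V) (α : V → ℝ) : Matrix V V ℝ :=
  Matrix.of fun u v =>
    if u = v then ∑ z : V, if G.Adj u z then α z else 0
    else if G.Adj u v then -√(α u * α v) else 0

theorem vwLaplacian_isHermitian {V : Type*} [Fintype V] (G : SimpleGraph V) (α : V → ℝ) :
    (vwLaplacian G α).IsHermitian := by
  ext u v
  simp only [vwLaplacian, Matrix.conjTranspose_apply, Matrix.of_apply, star_trivial]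
  by_cases h : u = v
  · subst h; rfl
  · by_cases h' : G.Adj u v
    · simp [h, Ne.symm h, h', h'.symm, mul_comm (α v)]
    · have h'' : ¬ G.Adj v u := fun e => h' e.symm
      simp [h, Ne.symm h, h', h'']

open Classical in
/-- The second smallest eigenvalue `λ₂`, counted with multiplicity, of the Laplacian
(`eigenvalues₀` lists the eigenvalues in decreasing order). The value `0` for a graph with fewer
than two vertices is a dummy. -/
def spectralGap {V : Type*} [Fintype V] (G : SimpleGraph V) (α : V → ℝ) : ℝ :=
  if h : 2 ≤ Fintype.card V then
    (vwLaplacian_isHermitian G α).eigenvalues₀ ⟨Fintype.card V - 2, by omega⟩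
  else 0

/-- The edges of the signal associated graph: `u ∼ v` iff `0 < |u - v| < r`. -/
def signalGraph (Λ : Finset (ℤ × ℤ)) (r : ℝ) : SimpleGraph Λ where
  Adj u v := 0 < dist₂ (latticePt mesh u) (latticePt mesh v) ∧
    dist₂ (latticePt mesh u) (latticePt mesh v) < r
  symm := ⟨fun u v h => by
    have e : dist₂ (latticePt mesh v) (latticePt mesh u) =
        dist₂ (latticePt mesh u) (latticePt mesh v) := by
      unfold dist₂; congr 1; ring
    rwa [e]⟩
  loopless := ⟨fun u h => by simp [dist₂] at h⟩

/-- `λ₂(f,Λ,r)`: the spectral gap of the signal associated graph, with vertex weights `𝒮 f`. -/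
def signalGap (f : ℝ → ℂ) (Λ : Finset (ℤ × ℤ)) (r : ℝ) : ℝ :=
  spectralGap (signalGraph Λ r) fun u => spectrogram f (latticePt mesh u)

/-! ### Index sets and well calibrated parameters -/

/-- `Λ = ([-T,T] × [-S,S]) ∩ 𝔞ℤ²`. -/
abbrev setΛ (T S : ℝ) : Finset (ℤ × ℤ) := latticeRect mesh T S

/-- `Ω = ([-T-R,T+R] × [-S-R,S+R]) ∩ sℤ²`. -/
abbrev setΩ (T S R s : ℝ) : Finset (ℤ × ℤ) := latticeRect s (T + R) (S + R)

/-- `Γ = ([-T-2R,T+2R] × [-S-2R,S+2R]) ∩ 𝔞ℤ²`. -/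
abbrev setΓ (T S R : ℝ) : Finset (ℤ × ℤ) := latticeRect mesh (T + 2 * R) (S + 2 * R)

/-- The parameters `T, S, R, r, s, ε, ε'` are (positive and) well calibrated for `f`. -/
structure WellCalibrated (f : ℝ → ℂ) (T S R r s ε ε' : ℝ) : Prop where
  T_pos : 0 < T
  S_pos : 0 < S
  R_pos : 0 < R
  r_pos : 0 < r
  s_pos : 0 < s
  ε_pos : 0 < ε
  ε'_pos : 0 < ε'
  ε_le : ε ≤ (Real.exp (-(17 * Real.pi / 32) * r ^ 2) / (1.33 * 10 ^ 5) *
    min (gaborEnergy f (setΛ T S) / ((setΛ T S).card : ℝ) ^ 2)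
      (signalGap f (setΛ T S) r / (192 * r ^ 2))) ^ 2
  ε'_eq : ε' = 3.1 * 10 ^ 4 * √ε * Real.exp (17 * Real.pi / 32 * r ^ 2)
  s_le : s ≤ 0.3 / √(Real.log (2 / (3 * ε)))
  R_ge : max (2.1 + 0.9 * √(Real.log (1 / ε))) ((r + s⁻¹) / 2) ≤ R

/-! ### The reconstruction algorithm -/

/-- The function `Φ_{λ,μ}` on `ℂ²`. -/
def ansatzPhi (l m : ℝ × ℝ) (z : ℂ × ℂ) : ℂ :=
  Complex.exp (-(Real.pi / 4) * ((l.1 - m.1) ^ 2 + (l.2 - m.2) ^ 2) +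
      Real.pi * Complex.I * (l.1 * l.2 - m.1 * m.2)) *
    Complex.exp (Complex.I * Real.pi * (z.1 * (l.2 - m.2) - z.2 * (l.1 - m.1))) *
    Complex.exp (-Real.pi * ((z.1 - (l.1 + m.1) / 2) ^ 2 + (z.2 - (l.2 + m.2) / 2) ^ 2))

/-- The Ansatz function `F_A = ∑_{λ,μ ∈ Γ} A_{λ,μ} Φ_{λ,μ}`. -/
def ansatz {Γ : Finset (ℤ × ℤ)} (A : Matrix Γ Γ ℂ) (z : ℂ × ℂ) : ℂ :=
  ∑ k : Γ, ∑ l : Γ, A k l * ansatzPhi (latticePt mesh k) (latticePt mesh l) z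

/-- The evaluation `ℰ[G](p,u) = G(L(p,u)) e^{Q(p,u)}`. -/
def evaluation (G : ℂ × ℂ → ℂ) (p u : ℝ × ℝ) : ℂ :=
  G (p.1 + (u.1 - Complex.I * u.2) / 2, p.2 + (Complex.I * u.1 + u.2) / 2) *
    Complex.exp (-(Real.pi / 2) * (u.1 ^ 2 + u.2 ^ 2) -
      Real.pi * Complex.I * (2 * p.1 + u.1) * u.2)

/-- Feasibility for the first convex program: `A ⪰ 0` and `|F_A(ω) - σ_ω| ≤ ε` on `Ω ⊆ sℤ²`. -/
def Feasible₁ {Γ Ω : Finset (ℤ × ℤ)} (s ε : ℝ) (σ : Ω → ℝ) (A : Matrix Γ Γ ℂ) : Prop :=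
  A.PosSemidef ∧
    ∀ k : Ω, ‖ansatz A (((latticePt s k).1 : ℂ), ((latticePt s k).2 : ℂ)) - (σ k : ℂ)‖ ≤ ε

/-- The objective `max_{λ ∈ Γ} A_{λ,λ}`. -/
def maxDiag {Γ : Finset (ℤ × ℤ)} (A : Matrix Γ Γ ℂ) : ℝ := ⨆ k : Γ, (A k k).re

/-- `A` solves the first convex program. -/
def Solves₁ {Γ Ω : Finset (ℤ × ℤ)} (s ε : ℝ) (σ : Ω → ℝ) (A : Matrix Γ Γ ℂ) : Prop :=
  Feasible₁ s ε σ A ∧ ∀ A' : Matrix Γ Γ ℂ, Feasible₁ s ε σ A' → maxDiag A ≤ maxDiag A'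

/-- `Y` solves the second convex (feasibility) program: `Y ⪰ 0` and
`|Y_{λ',λ} - ℰ[F_A](λ, λ' - λ)| ≤ ε'` whenever `|λ - λ'| ≤ r`. -/
def Solves₂ {Γ Λ : Finset (ℤ × ℤ)} (r ε' : ℝ) (A : Matrix Γ Γ ℂ) (Y : Matrix Λ Λ ℂ) : Prop :=
  Y.PosSemidef ∧
    ∀ k k' : Λ, dist₂ (latticePt mesh k) (latticePt mesh k') ≤ r →
      ‖Y k' k - evaluation (ansatz A) (latticePt mesh k)
        (latticePt mesh k' - latticePt mesh k)‖ ≤ ε'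

/-- `v` is a normalized eigenvector of `Y` for its largest eigenvalue. -/
def IsTopEigenvector {Λ : Finset (ℤ × ℤ)} (Y : Matrix Λ Λ ℂ) (v : Λ → ℂ) : Prop :=
  ∑ k : Λ, ‖v k‖ ^ 2 = 1 ∧
    ∃ μ : ℝ, Y.mulVec v = (μ : ℂ) • v ∧
      ∀ (ν : ℝ) (w : Λ → ℂ), w ≠ 0 → Y.mulVec w = (ν : ℂ) • w → ν ≤ μ

/-- `g` is (a representative of) an output of the reconstruction algorithm with parameters
`r, ε, ε'` and finite sets `Λ, Γ ⊆ 𝔞ℤ²` for the input `σ` on `Ω ⊆ sℤ²`: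
`g = √(tr Y) ∑_{λ ∈ Λ} v_λ π(λ)ψ`, for some solution `A` of the first program, some solution `Y`
of the second, and some normalized top eigenvector `v` of `Y`. -/
def IsAlgorithmOutput (Λ Γ : Finset (ℤ × ℤ)) {Ω : Finset (ℤ × ℤ)} (s r ε ε' : ℝ) (σ : Ω → ℝ)
    (g : ℝ → ℂ) : Prop :=
  ∃ (A : Matrix Γ Γ ℂ) (Y : Matrix Λ Λ ℂ) (v : Λ → ℂ) (ψ : ℝ → ℂ),
    Solves₁ s ε σ A ∧ Solves₂ r ε' A Y ∧ IsTopEigenvector Y v ∧ IsCanonicalDualWindow ψ ∧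
      g =ᵐ[volume] fun t : ℝ =>
        ((√(Y.trace.re) : ℝ) : ℂ) * ∑ k : Λ, v k * tfShift (latticePt mesh k) ψ t

/-- The bound `177 e^{0.84 r²} (1 + 20 r √(‖𝒢f‖²_{ℓ²(Λ)} / λ₂(f,Λ,r))) ε^{1/4}`. -/
def coeffBound (f : ℝ → ℂ) (Λ : Finset (ℤ × ℤ)) (r ε : ℝ) : ℝ :=
  177 * Real.exp (0.84 * r ^ 2) *
    (1 + 20 * r * √(gaborEnergy f Λ / signalGap f Λ r)) * ε ^ (1 / 4 : ℝ)

/-- `‖g - e^{iθ} f‖_{L²(-τ,τ)}`. -/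
def phaseError (τ : ℝ) (g f : ℝ → ℂ) (θ : ℝ) : ℝ≥0∞ :=
  eLpNorm (fun t : ℝ => g t - Complex.exp (Complex.I * θ) * f t) 2
    (volume.restrict (Set.Ioo (-τ) τ))

end

end GaborPR

namespace GaborPR

/-! ### Sampling of entire functions of Gaussian growth -/

/-! The products 𝒢f(q)·conj 𝒢f(p) with p ≠ q carry the relative phases that are missing from 𝒮f =
|𝒢f|². For the Gaussian window, 𝒢f is an entire function up to an explicit factor, so 𝒮f extends to
an entire function on ℂ² (`crossExt`). Its value above the midpoint of p and q, at an imaginary part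
of length |q - p|/2, is that product times an explicit Gaussian (`evaluation_crossExt`). Local phase
recovery is therefore analytic continuation from lattice samples. It is stable because the extension
grows at most like e^{2π|Im z|²} (`norm_crossExt`).

Continuation: an entire function of this growth that is of size e^{-L} on a fine grid is of size
e^{-L/2} at the complex points needed (`norm_le_of_lattice_samples`). Real points are reached by
Poisson summation against sinc kernels (`norm_le_of_samples`), complex points by the three lines
theorem along a complex line (`norm_le_continuation`). The result is applied to the difference
between F_A and the extension of 𝒮f (`norm_evaluation_sub_le`). This requires bounded entries of A,
which minimizing the largest diagonal entry ensures as soon as one feasible matrix has a small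
diagonal (`exists_feasible`). The loss of a square root here produces the √ε in ε'.

Frame theory: by Poisson summation the frame operator is twice a product of two theta series in
translations and modulations by √2 (`hasSum_inner_coh`). A Neumann series inverts e^{-πk²} under
convolution, with ℓ¹ and exponentially weighted ℓ¹ bounds. This yields the norm of the inverse,
bounded expansion coefficients (`norm_inner_latShift_frameInv_le`) and exponential decay of the dual
window (`ae_norm_dualL_le`).

Phase synchronization: let a be the vector of samples 𝒢f(λ), λ ∈ Λ. The matrix Y is within 2ε' of
aa* at all entries between points of distance at most r. Writing Y as a sum of rank-one matrices and
applying to each the gap inequality of the graph Laplacian, twisted by the phases of a, bounds the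
trace of Y away from the direction of a (`trace_sub_le_of_close`). Hence the scaled top eigenvector
is close to a up to one global phase (`exists_phase_close`). Passing from matrices to vectors costs
a second square root, whence the fourth root of ε.

Synthesis: errors in the coefficients pass to L² with constant 1 (`norm_sum_dual_le`). Coefficients
omitted above and below the rectangle are controlled by κ_S, those beside it by the decay of the
dual window (`localNorm_sub_sum_le`). -/

theorem integrable_horizontal {P : ℂ → ℂ} (hP : Differentiable ℂ P) {b C η : ℝ} (hb : 0 < b)
    (hC : ∀ t : ℝ, ‖P (t + η * Complex.I)‖ ≤ C * Real.exp (-b * t ^ 2)) :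
    Integrable fun t : ℝ => P (t + η * Complex.I) := by
  refine Integrable.mono' ((integrable_exp_neg_mul_sq hb).const_mul C) ?_ (ae_of_all _ hC)
  exact (hP.continuous.comp (by fun_prop)).aestronglyMeasurable

/-- Shifting a horizontal line of integration. -/
theorem integral_horizontal_shift {P : ℂ → ℂ} (hP : Differentiable ℂ P) {b C : ℝ} (hb : 0 < b)
    (η : ℝ)
    (hC : ∀ t y : ℝ, |y| ≤ |η| → ‖P (t + y * Complex.I)‖ ≤ C * Real.exp (-b * t ^ 2)) :
    ∫ t : ℝ, P t = ∫ t : ℝ, P (t + η * Complex.I) := by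
  have h0 : Integrable fun t : ℝ => P t := by
    have := integrable_horizontal (η := 0) hP hb (fun t => hC t 0 (by simp))
    simpa using this
  have h1 := integrable_horizontal (η := η) hP hb (fun t => hC t η le_rfl)
  -- Cauchy's theorem on the rectangle with vertices ±T and ±T + iη; the right side collects the
  -- vertical edges, which vanish as T → ∞.
  have key : ∀ T : ℝ, (∫ x in (-T)..T, P x) - (∫ x in (-T)..T, P (x + η * Complex.I)) =
      -(Complex.I • (∫ y in (0:ℝ)..η, P (T + y * Complex.I)) -
        Complex.I • ∫ y in (0:ℝ)..η, P ((-T : ℝ) + y * Complex.I)) := by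
    intro T
    have := Complex.integral_boundary_rect_eq_zero_of_differentiableOn P
      (((-T : ℝ) : ℂ)) ((T : ℂ) + η * Complex.I) hP.differentiableOn
    simp at this
    simp only [Complex.ofReal_neg, smul_eq_mul]
    linear_combination this
  have hv : ∀ σ : ℝ, σ = 1 ∨ σ = -1 → Tendsto
      (fun T : ℝ => ∫ y in (0:ℝ)..η, P ((σ * T : ℝ) + y * Complex.I)) atTop (𝓝 0) := by
    intro σ hσ
    have hlim : Tendsto (fun T : ℝ => C * Real.exp (-b * T ^ 2) * |η - 0|) atTop (𝓝 0) := by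
      have : Tendsto (fun T : ℝ => Real.exp (-b * T ^ 2)) atTop (𝓝 0) := by
        refine Real.tendsto_exp_atBot.comp ?_
        exact (tendsto_pow_atTop two_ne_zero).const_mul_atTop_of_neg (by linarith)
      simpa using (this.const_mul C).mul_const |η - 0|
    refine squeeze_zero_norm (fun T => ?_) hlim
    refine intervalIntegral.norm_integral_le_of_norm_le_const fun y hy => ?_
    have hy' : |y| ≤ |η| := by
      rcases le_total 0 η with h | h
      · rw [Set.uIoc_of_le h] at hy
        rw [abs_of_pos hy.1, abs_of_nonneg h]; exact hy.2
      · rw [Set.uIoc_of_ge h] at hy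
        rw [abs_of_nonpos hy.2, abs_of_nonpos h]; linarith [hy.1]
    have := hC (σ * T) y hy'
    rcases hσ with rfl | rfl
    · simpa using this
    · simpa using this
  have L1 := (intervalIntegral_tendsto_integral h0 tendsto_neg_atTop_atBot tendsto_id)
  have L2 := (intervalIntegral_tendsto_integral h1 tendsto_neg_atTop_atBot tendsto_id)
  have L3 : Tendsto (fun T : ℝ => -(Complex.I • (∫ y in (0:ℝ)..η, P (T + y * Complex.I)) -
        Complex.I • ∫ y in (0:ℝ)..η, P ((-T : ℝ) + y * Complex.I))) atTop (𝓝 0) := by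
    have a1 := hv 1 (Or.inl rfl)
    have a2 := hv (-1) (Or.inr rfl)
    simp only [one_mul, neg_mul] at a1 a2
    simpa using ((a1.const_smul Complex.I).sub (a2.const_smul Complex.I)).neg
  have L4 := (L1.sub L2)
  simp only [id] at L4
  simp only [key] at L4
  exact sub_eq_zero.1 (tendsto_nhds_unique L4 L3)

-- The line of integration moves to height h or -h, whichever makes the character decay. The
-- interior constant `C` only licenses the shift. The estimate involves the boundary constant `C₁`
-- alone, and it is on the boundary that sinc factors gain inverse powers of h.
open Real FourierTransform in
theorem norm_fourier_le_of_strip {Q : ℂ → ℂ} (hQ : Differentiable ℂ Q) {b C C₁ h : ℝ} (hb : 0 < b)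
    (hh : 0 < h)
    (hC : ∀ t y : ℝ, |y| ≤ h → ‖Q (t + y * Complex.I)‖ ≤ C * Real.exp (-b * t ^ 2))
    (hC₁ : ∀ t y : ℝ, |y| = h → ‖Q (t + y * Complex.I)‖ ≤ C₁ * Real.exp (-b * t ^ 2)) (ξ : ℝ) :
    ‖𝓕 (fun t : ℝ => Q t) ξ‖ ≤ C₁ * √(π / b) * Real.exp (-(2 * π * h) * |ξ|) := by
  obtain ⟨η, hη, hηξ⟩ : ∃ η : ℝ, |η| = h ∧ η * ξ = -(h * |ξ|) := by
    rcases le_total 0 ξ with h0 | h0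
    · exact ⟨-h, by rw [abs_neg, abs_of_pos hh], by rw [abs_of_nonneg h0]; ring⟩
    · exact ⟨h, abs_of_pos hh, by rw [abs_of_nonpos h0]; ring⟩
  have hC0 : 0 ≤ C := by
    have := (norm_nonneg _).trans (hC 0 0 (by simpa using hh.le))
    simpa using this
  set E : ℂ → ℂ := fun z => Complex.exp (-(2 * π * Complex.I * ξ) * z)
  have hE : ∀ t y : ℝ, ‖E (t + y * Complex.I)‖ = Real.exp (2 * π * (y * ξ)) := by
    intro t y
    simp only [E, Complex.norm_exp]
    congr 1
    simp [Complex.mul_re, Complex.mul_im]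
    ring
  rw [fourier_real_eq_integral_exp_smul]
  have e1 : ∫ v : ℝ, Complex.exp (((-2 * π * v * ξ : ℝ) : ℂ) * Complex.I) • Q v =
      ∫ v : ℝ, (fun z => E z * Q z) v := by
    congr 1 with v
    simp only [E, smul_eq_mul]
    congr 2
    push_cast
    ring
  rw [e1, integral_horizontal_shift (P := fun z => E z * Q z)
    (C := Real.exp (2 * π * (h * |ξ|)) * C) ((by fun_prop : Differentiable ℂ E).mul hQ) hb η]
  · have hInt : Integrable fun t : ℝ => C₁ * Real.exp (-(2 * π * h) * |ξ|) *
        Real.exp (-b * t ^ 2) := (integrable_exp_neg_mul_sq hb).const_mul _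
    refine (norm_integral_le_of_norm_le hInt (ae_of_all _ fun t => ?_)).trans ?_
    · rw [norm_mul, hE, hηξ]
      have := hC₁ t η hη
      calc _ ≤ Real.exp (2 * π * -(h * |ξ|)) * (C₁ * Real.exp (-b * t ^ 2)) := by gcongr
        _ = _ := by rw [show 2 * π * -(h * |ξ|) = -(2 * π * h) * |ξ| by ring]; ring
    · rw [integral_const_mul, integral_gaussian]
      exact le_of_eq (by ring)
  · intro t y hy
    rw [hη] at hy
    rw [norm_mul, hE]
    have h1 : y * ξ ≤ h * |ξ| := by
      calc y * ξ ≤ |y * ξ| := le_abs_self _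
        _ = |y| * |ξ| := abs_mul _ _
        _ ≤ _ := by gcongr
    calc _ ≤ Real.exp (2 * π * (h * |ξ|)) * (C * Real.exp (-b * t ^ 2)) := by
          gcongr
          exact hC t y hy
      _ = _ := by ring

theorem hasSum_int_geometric (c : ℝ) {z : ℝ} (hz0 : 0 ≤ z) (hz1 : z < 1) :
    HasSum (fun n : ℤ => if n = 0 then 0 else c * z ^ n.natAbs) (2 * (c * (z / (1 - z)))) := by
  have hgeo : HasSum (fun n : ℕ => c * z ^ (n + 1)) (c * (z / (1 - z))) := by
    have := (hasSum_geometric_of_lt_one hz0 hz1).mul_left (c * z)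
    rw [show (fun n : ℕ => c * z ^ (n + 1)) = fun n => c * z * z ^ n by ext n; ring,
      show c * (z / (1 - z)) = c * z * (1 - z)⁻¹ by ring]
    exact this
  rw [two_mul]
  refine HasSum.of_nat_of_neg_add_one ?_ ?_
  · rw [← hasSum_nat_add_iff' 1]
    have e : (fun n : ℕ => if ((n + 1 : ℕ) : ℤ) = 0 then 0 else c * z ^ ((n + 1 : ℕ) : ℤ).natAbs) =
        fun n => c * z ^ (n + 1) := by
      ext n
      rw [if_neg (by omega)]
      rfl
    rw [e]
    simpa using hgeo
  · have e : (fun n : ℕ => if (-((n : ℤ) + 1)) = 0 then 0 else c * z ^ (-((n : ℤ) + 1)).natAbs) =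
        fun n => c * z ^ (n + 1) := by
      ext n
      rw [if_neg (by omega)]
      congr 2
    rw [e]
    exact hgeo

open Real FourierTransform in
/-- The trapezoidal sums of a function with Gaussian decay in a strip do not depend much on the
offset of the grid. -/
theorem norm_tsum_sub_tsum_add_le {Q : ℂ → ℂ} (hQ : Differentiable ℂ Q) {b C C₁ h : ℝ} (hb : 0 < b)
    (hh : 0 < h)
    (hC : ∀ t y : ℝ, |y| ≤ h → ‖Q (t + y * Complex.I)‖ ≤ C * Real.exp (-b * t ^ 2))
    (hC₁ : ∀ t y : ℝ, |y| = h → ‖Q (t + y * Complex.I)‖ ≤ C₁ * Real.exp (-b * t ^ 2)) (x : ℝ) :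
    ‖∑' n : ℤ, Q (n : ℝ) - ∑' n : ℤ, Q ((x + n : ℝ))‖ ≤
      4 * C₁ * √(π / b) * (Real.exp (-(2 * π * h)) / (1 - Real.exp (-(2 * π * h)))) := by
  have hC0 : 0 ≤ C := by
    have := (norm_nonneg _).trans (hC 0 0 (by simpa using hh.le))
    simpa using this
  have hC₁0 : 0 ≤ C₁ := by
    have := (norm_nonneg _).trans (hC₁ 0 h (abs_of_pos hh))
    simpa using this
  let F : C(ℝ, ℂ) := ⟨fun t : ℝ => Q t, hQ.continuous.comp Complex.continuous_ofReal⟩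
  have hFdec : ∀ t : ℝ, ‖F t‖ ≤ C * Real.exp (-b * t ^ 2) := fun t => by
    simpa [F] using hC t 0 (by simpa using hh.le)
  have hO : ∀ l : Filter ℝ, l ≤ cocompact ℝ → (F : ℝ → ℂ) =O[l] fun x : ℝ => |x| ^ (-2 : ℝ) := by
    intro l hl
    have h1 : (F : ℝ → ℂ) =O[l] fun t : ℝ => Real.exp (-b * t ^ 2) := by
      refine Asymptotics.IsBigO.of_bound C (Eventually.of_forall fun t => ?_)
      rw [Real.norm_eq_abs, abs_of_pos (Real.exp_pos _)]
      exact hFdec t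
    refine h1.trans ?_
    have := (cexp_neg_quadratic_isLittleO_abs_rpow_cocompact (a := ((-b : ℝ) : ℂ)) (by simpa using hb) 0 (-2 : ℝ)).isBigO.mono hl
    refine Asymptotics.IsBigO.trans ?_ this
    refine Asymptotics.IsBigO.of_bound 1 (Eventually.of_forall fun t => ?_)
    rw [Complex.norm_exp]
    simp [← Complex.ofReal_pow]
  set z : ℝ := Real.exp (-(2 * π * h)) with hz
  have hz0 : 0 < z := Real.exp_pos _
  have hz1 : z < 1 := by
    rw [hz, Real.exp_lt_one_iff]
    have := mul_pos (mul_pos two_pos Real.pi_pos) hh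
    linarith
  set B : ℝ := C₁ * √(π / b) with hB
  have hB0 : 0 ≤ B := by positivity
  have hFn : ∀ n : ℤ, ‖𝓕 (F : ℝ → ℂ) n‖ ≤ B * z ^ n.natAbs := fun n => by
    refine (norm_fourier_le_of_strip hQ hb hh hC hC₁ (n : ℝ)).trans (le_of_eq ?_)
    rw [hz, ← Real.exp_nat_mul, Nat.cast_natAbs, Int.cast_abs]
    congr 2
    ring
  -- The zeroth Fourier coefficient does not see the offset and cancels. For n ≠ 0 two unimodular
  -- characters differ by at most 2, whence the factor.
  set u : ℤ → ℝ := fun n => if n = 0 then 0 else 2 * B * z ^ n.natAbs with hu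
  have husum : HasSum u (2 * (2 * B * (z / (1 - z)))) := hasSum_int_geometric (2 * B) hz0.le hz1
  have hFsum : Summable fun n : ℤ => 𝓕 (F : ℝ → ℂ) n := by
    have h2 : Summable fun n : ℤ => B * z ^ n.natAbs := by
      refine Summable.of_nat_of_neg_add_one ?_ ?_
      · simpa using (summable_geometric_of_lt_one hz0.le hz1).mul_left B
      · have := ((summable_nat_add_iff 1).2 (summable_geometric_of_lt_one hz0.le hz1)).mul_left B
        have e : (fun n : ℕ => B * z ^ (-((n : ℤ) + 1)).natAbs) = fun n => B * z ^ (n + 1) := by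
          ext n; congr 2
        rw [e]
        exact this
    exact Summable.of_norm_bounded h2 hFn
  have hpois := fun y : ℝ => Real.tsum_eq_tsum_fourier_of_rpow_decay_of_summable F.continuous one_lt_two
    (hO _ le_rfl) hFsum y
  have hfour : ∀ (n : ℤ) (y : ℝ), ‖(fourier n (y : UnitAddCircle) : ℂ)‖ = 1 := fun n y => by
    rw [fourier_apply]; exact Circle.norm_coe _
  have hsx : ∀ y : ℝ, Summable fun n : ℤ => 𝓕 (F : ℝ → ℂ) n * fourier n (y : UnitAddCircle) := by
    intro y
    refine Summable.of_norm ?_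
    simpa only [norm_mul, hfour, mul_one] using hFsum.norm
  have e0 : ∑' n : ℤ, Q (n : ℝ) = ∑' n : ℤ, F (0 + n) := by simp [F]
  have ex : ∑' n : ℤ, Q ((x + n : ℝ)) = ∑' n : ℤ, F (x + n) := by simp [F]
  rw [e0, ex, hpois 0, hpois x, ← (hsx 0).tsum_sub (hsx x)]
  refine (tsum_of_norm_bounded husum fun n => ?_).trans (le_of_eq (by rw [hB]; ring))
  simp only [hu]
  split_ifs with hn
  · subst hn; simp
  · rw [← mul_sub, norm_mul]
    calc _ ≤ (B * z ^ n.natAbs) * (1 + 1) := by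
          gcongr
          · exact hFn n
          · exact (norm_sub_le _ _).trans (by rw [hfour, hfour])
      _ = _ := by ring

/-- Sums over a shifted copy of `ℤ` of a function dominated by a radial one. -/
theorem summable_int_shift {u : ℝ → ℝ} {v : ℕ → ℝ} (hu : ∀ t, 0 ≤ u t) (hv : Summable v)
    (huv : ∀ (j : ℕ) (t : ℝ), (j : ℝ) ≤ |t| → u t ≤ v j) (x : ℝ) :
    Summable (fun n : ℤ => u (x + n)) ∧ ∑' n : ℤ, u (x + n) ≤ 2 * ∑' j, v j := by
  have hf0 := Int.fract_nonneg x
  have hf1 := Int.fract_lt_one x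
  have hx := Int.floor_add_fract x
  -- After translation by ⌊x⌋ the points are j + fract x and -(j + 1 - fract x) with j ≥ 0, both of
  -- modulus at least j.
  have key1 : ∀ j : ℕ, u (x + ((j : ℤ) + -⌊x⌋ : ℤ)) ≤ v j := fun j => by
    refine huv j _ ?_
    push_cast
    rw [show x + ((j : ℝ) + -(⌊x⌋ : ℝ)) = j + Int.fract x by linarith]
    exact (le_add_of_nonneg_right hf0).trans (le_abs_self _)
  have key2 : ∀ j : ℕ, u (x + ((-((j : ℤ) + 1)) + -⌊x⌋ : ℤ)) ≤ v j := fun j => by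
    refine huv j _ ?_
    push_cast
    rw [show x + (-((j : ℝ) + 1) + -(⌊x⌋ : ℝ)) = -(j + (1 - Int.fract x)) by linarith, abs_neg]
    exact (le_add_of_nonneg_right (by linarith)).trans (le_abs_self _)
  have s1 : Summable fun j : ℕ => u (x + ((j : ℤ) + -⌊x⌋ : ℤ)) :=
    Summable.of_nonneg_of_le (fun _ => hu _) key1 hv
  have s2 : Summable fun j : ℕ => u (x + ((-((j : ℤ) + 1)) + -⌊x⌋ : ℤ)) :=
    Summable.of_nonneg_of_le (fun _ => hu _) key2 hv
  have hs := HasSum.of_nat_of_neg_add_one (f := fun i : ℤ => u (x + (i + -⌊x⌋ : ℤ)))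
    s1.hasSum s2.hasSum
  have hs' : HasSum (fun n : ℤ => u (x + n)) _ :=
    (Equiv.hasSum_iff (Equiv.addRight (-⌊x⌋)) (f := fun n : ℤ => u (x + n))).1 hs
  refine ⟨hs'.summable, ?_⟩
  rw [hs'.tsum_eq, two_mul]
  exact add_le_add (s1.tsum_le_tsum key1 hv) (s2.tsum_le_tsum key2 hv)

/-! ### Sinc kernels and recovery of entire functions from samples -/

noncomputable section

/-- The entire function `sin z / z`. -/
def csinc (z : ℂ) : ℂ := dslope Complex.sin 0 z

end

theorem csinc_zero : csinc 0 = 1 := by simp [csinc]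

theorem csinc_of_ne {z : ℂ} (hz : z ≠ 0) : csinc z = Complex.sin z / z := by
  rw [csinc, dslope_of_ne _ hz, slope_def_field]
  simp

theorem differentiable_csinc : Differentiable ℂ csinc := by
  rw [← differentiableOn_univ]
  exact (Complex.differentiableOn_dslope univ_mem).2 Complex.differentiable_sin.differentiableOn

theorem norm_csin_le (z : ℂ) : ‖Complex.sin z‖ ≤ Real.exp |z.im| := by
  rw [Complex.sin]
  have h1 : ‖Complex.exp (-z * Complex.I)‖ ≤ Real.exp |z.im| := by
    rw [Complex.norm_exp]
    refine Real.exp_le_exp.2 ?_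
    simp [le_abs_self]
  have h2 : ‖Complex.exp (z * Complex.I)‖ ≤ Real.exp |z.im| := by
    rw [Complex.norm_exp]
    refine Real.exp_le_exp.2 ?_
    simp [neg_le_abs]
  rw [norm_div, norm_mul, Complex.norm_I, mul_one, Complex.norm_two]
  have := norm_sub_le (Complex.exp (-z * Complex.I)) (Complex.exp (z * Complex.I))
  linarith

theorem norm_csinc_le {z : ℂ} {y : ℝ} (hy : 0 < y) (hz : y ≤ ‖z‖) :
    ‖csinc z‖ ≤ Real.exp |z.im| / y := by
  have hz0 : z ≠ 0 := by rintro rfl; simp at hz; linarith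
  rw [csinc_of_ne hz0, norm_div]
  exact div_le_div₀ (Real.exp_pos _).le (norm_csin_le z) hy hz

theorem norm_csinc_real_le_one (x : ℝ) : ‖csinc x‖ ≤ 1 := by
  by_cases hx : x = 0
  · subst hx; simp [csinc_zero]
  · rw [csinc_of_ne (by exact_mod_cast hx), norm_div, ← Complex.ofReal_sin, Complex.norm_real,
      Complex.norm_real, Real.norm_eq_abs, Real.norm_eq_abs]
    exact div_le_one_of_le₀ (Real.abs_sin_le_abs) (abs_nonneg _)

theorem norm_csinc_real_le (x : ℝ) (hx : x ≠ 0) : ‖csinc x‖ ≤ 1 / |x| := by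
  have := norm_csinc_le (z := x) (abs_pos.2 hx) (by simp)
  simpa using this

/-- Purely qualitative: it supplies the interior constant of the contour shift, on which no final
estimate depends. -/
theorem exists_norm_csinc_le (h : ℝ) : ∃ B : ℝ, 0 ≤ B ∧ ∀ z : ℂ, |z.im| ≤ h → ‖csinc z‖ ≤ B := by
  obtain ⟨B, hB⟩ := (isCompact_closedBall (0 : ℂ) 1).exists_bound_of_continuousOn
    differentiable_csinc.continuous.continuousOn
  refine ⟨max B (Real.exp h), le_max_of_le_right (Real.exp_pos _).le, fun z hz => ?_⟩
  rcases le_total ‖z‖ 1 with h1 | h1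
  · exact (hB z (by simpa using h1)).trans (le_max_left _ _)
  · refine (norm_csinc_le one_pos h1).trans ?_
    rw [div_one]
    exact (Real.exp_le_exp.2 hz).trans (le_max_right _ _)

theorem csinc_pi_mul_int {n : ℤ} (hn : n ≠ 0) : csinc (Real.pi * n) = 0 := by
  rw [csinc_of_ne (by simp [hn, Real.pi_ne_zero]), mul_comm, Complex.sin_int_mul_pi, zero_div]

-- Since s²h = 0.059, every exponent is a multiple of h: Gaussian growth costs (2π + 20)·0.059 ≈
-- 1.551, the two sinc factors cost 1.01π, and Poisson summation gains 2π. The net gain of about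
-- 1.559·h exceeds L ≤ (0.09/0.059)·h ≈ 1.526·h. The remaining prefactor is small because s ≤ 1/17.
open Real in
theorem sampling_error_le {s L M h : ℝ} (hs : 0 < s) (hN : 17 * s ≤ 1) (hL : L * s ^ 2 ≤ 0.09)
    (hM0 : 0 ≤ M) (hh : h = 0.059 / s ^ 2) :
    4 * (M * Real.exp ((2 * π + 20) * s ^ 2 * h ^ 2) * (Real.exp (π * h) / (π * h) *
        (Real.exp (π / 100 * h) / (π / 100 * h)))) * √(π / (20 * s ^ 2)) *
      (Real.exp (-(2 * π * h)) / (1 - Real.exp (-(2 * π * h)))) ≤ 2 * (M * Real.exp (-L)) := by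
  have hh0 : 0 < h := by rw [hh]; positivity
  have hpi1 := Real.pi_gt_d4
  have hpi2 := Real.pi_lt_d4
  have hh1 : 1 ≤ h := by
    rw [hh, le_div_iff₀ (by positivity)]
    nlinarith
  have hz : Real.exp (-(2 * π * h)) ≤ 1 / 2 := by
    have : Real.exp (-(2 * π * h)) ≤ Real.exp (-1) := Real.exp_le_exp.2 (by nlinarith)
    have := Real.exp_neg_one_lt_d9
    linarith
  have hz0 := Real.exp_pos (-(2 * π * h))
  have h1 : Real.exp (-(2 * π * h)) / (1 - Real.exp (-(2 * π * h))) ≤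
      2 * Real.exp (-(2 * π * h)) := by
    rw [div_le_iff₀ (by linarith)]
    nlinarith
  have h2 : √(π / (20 * s ^ 2)) ≤ 0.4 / s := by
    rw [Real.sqrt_le_left (by positivity), div_pow]
    rw [div_le_div_iff₀ (by positivity) (by positivity)]
    nlinarith [sq_nonneg s]
  have h3 : Real.exp ((2 * π + 20) * s ^ 2 * h ^ 2) * (Real.exp (π * h) *
      Real.exp (π / 100 * h)) * Real.exp (-(2 * π * h)) ≤ Real.exp (-L) := by
    rw [← Real.exp_add, ← Real.exp_add, ← Real.exp_add]
    refine Real.exp_le_exp.2 ?_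
    have hsh : s ^ 2 * h = 0.059 := by rw [hh]; field_simp
    have e1 : (2 * π + 20) * s ^ 2 * h ^ 2 = (2 * π + 20) * 0.059 * h := by
      rw [← hsh]; ring
    have hLh : L * 0.059 ≤ 0.09 * h := by
      rw [← hsh]
      have := mul_le_mul_of_nonneg_right hL hh0.le
      linarith
    rw [e1]
    have : 3.1415 * h ≤ π * h := by gcongr
    linarith
  have h4 : 100 * (4 * 0.4 * 2) / (π ^ 2 * h ^ 2 * s) ≤ 2 := by
    rw [div_le_iff₀ (by positivity), hh, div_pow]
    have h5 : (9.8 : ℝ) ≤ π ^ 2 := by nlinarith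
    have h6 : s ^ 3 * 4913 ≤ 1 := by
      have : (17 * s) ^ 3 ≤ 1 := pow_le_one₀ (by positivity) hN
      nlinarith
    have h7 : (0.059 ^ 2 / (s ^ 2) ^ 2 * s : ℝ) = 0.003481 / s ^ 3 := by field_simp; norm_num
    have h8 : (17.1:ℝ) ≤ 0.003481 / s ^ 3 := by
      rw [le_div_iff₀ (by positivity)]; nlinarith
    calc (100 * (4 * 0.4 * 2) : ℝ) ≤ 2 * (9.8 * 17.1) := by norm_num
      _ ≤ 2 * (π ^ 2 * (0.003481 / s ^ 3)) := by gcongr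
      _ = _ := by rw [← h7]; ring
  calc _ ≤ 4 * (M * Real.exp ((2 * π + 20) * s ^ 2 * h ^ 2) * (Real.exp (π * h) / (π * h) *
      (Real.exp (π / 100 * h) / (π / 100 * h)))) * (0.4 / s) *
      (2 * Real.exp (-(2 * π * h))) := by
          gcongr
          exact div_nonneg hz0.le (by linarith)
    _ = 100 * (4 * 0.4 * 2) / (π ^ 2 * h ^ 2 * s) * (M * (Real.exp ((2 * π + 20) * s ^ 2 * h ^ 2) *
      (Real.exp (π * h) * Real.exp (π / 100 * h)) * Real.exp (-(2 * π * h)))) := by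
        field_simp
    _ ≤ 2 * (M * Real.exp (-L)) := by gcongr

-- The function Q(τ) = g(x₀ + sτ)·e^{-20s²τ²}·sinc(πτ)·sinc(πτ/100) vanishes at all integers but 0,
-- where it equals g(x₀). Its sum over ℤ is thus g(x₀), while its sum over the grid offset by -x₀/s
-- involves only the samples g(sn). By Poisson summation the two sums differ by at most 2Me^{-L}.
-- The Gaussian suppresses samples outside the window W, where only the global bound M is available.
open Real in
theorem norm_le_of_samples {g : ℂ → ℂ} (hg : Differentiable ℂ g) {M δ L s x₀ W : ℝ} (hs : 0 < s)
    (hN : 17 * s ≤ 1) (hL : L * s ^ 2 ≤ 0.09)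
    (hM : ∀ x y : ℝ, ‖g (x + y * Complex.I)‖ ≤ M * Real.exp (2 * π * y ^ 2))
    (hW0 : 0 ≤ W) (hW : L ≤ 20 * W ^ 2)
    (hδ : ∀ n : ℤ, |s * n - x₀| ≤ W → ‖g ((s * n : ℝ))‖ ≤ δ) (hδM : M * Real.exp (-L) ≤ δ) :
    ‖g x₀‖ ≤ 40 * δ := by
  have hM0 : 0 ≤ M := by
    have := (norm_nonneg _).trans (hM 0 0)
    simpa using this
  set h : ℝ := 0.059 / s ^ 2 with hh
  have hh0 : 0 < h := by positivity
  set V : ℂ → ℂ := fun τ => csinc (π * τ) * csinc (π / 100 * τ) with hV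
  set Q : ℂ → ℂ := fun τ => g (x₀ + s * τ) * Complex.exp (-(20 * s ^ 2) * τ ^ 2) * V τ with hQ
  have hVd : Differentiable ℂ V :=
    (differentiable_csinc.comp (by fun_prop)).mul (differentiable_csinc.comp (by fun_prop))
  have hQd : Differentiable ℂ Q :=
    ((hg.comp (by fun_prop)).mul (by fun_prop)).mul hVd
  have hnQ : ∀ t y : ℝ, ‖Q (t + y * Complex.I)‖ ≤
      M * Real.exp ((2 * π + 20) * s ^ 2 * y ^ 2) * ‖V (t + y * Complex.I)‖ *
        Real.exp (-(20 * s ^ 2) * t ^ 2) := by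
    intro t y
    simp only [hQ, norm_mul]
    have e1 : (x₀ : ℂ) + s * (t + y * Complex.I) = ((x₀ + s * t : ℝ) : ℂ) +
        ((s * y : ℝ) : ℂ) * Complex.I := by push_cast; ring
    have e2 : ‖Complex.exp (-(20 * s ^ 2) * (t + y * Complex.I) ^ 2)‖ =
        Real.exp (-(20 * s ^ 2) * t ^ 2) * Real.exp (20 * s ^ 2 * y ^ 2) := by
      rw [Complex.norm_exp, ← Real.exp_add]
      congr 1
      have : (-(20 * (s : ℂ) ^ 2) * (t + y * Complex.I) ^ 2) =
        ((-(20 * s ^ 2) * t ^ 2 + 20 * s ^ 2 * y ^ 2 : ℝ) : ℂ) +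
          ((-(40 * s ^ 2) * t * y : ℝ) : ℂ) * Complex.I := by
        push_cast
        linear_combination (-(20 * (s : ℂ) ^ 2) * y ^ 2) * Complex.I_sq
      rw [this, Complex.add_re, Complex.ofReal_re, Complex.re_ofReal_mul, Complex.I_re]
      ring
    rw [e1, e2]
    have h1 := hM (x₀ + s * t) (s * y)
    have e3 : Real.exp ((2 * π + 20) * s ^ 2 * y ^ 2) =
        Real.exp (2 * π * (s * y) ^ 2) * Real.exp (20 * s ^ 2 * y ^ 2) := by
      rw [← Real.exp_add]; congr 1; ring
    rw [e3]
    calc _ ≤ M * Real.exp (2 * π * (s * y) ^ 2) *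
          (Real.exp (-(20 * s ^ 2) * t ^ 2) * Real.exp (20 * s ^ 2 * y ^ 2)) *
          ‖V (t + y * Complex.I)‖ := by gcongr
      _ = _ := by ring
  obtain ⟨B, hB0, hB⟩ := exists_norm_csinc_le (π * h)
  have him : ∀ (c t y : ℝ), ((c : ℂ) * (t + y * Complex.I)).im = c * y := by intro c t y; simp
  have hre : ∀ (c t y : ℝ), |c * y| ≤ ‖(c : ℂ) * (t + y * Complex.I)‖ := fun c t y => by
    rw [← him c t y]; exact Complex.abs_im_le_norm _
  have hC : ∀ t y : ℝ, |y| ≤ h → ‖Q (t + y * Complex.I)‖ ≤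
      (M * Real.exp ((2 * π + 20) * s ^ 2 * h ^ 2) * (B * B)) *
        Real.exp (-(20 * s ^ 2) * t ^ 2) := by
    intro t y hy
    refine (hnQ t y).trans ?_
    have hy2 : y ^ 2 ≤ h ^ 2 := sq_le_sq.2 (by rwa [abs_of_pos hh0])
    have hv : ‖V (t + y * Complex.I)‖ ≤ B * B := by
      simp only [hV, norm_mul]
      refine mul_le_mul (hB _ ?_) (hB _ ?_) (norm_nonneg _) hB0
      · rw [him, abs_mul, abs_of_pos Real.pi_pos]; gcongr
      · have := him (π / 100) t y
        push_cast at this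
        rw [this, abs_mul, abs_of_pos (by positivity)]
        gcongr
        linarith [Real.pi_pos]
    gcongr
  have hC₁ : ∀ t y : ℝ, |y| = h → ‖Q (t + y * Complex.I)‖ ≤
      (M * Real.exp ((2 * π + 20) * s ^ 2 * h ^ 2) * (Real.exp (π * h) / (π * h) *
        (Real.exp (π / 100 * h) / (π / 100 * h)))) * Real.exp (-(20 * s ^ 2) * t ^ 2) := by
    intro t y hy
    refine (hnQ t y).trans ?_
    have hy2 : y ^ 2 = h ^ 2 := by rw [← hy, sq_abs]
    have hv : ‖V (t + y * Complex.I)‖ ≤ Real.exp (π * h) / (π * h) *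
        (Real.exp (π / 100 * h) / (π / 100 * h)) := by
      simp only [hV, norm_mul]
      have key : ∀ c : ℝ, 0 < c → ‖csinc (c * (t + y * Complex.I))‖ ≤
          Real.exp (c * h) / (c * h) := fun c hc => by
        have h1 : |c * y| = c * h := by rw [abs_mul, abs_of_pos hc, hy]
        have := norm_csinc_le (z := (c : ℂ) * (t + y * Complex.I)) (y := c * h) (by positivity)
          (by rw [← h1]; exact hre c t y)
        rwa [him, h1] at this
      have k2 := key (π / 100) (by positivity)
      push_cast at k2
      exact mul_le_mul (key π Real.pi_pos) k2 (norm_nonneg _) (by positivity)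
    rw [hy2]
    gcongr
  have hmain := norm_tsum_sub_tsum_add_le hQd (b := 20 * s ^ 2) (by positivity) hh0 hC hC₁ (-(x₀ / s))
  have hsum0 : ∑' n : ℤ, Q (n : ℝ) = g x₀ := by
    rw [tsum_eq_single (0 : ℤ)]
    · simp [hQ, hV, csinc_zero]
    · intro n hn
      have := csinc_pi_mul_int hn
      simp [hQ, hV, this]
  have hδ0 : 0 ≤ δ := le_trans (by positivity) hδM
  -- The second sinc factor gives decay 1/j², so the weights are summable uniformly in s: over both
  -- half-lines they contribute 2(1 + 100/6) < 36.
  have hv : HasSum (fun j : ℕ => (if j = 0 then (1:ℝ) else 0) + 100 / π ^ 2 * (1 / (j : ℝ) ^ 2))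
      (1 + 100 / π ^ 2 * (π ^ 2 / 6)) :=
    (hasSum_ite_eq 0 1).add (hasSum_zeta_two.mul_left _)
  have hVr : ∀ t : ℝ, V t = csinc ((π * t : ℝ)) * csinc ((π / 100 * t : ℝ)) := fun t => by
    simp only [hV]; push_cast; rfl
  have huv : ∀ (j : ℕ) (t : ℝ), (j : ℝ) ≤ |t| →
      ‖V t‖ ≤ (if j = 0 then (1:ℝ) else 0) + 100 / π ^ 2 * (1 / (j : ℝ) ^ 2) := by
    intro j t hjt
    rw [hVr, norm_mul]
    rcases Nat.eq_zero_or_pos j with rfl | hj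
    · simp only [if_true, Nat.cast_zero]
      have := mul_le_mul (norm_csinc_real_le_one (π * t)) (norm_csinc_real_le_one (π / 100 * t))
        (norm_nonneg _) zero_le_one
      simpa using this
    · rw [if_neg hj.ne', zero_add]
      have hj' : (0 : ℝ) < j := by exact_mod_cast hj
      have ht : 0 < |t| := hj'.trans_le hjt
      have ht' : t ≠ 0 := abs_pos.1 ht
      have h1 := norm_csinc_real_le (π * t) (mul_ne_zero Real.pi_ne_zero ht')
      have h2 := norm_csinc_real_le (π / 100 * t)
        (mul_ne_zero (div_ne_zero Real.pi_ne_zero (by norm_num)) ht')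
      rw [abs_mul, abs_of_pos (by positivity)] at h1 h2
      calc _ ≤ (1 / (π * |t|)) * (1 / (π / 100 * |t|)) :=
            mul_le_mul h1 h2 (norm_nonneg _) (by positivity)
        _ ≤ (1 / (π * j)) * (1 / (π / 100 * j)) := by gcongr
        _ = _ := by field_simp
  have hVsum := summable_int_shift (u := fun t : ℝ => ‖V t‖) (fun _ => norm_nonneg _) hv.summable huv
    (-(x₀ / s))
  rw [hv.tsum_eq] at hVsum
  have hsum1 : ‖∑' n : ℤ, Q ((-(x₀ / s) + n : ℝ))‖ ≤ 36 * δ := by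
    have hb : ∀ n : ℤ, ‖Q ((-(x₀ / s) + n : ℝ))‖ ≤ δ * ‖V ((-(x₀ / s) + n : ℝ))‖ := by
      intro n
      have e1 : (x₀ : ℂ) + s * ((-(x₀ / s) + n : ℝ) : ℂ) = ((s * n : ℝ) : ℂ) := by
        have : x₀ + s * (-(x₀ / s) + n) = s * n := by field_simp; ring
        rw [← this]; push_cast; ring
      have e2 : Complex.exp (-(20 * s ^ 2) * ((-(x₀ / s) + n : ℝ) : ℂ) ^ 2) =
          ((Real.exp (-20 * (s * n - x₀) ^ 2) : ℝ) : ℂ) := by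
        have : -20 * (s * n - x₀) ^ 2 = -(20 * s ^ 2) * (-(x₀ / s) + n) ^ 2 := by
          field_simp; ring
        rw [this]; push_cast; rfl
      simp only [hQ, norm_mul]
      rw [e1, e2, Complex.norm_real, Real.norm_eq_abs, abs_of_pos (Real.exp_pos _)]
      refine mul_le_mul_of_nonneg_right ?_ (norm_nonneg _)
      by_cases hn : |s * n - x₀| ≤ W
      · calc _ ≤ δ * 1 := by
              gcongr
              · exact hδ n hn
              · rw [Real.exp_le_one_iff]; nlinarith [sq_nonneg (s * n - x₀)]
          _ = δ := mul_one _
      · push Not at hn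
        have h1 : ‖g ((s * n : ℝ))‖ ≤ M := by simpa using hM (s * n) 0
        have h2 : L ≤ 20 * (s * n - x₀) ^ 2 := by
          have := mul_self_le_mul_self hW0 hn.le
          rw [abs_mul_abs_self] at this
          nlinarith
        refine le_trans ?_ hδM
        gcongr
        linarith
    have hs2 := hVsum.1.mul_left δ
    refine (tsum_of_norm_bounded hs2.hasSum hb).trans ?_
    rw [tsum_mul_left, mul_comm]
    refine mul_le_mul_of_nonneg_right (hVsum.2.trans ?_) hδ0
    have : 100 / π ^ 2 * (π ^ 2 / 6) = 100 / 6 := by field_simp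
    rw [this]; norm_num
  have herr := sampling_error_le hs hN hL hM0 hh
  rw [hsum0] at hmain
  have := norm_add_le (g x₀ - ∑' n : ℤ, Q ((-(x₀ / s) + n : ℝ))) (∑' n : ℤ, Q ((-(x₀ / s) + n : ℝ)))
  rw [sub_add_cancel] at this
  linarith

/-- Hadamard's three lines theorem with a Gaussian localization. -/
theorem norm_le_three_lines {g : ℂ → ℂ} (hg : Differentiable ℂ g) {M A W α y H : ℝ} (hα : 0 < α)
    (hy : 0 < y) (hyH : y ≤ H)
    (hM : ∀ x y : ℝ, ‖g (x + y * Complex.I)‖ ≤ M * Real.exp (2 * Real.pi * y ^ 2))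
    (hW : 0 ≤ W) (hA : ∀ t : ℝ, |t| ≤ W → ‖g t‖ ≤ A) (hMA : M * Real.exp (-α * W ^ 2) ≤ A) :
    ‖g (y * Complex.I)‖ ≤ Real.exp (-α * y ^ 2) * (A ^ (1 - y / H) *
      (M * Real.exp ((2 * Real.pi + α) * H ^ 2)) ^ (y / H)) := by
  have hM0 : 0 ≤ M := by
    have := (norm_nonneg _).trans (hM 0 0)
    simpa using this
  have hH : 0 < H := hy.trans_le hyH
  -- Rotation turns the real axis into an edge of a vertical strip. The factor e^{αw²} decays along
  -- that edge, which replaces the missing smallness of g beyond W, and is divided out at the end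
  -- with the gain e^{-αy²}.
  set f : ℂ → ℂ := fun w => g (w * Complex.I) * Complex.exp (α * w ^ 2) with hf
  have hfd : Differentiable ℂ f := (hg.comp (by fun_prop)).mul (by fun_prop)
  have hn : ∀ w : ℂ, ‖f w‖ = ‖g (((-w.im : ℝ) : ℂ) + (w.re : ℂ) * Complex.I)‖ *
      (Real.exp (α * w.re ^ 2) * Real.exp (-α * w.im ^ 2)) := by
    intro w
    have e1 : w * Complex.I = ((-w.im : ℝ) : ℂ) + (w.re : ℂ) * Complex.I := by
      conv_lhs => rw [← Complex.re_add_im w]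
      push_cast
      linear_combination (w.im : ℂ) * Complex.I_sq
    simp only [hf]
    rw [norm_mul, e1, Complex.norm_exp, Complex.re_ofReal_mul, ← Real.exp_add]
    congr 3
    rw [sq, Complex.mul_re]
    ring
  have hbd : ∀ w : ℂ, ‖f w‖ ≤ M * Real.exp ((2 * Real.pi + α) * w.re ^ 2) *
      Real.exp (-α * w.im ^ 2) := by
    intro w
    rw [hn]
    have e : Real.exp ((2 * Real.pi + α) * w.re ^ 2) =
      Real.exp (2 * Real.pi * w.re ^ 2) * Real.exp (α * w.re ^ 2) := by
        rw [← Real.exp_add]; congr 1; ring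
    rw [e]
    calc _ ≤ M * Real.exp (2 * Real.pi * w.re ^ 2) *
        (Real.exp (α * w.re ^ 2) * Real.exp (-α * w.im ^ 2)) := by gcongr; exact hM _ _
      _ = _ := by ring
  have hle1 : ∀ x : ℝ, Real.exp (-α * x ^ 2) ≤ 1 := fun x => by
    rw [Real.exp_le_one_iff]; nlinarith [sq_nonneg x]
  have hpi := Real.pi_pos
  have key := Complex.HadamardThreeLines.norm_le_interp_of_mem_verticalClosedStrip' (f := f)
    (z := (y : ℂ)) (a := A) (b := M * Real.exp ((2 * Real.pi + α) * H ^ 2)) (l := 0) (u := H) hH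
    ?_ hfd.diffContOnCl ?_ ?_ ?_
  · rw [hn] at key
    simp only [Complex.ofReal_im, neg_zero, Complex.ofReal_zero, zero_add, Complex.ofReal_re,
      sub_zero] at key
    have e : Real.exp (-α * 0 ^ 2) = 1 := by simp
    rw [e, mul_one] at key
    have e2 : Real.exp (-α * y ^ 2) * Real.exp (α * y ^ 2) = 1 := by
      rw [← Real.exp_add]; simp
    calc ‖g (y * Complex.I)‖ = Real.exp (-α * y ^ 2) * (‖g (y * Complex.I)‖ *
          Real.exp (α * y ^ 2)) := by rw [mul_left_comm, e2, mul_one]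
      _ ≤ _ := by gcongr
  · simp [Complex.HadamardThreeLines.verticalClosedStrip, hy.le, hyH]
  · refine ⟨M * Real.exp ((2 * Real.pi + α) * H ^ 2), ?_⟩
    rintro _ ⟨w, hw, rfl⟩
    simp only [Complex.HadamardThreeLines.verticalClosedStrip, Set.mem_preimage, Set.mem_Icc] at hw
    refine (hbd w).trans ?_
    calc _ ≤ M * Real.exp ((2 * Real.pi + α) * H ^ 2) * 1 := by
          have : w.re ^ 2 ≤ H ^ 2 := pow_le_pow_left₀ hw.1 hw.2 2
          gcongr
          exact hle1 _
      _ = _ := mul_one _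
  · intro w hw
    simp only [Set.mem_preimage, Set.mem_singleton_iff] at hw
    rw [hn, hw]
    simp only [Complex.ofReal_zero, zero_mul, add_zero]
    have e : Real.exp (α * 0 ^ 2) = 1 := by simp
    rw [e, one_mul]
    have hg0 : ‖g ((-w.im : ℝ) : ℂ)‖ ≤ M := by simpa using hM (-w.im) 0
    by_cases h : |-w.im| ≤ W
    · calc _ ≤ A * 1 := by
            gcongr
            · exact (norm_nonneg _).trans (hA _ h)
            · exact hA _ h
            · exact hle1 _
        _ = A := mul_one A
    · push Not at h
      refine le_trans ?_ hMA
      have : W ^ 2 ≤ w.im ^ 2 := by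
        rw [← sq_abs w.im, ← abs_neg]; exact pow_le_pow_left₀ hW h.le 2
      have h2 : -α * w.im ^ 2 ≤ -α * W ^ 2 := by nlinarith
      gcongr
  · intro w hw
    simp only [Set.mem_preimage, Set.mem_singleton_iff] at hw
    refine (hbd w).trans ?_
    rw [hw]
    calc _ ≤ M * Real.exp ((2 * Real.pi + α) * H ^ 2) * 1 := by gcongr; exact hle1 _
      _ = _ := mul_one _

/-- Three lines in two regimes. For y ≥ 0.16√L the margin gives W ≥ 1.6√L, so α = π/8 is admissible
(1.6²·π/8 > 1). Taking H = 2y yields weight exactly 1/2 and the exponent ½(2π + π/8)·4 - π/8 =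
33π/8. For smaller y only W ≥ 1.44√L is available, which forces α = 0.483. Then H = 2.5y leaves
weight 3/5 on the small edge, and the surplus e^{-L/10} pays for the faster growth because y² ≤
0.0256·L. At y = 0 the geometric mean of the two bounds suffices. -/
theorem norm_le_continuation {g : ℂ → ℂ} (hg : Differentiable ℂ g) {M L y W : ℝ} (hL : 0 ≤ L)
    (hy : 0 ≤ y) (hyW : 1.44 * √L + y ≤ W)
    (hM : ∀ x y : ℝ, ‖g (x + y * Complex.I)‖ ≤ M * Real.exp (2 * Real.pi * y ^ 2))
    (hA : ∀ t : ℝ, |t| ≤ W → ‖g t‖ ≤ 1600 * (M * Real.exp (-L))) :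
    ‖g (y * Complex.I)‖ ≤ 100 * M * Real.exp (-L / 2 + 33 * Real.pi / 8 * y ^ 2) := by
  have hM0 : 0 ≤ M := by
    have := (norm_nonneg _).trans (hM 0 0)
    simpa using this
  have hpi1 := Real.pi_gt_d4
  have hpi2 := Real.pi_lt_d4
  set l := √L with hl
  have hl0 : 0 ≤ l := Real.sqrt_nonneg _
  have hLl : L = l ^ 2 := (Real.sq_sqrt hL).symm
  have hW0 : 0 ≤ W := by linarith [mul_nonneg (by norm_num : (0:ℝ) ≤ 1.44) hl0]
  have hexp : ∀ α : ℝ, 0 < α → l ^ 2 ≤ α * W ^ 2 →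
      M * Real.exp (-α * W ^ 2) ≤ 1600 * (M * Real.exp (-L)) := fun α _ h => by
    have : Real.exp (-α * W ^ 2) ≤ Real.exp (-L) := Real.exp_le_exp.2 (by linarith)
    have h2 : M * Real.exp (-α * W ^ 2) ≤ M * Real.exp (-L) := by gcongr
    have h3 : 0 ≤ M * Real.exp (-L) := by positivity
    linarith
  rcases hy.eq_or_lt with rfl | hy
  · have := hA 0 (by simpa using hW0)
    have h2 : ‖g 0‖ ≤ M := by simpa using hM 0 0
    have e1 : Real.exp (-L / 2) * Real.exp (-L / 2) = Real.exp (-L) := by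
      rw [← Real.exp_add]; congr 1; ring
    simp only [Complex.ofReal_zero, zero_mul, ne_eq, OfNat.ofNat_ne_zero, not_false_eq_true,
      zero_pow, mul_zero, add_zero] at this ⊢
    refine abs_le_of_sq_le_sq' ?_ (by positivity) |>.2
    calc ‖g 0‖ ^ 2 = ‖g 0‖ * ‖g 0‖ := sq _
      _ ≤ (1600 * (M * Real.exp (-L))) * M := by gcongr
      _ ≤ 10000 * (M * Real.exp (-L)) * M := by gcongr; norm_num
      _ = _ := by rw [← e1]; ring
  by_cases hc : 0.16 * l ≤ y
  · have hW2 : l ^ 2 ≤ Real.pi / 8 * W ^ 2 := by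
      have : 1.6 * l ≤ W := by linarith
      have := pow_le_pow_left₀ (by positivity) this 2
      nlinarith
    have key := norm_le_three_lines hg (α := Real.pi / 8) (H := 2 * y) (by positivity) hy
      (by linarith) hM hW0 hA (hexp _ (by positivity) hW2)
    refine key.trans ?_
    have e : y / (2 * y) = 1 / 2 := by field_simp
    rw [e, show (1 : ℝ) - 1 / 2 = 1 / 2 by norm_num, ← Real.sqrt_eq_rpow, ← Real.sqrt_eq_rpow,
      ← Real.sqrt_mul (by positivity)]
    have e2 : 1600 * (M * Real.exp (-L)) * (M * Real.exp ((2 * Real.pi + Real.pi / 8) * (2 * y) ^ 2))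
      = (40 * M * Real.exp (-L / 2 + 17 * Real.pi / 4 * y ^ 2)) ^ 2 := by
      rw [mul_pow (40 * M), ← Real.exp_nat_mul]
      have : Real.exp (((2 : ℕ) : ℝ) * (-L / 2 + 17 * Real.pi / 4 * y ^ 2)) = Real.exp (-L) *
          Real.exp ((2 * Real.pi + Real.pi / 8) * (2 * y) ^ 2) := by
        rw [← Real.exp_add]; congr 1; push_cast; ring
      rw [this]; ring
    rw [e2, Real.sqrt_sq (by positivity)]
    have e3 : Real.exp (-(Real.pi / 8) * y ^ 2) * Real.exp (-L / 2 + 17 * Real.pi / 4 * y ^ 2) =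
      Real.exp (-L / 2 + 33 * Real.pi / 8 * y ^ 2) := by
      rw [← Real.exp_add]; congr 1; ring
    calc _ = 40 * M * (Real.exp (-(Real.pi / 8) * y ^ 2) *
          Real.exp (-L / 2 + 17 * Real.pi / 4 * y ^ 2)) := by ring
      _ ≤ _ := by rw [e3]; gcongr; norm_num
  · push Not at hc
    have hW2 : l ^ 2 ≤ 0.483 * W ^ 2 := by
      have : 1.44 * l ≤ W := by linarith
      have := pow_le_pow_left₀ (by positivity) this 2
      nlinarith
    have key := norm_le_three_lines hg (α := 0.483) (H := 2.5 * y) (by norm_num) hy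
      (by linarith) hM hW0 hA (hexp _ (by norm_num) hW2)
    refine key.trans ?_
    have e : y / (2.5 * y) = 2 / 5 := by field_simp; norm_num
    rw [e, show (1 : ℝ) - 2 / 5 = 3 / 5 by norm_num,
      Real.mul_rpow (by norm_num) (by positivity), Real.mul_rpow hM0 (by positivity),
      Real.mul_rpow hM0 (by positivity), ← Real.exp_mul, ← Real.exp_mul]
    have h1 : (1600 : ℝ) ^ (3 / 5 : ℝ) ≤ 100 := by
      have : (1600 : ℝ) ^ (3 / 5 : ℝ) = ((1600 : ℝ) ^ 3) ^ (1 / 5 : ℝ) := by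
        rw [← Real.rpow_natCast, ← Real.rpow_mul (by norm_num)]; norm_num
      rw [this]
      have h5 : (100 : ℝ) = ((100 : ℝ) ^ 5) ^ (1 / 5 : ℝ) := by
        rw [← Real.rpow_natCast, ← Real.rpow_mul (by norm_num)]; norm_num
      rw [h5]
      exact Real.rpow_le_rpow (by norm_num) (by norm_num) (by norm_num)
    have h2 : M ^ (3 / 5 : ℝ) * M ^ (2 / 5 : ℝ) = M := by
      rcases hM0.eq_or_lt with h | h
      · rw [← h, Real.zero_rpow (by norm_num), zero_mul]
      · rw [← Real.rpow_add h]; norm_num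
    have h3 : Real.exp (-0.483 * y ^ 2) * Real.exp (-L * (3 / 5)) *
        Real.exp ((2 * Real.pi + 0.483) * (2.5 * y) ^ 2 * (2 / 5)) ≤
        Real.exp (-L / 2 + 33 * Real.pi / 8 * y ^ 2) := by
      rw [← Real.exp_add, ← Real.exp_add]
      refine Real.exp_le_exp.2 ?_
      have hy2 : y ^ 2 ≤ 0.0256 * L := by
        have := pow_le_pow_left₀ hy.le hc.le 2
        rw [hLl]; nlinarith
      have : Real.pi * y ^ 2 ≤ 3.1416 * y ^ 2 := by gcongr
      nlinarith
    calc _ = (1600 : ℝ) ^ (3 / 5 : ℝ) * (M ^ (3 / 5 : ℝ) * M ^ (2 / 5 : ℝ)) *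
        (Real.exp (-0.483 * y ^ 2) * Real.exp (-L * (3 / 5)) *
        Real.exp ((2 * Real.pi + 0.483) * (2.5 * y) ^ 2 * (2 / 5))) := by ring
      _ ≤ _ := by rw [h2]; gcongr

/-- An entire function on `ℂ²` of Gaussian growth which is small on the points of a fine lattice in
a rectangle is small at complex points over a smaller rectangle. -/
theorem norm_le_of_lattice_samples {D : ℂ × ℂ → ℂ} (hD : Differentiable ℂ D)
    {M L s r R T S : ℝ} (hs : 0 < s) (hN : 17 * s ≤ 1) (hL : L * s ^ 2 ≤ 0.09) (hL0 : 0 ≤ L)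
    (hM : ∀ x₁ y₁ x₂ y₂ : ℝ, ‖D (x₁ + y₁ * Complex.I, x₂ + y₂ * Complex.I)‖ ≤
      M * Real.exp (2 * Real.pi * (y₁ ^ 2 + y₂ ^ 2)))
    (hr : 0 ≤ r) (hR : 5 / 3 * √L + r / 2 ≤ R)
    (hsamp : ∀ n m : ℤ, |s * n| ≤ T + R → |s * m| ≤ S + R →
      ‖D ((s * n : ℝ), (s * m : ℝ))‖ ≤ M * Real.exp (-L))
    {x₁ x₂ y₁ y₂ : ℝ} (hx₁ : |x₁| ≤ T) (hx₂ : |x₂| ≤ S) (hy : y₁ ^ 2 + y₂ ^ 2 ≤ (r / 2) ^ 2) :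
    ‖D (x₁ + y₁ * Complex.I, x₂ + y₂ * Complex.I)‖ ≤
      100 * M * Real.exp (-L / 2 + 33 * Real.pi / 8 * (y₁ ^ 2 + y₂ ^ 2)) := by
  have hM0 : 0 ≤ M := by
    have := (norm_nonneg _).trans (hM 0 0 0 0)
    simpa using this
  set l := √L with hl
  have hl0 : 0 ≤ l := Real.sqrt_nonneg _
  have hLl : L = l ^ 2 := (Real.sq_sqrt hL0).symm
  have hW : L ≤ 20 * (0.226 * l) ^ 2 := by rw [hLl]; nlinarith [sq_nonneg l]
  have hδ0 : 0 ≤ M * Real.exp (-L) := by positivity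
  -- The coordinates are filled in one at a time, each with window 0.226√L (20·0.226² > 1) and at
  -- the cost of a factor 40, whence 1600. Of the margin (5/3)√L this leaves the 1.44√L needed for
  -- continuation.
  have first : ∀ (t₁ : ℝ) (m : ℤ), |t₁| ≤ T + R - 0.226 * l → |s * m| ≤ S + R →
      ‖D (t₁, (s * m : ℝ))‖ ≤ 40 * (M * Real.exp (-L)) := by
    intro t₁ m ht₁ hm
    refine norm_le_of_samples (g := fun z => D (z, (s * m : ℝ))) (hD.comp (by fun_prop)) hs hN hL ?_
      (by positivity) hW ?_ le_rfl
    · intro x y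
      simpa using hM x y (s * m) 0
    · intro n hn
      refine hsamp n m ?_ hm
      have := abs_add_le (s * n - t₁) t₁
      rw [sub_add_cancel] at this
      linarith
  have second : ∀ t₁ t₂ : ℝ, |t₁| ≤ T + R - 0.226 * l → |t₂| ≤ S + R - 0.226 * l →
      ‖D (t₁, t₂)‖ ≤ 1600 * (M * Real.exp (-L)) := by
    intro t₁ t₂ ht₁ ht₂
    have := norm_le_of_samples (g := fun z => D (t₁, z)) (x₀ := t₂) (M := M)
      (δ := 40 * (M * Real.exp (-L))) (hD.comp (by fun_prop)) hs hN hL ?_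
      (by positivity) hW ?_ (by linarith)
    · linarith
    · intro x y
      simpa using hM t₁ 0 x y
    · intro m hm
      refine first t₁ m ht₁ ?_
      have := abs_add_le (s * m - t₂) t₂
      rw [sub_add_cancel] at this
      linarith
  -- Continuation runs along the complex line through the real point in the unit direction of the
  -- imaginary part, so the two-variable growth bound restricts to the one-variable one.
  obtain ⟨y, c₁, c₂, hy0, hc, h1, h2⟩ : ∃ y c₁ c₂ : ℝ, 0 ≤ y ∧ c₁ ^ 2 + c₂ ^ 2 = 1 ∧
      y₁ = y * c₁ ∧ y₂ = y * c₂ := by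
    by_cases h : y₁ ^ 2 + y₂ ^ 2 = 0
    · refine ⟨0, 1, 0, le_rfl, by norm_num, ?_, ?_⟩ <;> nlinarith [sq_nonneg y₁, sq_nonneg y₂]
    · have hpos : 0 < y₁ ^ 2 + y₂ ^ 2 := lt_of_le_of_ne (by positivity) (Ne.symm h)
      have hq := Real.sqrt_pos.2 hpos
      refine ⟨√(y₁ ^ 2 + y₂ ^ 2), y₁ / √(y₁ ^ 2 + y₂ ^ 2), y₂ / √(y₁ ^ 2 + y₂ ^ 2), hq.le, ?_, ?_, ?_⟩
      · rw [div_pow, div_pow, Real.sq_sqrt hpos.le, ← add_div, div_self h]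
      · field_simp
      · field_simp
  have hyy : y₁ ^ 2 + y₂ ^ 2 = y ^ 2 := by rw [h1, h2]; linear_combination y ^ 2 * hc
  rw [hyy] at hy ⊢
  have hyr : y ≤ r / 2 := abs_le_of_sq_le_sq' hy (by positivity) |>.2
  have hc1 : |c₁| ≤ 1 := abs_le_one_iff_mul_self_le_one.2 (by nlinarith [sq_nonneg c₂])
  have hc2 : |c₂| ≤ 1 := abs_le_one_iff_mul_self_le_one.2 (by nlinarith [sq_nonneg c₁])
  have key := norm_le_continuation (g := fun ζ => D (x₁ + ζ * c₁, x₂ + ζ * c₂)) (M := M) (L := L)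
    (y := y) (W := R - 0.226 * l) (hD.comp (by fun_prop)) hL0 hy0
    (by have : (1.44 : ℝ) * l ≤ (5 / 3 - 0.226) * l := by gcongr; norm_num
        linarith) ?_ ?_
  · rw [h1, h2]
    convert key using 4
    · push_cast; ring
    · push_cast; ring
  · intro a b
    have := hM (x₁ + a * c₁) (b * c₁) (x₂ + a * c₂) (b * c₂)
    have e : (b * c₁) ^ 2 + (b * c₂) ^ 2 = b ^ 2 := by linear_combination b ^ 2 * hc
    rw [e] at this
    convert this using 4
    · push_cast; ring
    · push_cast; ring
  · intro t ht
    have := second (x₁ + t * c₁) (x₂ + t * c₂) ?_ ?_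
    · push_cast at this
      exact this
    · have h3 := abs_add_le x₁ (t * c₁)
      have h4 : |t * c₁| ≤ |t| * 1 := by rw [abs_mul]; gcongr
      linarith
    · have h3 := abs_add_le x₂ (t * c₂)
      have h4 : |t * c₂| ≤ |t| * 1 := by rw [abs_mul]; gcongr
      linarith

/-! ### Entire extensions of Gabor transforms and spectrograms -/

noncomputable section

/-- The Bargmann-type transform `2^{1/4} ∫ f(t) e^{-πt² + 2πtw} dt`. -/
def bargmann (f : ℝ → ℂ) (w : ℂ) : ℂ :=
  ∫ t : ℝ, f t * ((((2 : ℝ) ^ (1 / 4 : ℝ) : ℝ) : ℂ) *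
    Complex.exp (-Real.pi * t ^ 2 + 2 * Real.pi * t * w))

/-- The function on phase space attached to a function `B` on `ℂ`. -/
def phaseFun (B : ℂ → ℂ) (p : ℝ × ℝ) : ℂ :=
  Complex.exp (-Real.pi * p.1 ^ 2) * B (p.1 - p.2 * Complex.I)

/-- The entire extension of `phaseFun B₁ * conj (phaseFun B₂)`. -/
def crossExt (B₁ B₂ : ℂ → ℂ) (z : ℂ × ℂ) : ℂ :=
  Complex.exp (-2 * Real.pi * z.1 ^ 2) * B₁ (z.1 - Complex.I * z.2) *
    conj (B₂ (conj (z.1 + Complex.I * z.2)))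

/-- The transform of a time-frequency shifted Gaussian. -/
def gaussBargmann (l : ℝ × ℝ) (w : ℂ) : ℂ :=
  Complex.exp (-Real.pi * l.1 ^ 2 + Real.pi / 2 * (w + l.1 + Complex.I * l.2) ^ 2)

end

theorem memLp_exp_neg_mul_sq {b : ℝ} (hb : 0 < b) :
    MemLp (fun t : ℝ => Real.exp (-b * t ^ 2)) 2 volume := by
  rw [memLp_two_iff_integrable_sq (by fun_prop)]
  have : (fun t : ℝ => Real.exp (-b * t ^ 2) ^ 2) = fun t => Real.exp (-(2 * b) * t ^ 2) := by
    ext t; rw [← Real.exp_nat_mul]; congr 1; push_cast; ring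
  rw [this]
  exact integrable_exp_neg_mul_sq (by positivity)

theorem norm_bargmann_kernel_le {w : ℂ} {c : ℝ} (hw : ‖w‖ ≤ c) (t : ℝ) :
    ‖Complex.exp (-Real.pi * t ^ 2 + 2 * Real.pi * t * w)‖ ≤
      Real.exp (2 * Real.pi * c ^ 2) * Real.exp (-(Real.pi / 2) * t ^ 2) := by
  rw [Complex.norm_exp, ← Real.exp_add]
  refine Real.exp_le_exp.2 ?_
  have h1 : (-(Real.pi : ℂ) * t ^ 2 + 2 * Real.pi * t * w).re =
      -Real.pi * t ^ 2 + 2 * Real.pi * t * w.re := by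
    have : (-(Real.pi : ℂ) * t ^ 2 + 2 * Real.pi * t * w) =
      ((-Real.pi * t ^ 2 : ℝ) : ℂ) + ((2 * Real.pi * t : ℝ) : ℂ) * w := by push_cast; ring
    rw [this, Complex.add_re, Complex.ofReal_re, Complex.re_ofReal_mul]
  rw [h1]
  have h2 : w.re ^ 2 ≤ c ^ 2 := by
    rw [← sq_abs]; exact pow_le_pow_left₀ (abs_nonneg _) ((Complex.abs_re_le_norm w).trans hw) 2
  have hpi := Real.pi_pos
  nlinarith [sq_nonneg (t - 2 * w.re)]

theorem differentiable_bargmann {f : ℝ → ℂ} (hf : MemLp f 2 volume) :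
    Differentiable ℂ (bargmann f) := by
  intro w₀
  set a : ℂ := (((2 : ℝ) ^ (1 / 4 : ℝ) : ℝ) : ℂ)
  have hpi := Real.pi_pos
  have hmeas : ∀ w : ℂ, AEStronglyMeasurable
      (fun t : ℝ => f t * (a * Complex.exp (-Real.pi * t ^ 2 + 2 * Real.pi * t * w))) volume :=
    fun w => hf.1.mul (Continuous.aestronglyMeasurable (by fun_prop))
  have hInt : ∀ c : ℝ, Integrable (fun t : ℝ => ‖f t‖ * (c *
      Real.exp (-(Real.pi / 2) * t ^ 2))) volume := fun c =>
    hf.norm.integrable_mul ((memLp_exp_neg_mul_sq (by positivity)).const_mul c)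
  have hInt₂ : ∀ c : ℝ, Integrable (fun t : ℝ => ‖f t‖ * (c *
      (|t| * Real.exp (-(Real.pi / 2) * t ^ 2)))) volume := by
    intro c
    have : MemLp (fun t : ℝ => |t| * Real.exp (-(Real.pi / 2) * t ^ 2)) 2 volume := by
      refine MemLp.of_le (memLp_exp_neg_mul_sq (b := Real.pi / 4) (by positivity))
        (Continuous.aestronglyMeasurable (by fun_prop)) (ae_of_all _ fun t => ?_)
      rw [Real.norm_of_nonneg (by positivity), Real.norm_of_nonneg (by positivity)]
      have h1 : |t| ≤ Real.exp (Real.pi / 4 * t ^ 2) := by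
        have h2 := Real.add_one_le_exp (Real.pi / 4 * t ^ 2)
        have h3 := Real.pi_gt_three
        have h4 := sq_abs t
        nlinarith [sq_nonneg (|t| - 1), sq_nonneg (|t|)]
      calc _ ≤ Real.exp (Real.pi / 4 * t ^ 2) * Real.exp (-(Real.pi / 2) * t ^ 2) := by gcongr
        _ = _ := by rw [← Real.exp_add]; congr 1; ring
    exact hf.norm.integrable_mul (this.const_mul c)
  set c := ‖w₀‖ + 1
  have key := hasDerivAt_integral_of_dominated_loc_of_deriv_le (μ := volume)
    (F := fun w (t : ℝ) => f t * (a * Complex.exp (-Real.pi * t ^ 2 + 2 * Real.pi * t * w)))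
    (F' := fun w (t : ℝ) => f t * (a * (Complex.exp (-Real.pi * t ^ 2 + 2 * Real.pi * t * w) *
      (2 * Real.pi * t))))
    (bound := fun t => ‖f t‖ * ((‖a‖ * Real.exp (2 * Real.pi * c ^ 2) * (2 * Real.pi)) *
      (|t| * Real.exp (-(Real.pi / 2) * t ^ 2))))
    (x₀ := w₀) (Metric.ball_mem_nhds w₀ one_pos) (Eventually.of_forall hmeas) ?_ ?_ ?_ (hInt₂ _) ?_
  · exact key.2.differentiableAt
  · refine Integrable.mono' (hInt (‖a‖ * Real.exp (2 * Real.pi * c ^ 2))) (hmeas w₀)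
      (ae_of_all _ fun t => ?_)
    rw [norm_mul, norm_mul]
    have := norm_bargmann_kernel_le (w := w₀) (c := c) (by simp [c]) t
    rw [mul_assoc ‖a‖]
    gcongr
  · exact hf.1.mul (Continuous.aestronglyMeasurable (by fun_prop))
  · refine ae_of_all _ fun t w hw => ?_
    have hw' : ‖w‖ ≤ c := by
      have h1 := norm_add_le (w - w₀) w₀
      rw [sub_add_cancel] at h1
      have h2 : ‖w - w₀‖ < 1 := by simpa [dist_eq_norm] using hw
      simp only [c]; linarith
    have h3 := norm_bargmann_kernel_le hw' t
    have h4 : ‖(2 * Real.pi * t : ℂ)‖ = 2 * Real.pi * |t| := by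
      simp [abs_of_pos hpi]
    rw [norm_mul, norm_mul, norm_mul, h4]
    calc _ ≤ ‖f t‖ * (‖a‖ * ((Real.exp (2 * Real.pi * c ^ 2) * Real.exp (-(Real.pi / 2) * t ^ 2)) *
          (2 * Real.pi * |t|))) := by gcongr
      _ = _ := by ring
  · refine ae_of_all _ fun t w _ => ?_
    refine HasDerivAt.const_mul _ (HasDerivAt.const_mul _ (HasDerivAt.cexp ?_))
    simpa using ((hasDerivAt_id w).const_mul (2 * (Real.pi : ℂ) * t)).const_add
      (-(Real.pi : ℂ) * t ^ 2)

theorem gabor_eq_phaseFun (f : ℝ → ℂ) (p : ℝ × ℝ) : gabor f p = phaseFun (bargmann f) p := by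
  rw [gabor, phaseFun, bargmann, ← integral_const_mul]
  congr 1 with t
  simp only [tfShift, gaussian, map_mul, ← Complex.exp_conj, Complex.conj_ofReal, Complex.conj_I,
    map_ofNat, Complex.ofReal_mul, Complex.ofReal_exp]
  have : Complex.exp (2 * Real.pi * -Complex.I * p.2 * t) *
      Complex.exp (((-Real.pi : ℝ) : ℂ) * (((t - p.1) ^ 2 : ℝ) : ℂ)) =
      Complex.exp (-Real.pi * p.1 ^ 2) *
        Complex.exp (-Real.pi * t ^ 2 + 2 * Real.pi * t * (p.1 - p.2 * Complex.I)) := by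
    rw [← Complex.exp_add, ← Complex.exp_add]
    congr 1
    push_cast
    ring
  linear_combination (f t * (((2 : ℝ) ^ (1 / 4 : ℝ) : ℝ) : ℂ)) * this

theorem re_phase (p : ℝ × ℝ) : ‖Complex.exp (-(Real.pi : ℂ) * p.1 ^ 2)‖ =
    Real.exp (-Real.pi * p.1 ^ 2) := by
  rw [Complex.norm_exp]
  congr 1
  have : (-(Real.pi : ℂ) * p.1 ^ 2) = ((-Real.pi * p.1 ^ 2 : ℝ) : ℂ) := by push_cast; ring
  rw [this, Complex.ofReal_re]

/-- The Gaussian growth in the imaginary part is exact: what remains are phase-space values at two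
real points displaced from the real part by the rotated imaginary part. Bounded phase-space
functions therefore give bounds uniform in the real part. -/
theorem norm_crossExt (B₁ B₂ : ℂ → ℂ) (x₁ y₁ x₂ y₂ : ℝ) :
    ‖crossExt B₁ B₂ (x₁ + y₁ * Complex.I, x₂ + y₂ * Complex.I)‖ =
      ‖phaseFun B₁ (x₁ + y₂, x₂ - y₁)‖ * ‖phaseFun B₂ (x₁ - y₂, x₂ + y₁)‖ *
        Real.exp (2 * Real.pi * (y₁ ^ 2 + y₂ ^ 2)) := by
  have e1 : (x₁ : ℂ) + y₁ * Complex.I - Complex.I * (x₂ + y₂ * Complex.I) =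
      ((x₁ + y₂ : ℝ) : ℂ) - ((x₂ - y₁ : ℝ) : ℂ) * Complex.I := by
    push_cast; linear_combination (-y₂ : ℂ) * Complex.I_sq
  have e2 : conj ((x₁ : ℂ) + y₁ * Complex.I + Complex.I * (x₂ + y₂ * Complex.I)) =
      ((x₁ - y₂ : ℝ) : ℂ) - ((x₂ + y₁ : ℝ) : ℂ) * Complex.I := by
    simp only [map_add, map_mul, Complex.conj_ofReal, Complex.conj_I]
    push_cast; linear_combination (y₂ : ℂ) * Complex.I_sq
  have e3 : ‖Complex.exp (-2 * Real.pi * ((x₁ : ℂ) + y₁ * Complex.I) ^ 2)‖ =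
      Real.exp (-2 * Real.pi * (x₁ ^ 2 - y₁ ^ 2)) := by
    rw [Complex.norm_exp]
    congr 1
    have : (-2 * Real.pi * ((x₁ : ℂ) + y₁ * Complex.I) ^ 2) =
      ((-2 * Real.pi * (x₁ ^ 2 - y₁ ^ 2) : ℝ) : ℂ) +
        ((-4 * Real.pi * x₁ * y₁ : ℝ) : ℂ) * Complex.I := by
      push_cast
      linear_combination (-2 * Real.pi * y₁ ^ 2 : ℂ) * Complex.I_sq
    rw [this, Complex.add_re, Complex.ofReal_re, Complex.re_ofReal_mul, Complex.I_re]
    ring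
  simp only [crossExt, phaseFun, norm_mul, RCLike.norm_conj]
  rw [e1, e2, e3, re_phase (x₁ + y₂, x₂ - y₁), re_phase (x₁ - y₂, x₂ + y₁)]
  have e4 : Real.exp (-2 * Real.pi * (x₁ ^ 2 - y₁ ^ 2)) =
      Real.exp (-Real.pi * (x₁ + y₂) ^ 2) * Real.exp (-Real.pi * (x₁ - y₂) ^ 2) *
        Real.exp (2 * Real.pi * (y₁ ^ 2 + y₂ ^ 2)) := by
    rw [← Real.exp_add, ← Real.exp_add]; congr 1; ring
  rw [e4]
  ring

theorem crossExt_ofReal (B₁ B₂ : ℂ → ℂ) (x₁ x₂ : ℝ) :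
    crossExt B₁ B₂ (x₁, x₂) = phaseFun B₁ (x₁, x₂) * conj (phaseFun B₂ (x₁, x₂)) := by
  have e2 : conj ((x₁ : ℂ) + Complex.I * x₂) = (x₁ : ℂ) - x₂ * Complex.I := by
    simp only [map_add, map_mul, Complex.conj_ofReal, Complex.conj_I]; ring
  simp only [crossExt, phaseFun, map_mul, ← Complex.exp_conj, map_neg, map_pow, Complex.conj_ofReal]
  rw [e2, mul_comm Complex.I]
  have : Complex.exp (-2 * Real.pi * (x₁ : ℂ) ^ 2) =
    Complex.exp (-Real.pi * (x₁ : ℂ) ^ 2) * Complex.exp (-Real.pi * (x₁ : ℂ) ^ 2) := by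
    rw [← Complex.exp_add]; congr 1; ring
  rw [this]; ring

/-- The complex point is chosen so that z₁ - iz₂ is the holomorphic coordinate of p + u and the
conjugate of z₁ + iz₂ is that of p; the exponential restores the Gaussian factors. Values of the
extension away from the diagonal thus encode relative phases. -/
theorem evaluation_crossExt (B₁ B₂ : ℂ → ℂ) (p u : ℝ × ℝ) :
    evaluation (crossExt B₁ B₂) p u = phaseFun B₁ (p + u) * conj (phaseFun B₂ p) := by
  have e1 : (p.1 : ℂ) + (u.1 - Complex.I * u.2) / 2 - Complex.I * (p.2 + (Complex.I * u.1 + u.2) / 2)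
      = ((p + u).1 : ℝ) - ((p + u).2 : ℝ) * Complex.I := by
    simp only [Prod.fst_add, Prod.snd_add]
    push_cast
    linear_combination (-u.1 / 2 : ℂ) * Complex.I_sq
  have e2 : conj ((p.1 : ℂ) + (u.1 - Complex.I * u.2) / 2 +
      Complex.I * (p.2 + (Complex.I * u.1 + u.2) / 2)) = p.1 - p.2 * Complex.I := by
    simp only [map_add, map_sub, map_mul, map_div₀, Complex.conj_ofReal, Complex.conj_I, map_ofNat]
    linear_combination (u.1 / 2 : ℂ) * Complex.I_sq
  simp only [evaluation, crossExt, phaseFun, map_mul, ← Complex.exp_conj, map_neg, map_pow,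
    Complex.conj_ofReal]
  rw [e1, e2]
  have : Complex.exp (-2 * Real.pi * ((p.1 : ℂ) + (u.1 - Complex.I * u.2) / 2) ^ 2) *
      Complex.exp (-(Real.pi / 2) * (u.1 ^ 2 + u.2 ^ 2) -
        Real.pi * Complex.I * (2 * p.1 + u.1) * u.2) =
      Complex.exp (-Real.pi * ((p + u).1 : ℝ) ^ 2) * Complex.exp (-Real.pi * (p.1 : ℂ) ^ 2) := by
    rw [← Complex.exp_add, ← Complex.exp_add]
    congr 1
    simp only [Prod.fst_add]
    push_cast
    linear_combination (-Real.pi * u.2 ^ 2 / 2 : ℂ) * Complex.I_sq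
  linear_combination (B₁ (((p + u).1 : ℝ) - ((p + u).2 : ℝ) * Complex.I) *
    conj (B₂ (p.1 - p.2 * Complex.I))) * this

theorem differentiable_crossExt {B₁ B₂ : ℂ → ℂ} (h₁ : Differentiable ℂ B₁)
    (h₂ : Differentiable ℂ B₂) : Differentiable ℂ (crossExt B₁ B₂) := by
  have h3 : Differentiable ℂ fun w => conj (B₂ (conj w)) := fun w =>
    (differentiableAt_conj_conj_iff (f := B₂)).2 (h₂ _)
  have h4 : Differentiable ℂ fun z : ℂ × ℂ => conj (B₂ (conj (z.1 + Complex.I * z.2))) :=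
    h3.comp (by fun_prop : Differentiable ℂ fun z : ℂ × ℂ => z.1 + Complex.I * z.2)
  have h5 : Differentiable ℂ fun z : ℂ × ℂ => B₁ (z.1 - Complex.I * z.2) :=
    h₁.comp (by fun_prop : Differentiable ℂ fun z : ℂ × ℂ => z.1 - Complex.I * z.2)
  exact ((by fun_prop : Differentiable ℂ fun z : ℂ × ℂ =>
    Complex.exp (-2 * Real.pi * z.1 ^ 2)).mul h5).mul h4

theorem differentiable_gaussBargmann (l : ℝ × ℝ) : Differentiable ℂ (gaussBargmann l) := by
  unfold gaussBargmann; fun_prop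

/-- The Ansatz functions are the entire extensions of cross-spectrograms of shifted Gaussians, so
F_A obeys the same growth and evaluation identities as the extension of 𝒮f. -/
theorem ansatzPhi_eq (l m : ℝ × ℝ) : ansatzPhi l m = crossExt (gaussBargmann l) (gaussBargmann m) := by
  ext z
  simp only [ansatzPhi, crossExt, gaussBargmann, ← Complex.exp_conj, map_add, map_mul, map_neg,
    map_pow, map_div₀, Complex.conj_ofReal, Complex.conj_I, map_ofNat, Complex.conj_conj,
    ← Complex.exp_add]
  congr 1
  linear_combination (-Real.pi * (z.2 ^ 2 - z.2 * (l.2 + m.2) +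
    (l.2 ^ 2 + m.2 ^ 2) / 2) : ℂ) * Complex.I_sq

theorem bargmann_tfShift_gaussian (l : ℝ × ℝ) :
    bargmann (tfShift l gaussian) = gaussBargmann l := by
  ext w
  have hpi := Real.pi_pos
  have hpi' : (Real.pi : ℂ) ≠ 0 := by exact_mod_cast hpi.ne'
  have h2 : (((2 : ℝ) ^ (1 / 4 : ℝ) : ℝ) : ℂ) * (((2 : ℝ) ^ (1 / 4 : ℝ) : ℝ) : ℂ) =
      ((√2 : ℝ) : ℂ) := by
    rw [← Complex.ofReal_mul, ← Real.rpow_add two_pos, Real.sqrt_eq_rpow]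
    norm_num
  have e : (fun t : ℝ => tfShift l gaussian t * ((((2 : ℝ) ^ (1 / 4 : ℝ) : ℝ) : ℂ) *
      Complex.exp (-Real.pi * t ^ 2 + 2 * Real.pi * t * w))) = fun t : ℝ => ((√2 : ℝ) : ℂ) *
      Complex.exp ((-2 * Real.pi) * t ^ 2 + (2 * Real.pi * (w + l.1 + Complex.I * l.2)) * t +
        -Real.pi * l.1 ^ 2) := by
    ext t
    simp only [tfShift, gaussian, Complex.ofReal_mul, Complex.ofReal_exp, ← h2]
    rw [show ∀ a b c d e : ℂ, a * (b * c) * (d * e) = b * d * (a * (c * e)) by intros; ring,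
      ← Complex.exp_add, ← Complex.exp_add]
    congr 2
    push_cast
    ring
  rw [bargmann, e, integral_const_mul, integral_cexp_quadratic (by simp [hpi]), gaussBargmann]
  have h3 : (Real.pi : ℂ) / -(-2 * Real.pi) = ((1 / 2 : ℝ) : ℂ) := by
    push_cast; field_simp
  have h4 : ((1 / 2 : ℝ) : ℂ) ^ (1 / 2 : ℂ) = ((1 / √2 : ℝ) : ℂ) := by
    have : (1 / 2 : ℂ) = ((1 / 2 : ℝ) : ℂ) := by push_cast; rfl
    rw [this, ← Complex.ofReal_cpow (by norm_num), ← Real.sqrt_eq_rpow]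
    congr 1
    rw [Real.sqrt_div zero_le_one, Real.sqrt_one]
  rw [h3, h4, ← mul_assoc, ← Complex.ofReal_mul, mul_one_div_cancel (by positivity),
    Complex.ofReal_one, one_mul]
  congr 1
  field_simp
  ring

theorem gabor_tfShift_gaussian (l p : ℝ × ℝ) :
    gabor (tfShift l gaussian) p = phaseFun (gaussBargmann l) p := by
  rw [gabor_eq_phaseFun, bargmann_tfShift_gaussian]

theorem norm_phaseFun_gaussBargmann (l p : ℝ × ℝ) :
    ‖phaseFun (gaussBargmann l) p‖ =
      Real.exp (-(Real.pi / 2) * ((p.1 - l.1) ^ 2 + (p.2 - l.2) ^ 2)) := by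
  rw [phaseFun, gaussBargmann, ← Complex.exp_add, Complex.norm_exp]
  congr 1
  have : (-(Real.pi : ℂ) * p.1 ^ 2 + (-Real.pi * l.1 ^ 2 +
      Real.pi / 2 * (p.1 - p.2 * Complex.I + l.1 + Complex.I * l.2) ^ 2)) =
    ((-(Real.pi / 2) * ((p.1 - l.1) ^ 2 + (p.2 - l.2) ^ 2) : ℝ) : ℂ) +
      ((Real.pi * (p.1 + l.1) * (l.2 - p.2) : ℝ) : ℂ) * Complex.I := by
    push_cast
    linear_combination (Real.pi / 2 * (p.2 - l.2) ^ 2 : ℂ) * Complex.I_sq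
  rw [this, Complex.add_re, Complex.ofReal_re, Complex.re_ofReal_mul, Complex.I_re]
  ring

theorem continuous_gabor {f : ℝ → ℂ} (hf : MemLp f 2 volume) : Continuous (gabor f) := by
  have : gabor f = phaseFun (bargmann f) := funext (gabor_eq_phaseFun f)
  rw [this]
  unfold phaseFun
  exact (by fun_prop : Continuous fun p : ℝ × ℝ => Complex.exp (-Real.pi * p.1 ^ 2)).mul
    ((differentiable_bargmann hf).continuous.comp (by fun_prop))

/-- Continuity upgrades the essential bound to a pointwise one, as needed at individual lattice
points. -/
theorem norm_gabor_le_one {f : ℝ → ℂ} (hf : MemLp f 2 volume)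
    (hSf : eLpNorm (spectrogram f) ⊤ volume ≤ 1) (p : ℝ × ℝ) : ‖gabor f p‖ ≤ 1 := by
  have hc : Continuous (spectrogram f) := (continuous_gabor hf).norm.pow 2
  have h1 : ∀ᵐ q : ℝ × ℝ, spectrogram f q ≤ 1 := by
    rw [eLpNorm_exponent_top] at hSf
    filter_upwards [ae_le_eLpNormEssSup (f := spectrogram f) (μ := volume)] with q hq
    have := hq.trans hSf
    rw [← ofReal_norm, ← ENNReal.ofReal_one, ENNReal.ofReal_le_ofReal_iff zero_le_one] at this
    exact (le_abs_self _).trans this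
  have h2 : ∀ q, spectrogram f q ≤ 1 := by
    have hd : Dense {q | spectrogram f q ≤ 1} := Measure.dense_of_ae h1
    have hcl : IsClosed {q | spectrogram f q ≤ 1} := isClosed_le hc continuous_const
    intro q
    have := hd.closure_eq
    rw [hcl.closure_eq] at this
    exact this.ge (Set.mem_univ q)
  have := h2 p
  rw [spectrogram] at this
  exact (sq_le_one_iff₀ (norm_nonneg _)).1 this

/-! ### Positive semidefinite matrices and Gaussian lattice sums -/

/-- Cauchy–Schwarz on a decomposition into rank-one matrices. Control of the diagonal therefore
controls all entries, which gives both compactness in the first program and the growth bound for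
F_A. -/
theorem norm_sq_entry_le_of_posSemidef {V : Type*} [Fintype V] {A : Matrix V V ℂ}
    (hA : A.PosSemidef) (k l : V) : ‖A k l‖ ^ 2 ≤ (A k k).re * (A l l).re := by
  classical
  obtain ⟨m, B, rfl⟩ := Matrix.posSemidef_iff_eq_sum_vecMulVec.1 hA
  have hd : ∀ k, ((∑ i : Fin m, Matrix.vecMulVec (B i) (star (B i))) k k).re =
      ∑ i, ‖B i k‖ ^ 2 := by
    intro k
    rw [Matrix.sum_apply, Complex.re_sum]
    refine Finset.sum_congr rfl fun i _ => ?_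
    rw [Matrix.vecMulVec_apply, Pi.star_apply, Complex.star_def, Complex.mul_conj,
      Complex.ofReal_re, Complex.normSq_eq_norm_sq]
  rw [hd, hd, Matrix.sum_apply]
  refine le_trans (pow_le_pow_left₀ (norm_nonneg _) (norm_sum_le _ _) 2) ?_
  simp only [norm_mul, Matrix.vecMulVec_apply, Pi.star_apply, norm_star]
  exact Finset.sum_mul_sq_le_sq_mul_sq _ _ _

theorem norm_entry_le_maxDiag {Γ : Finset (ℤ × ℤ)} {A : Matrix Γ Γ ℂ} (hA : A.PosSemidef)
    (k l : Γ) : ‖A k l‖ ≤ maxDiag A := by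
  have hle : ∀ k : Γ, (A k k).re ≤ maxDiag A := fun k =>
    le_ciSup (f := fun k : Γ => (A k k).re) (Set.finite_range _).bddAbove k
  have h0 : ∀ k : Γ, 0 ≤ (A k k).re := fun k => (Complex.le_def.1 (hA.diag_nonneg (i := k))).1
  have hM : 0 ≤ maxDiag A := (h0 k).trans (hle k)
  refine abs_le_of_sq_le_sq' ?_ hM |>.2
  calc _ ≤ _ := norm_sq_entry_le_of_posSemidef hA k l
    _ ≤ maxDiag A * maxDiag A := mul_le_mul (hle k) (hle l) (h0 l) hM
    _ = _ := (sq _).symm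

theorem tsum_exp_neg_mul_sq_le {b : ℝ} (hb : 0 < b) (x : ℝ) :
    Summable (fun n : ℤ => Real.exp (-b * (x + n) ^ 2)) ∧
      ∑' n : ℤ, Real.exp (-b * (x + n) ^ 2) ≤ 2 * (1 - Real.exp (-b))⁻¹ := by
  have hz : Real.exp (-b) < 1 := by rw [Real.exp_lt_one_iff]; linarith
  have hg := hasSum_geometric_of_lt_one (Real.exp_pos (-b)).le hz
  rw [← hg.tsum_eq]
  refine summable_int_shift (u := fun t => Real.exp (-b * t ^ 2)) (fun _ => (Real.exp_pos _).le)
    hg.summable (fun j t hj => ?_) x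
  rw [← Real.exp_nat_mul]
  refine Real.exp_le_exp.2 ?_
  have h1 : (j : ℝ) ≤ (j : ℝ) ^ 2 := by
    have : j ≤ j ^ 2 := Nat.le_self_pow two_ne_zero j
    exact_mod_cast this
  have h2 : (j : ℝ) ^ 2 ≤ t ^ 2 := by
    rw [← sq_abs t]; exact pow_le_pow_left₀ (Nat.cast_nonneg _) hj 2
  nlinarith

theorem mesh_pos : 0 < mesh := by unfold mesh; positivity

theorem mesh_sq : mesh ^ 2 = 1 / 2 := by
  unfold mesh
  rw [div_pow, Real.sq_sqrt two_pos.le]; norm_num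

/-- Gaussian sums over the lattice `𝔞ℤ²`. -/
theorem tsum_exp_neg_lattice_le {b : ℝ} (hb : 0 < b) (p : ℝ × ℝ) :
    Summable (fun k : ℤ × ℤ => Real.exp (-(2 * b) * ((p.1 - (latticePt mesh k).1) ^ 2 +
      (p.2 - (latticePt mesh k).2) ^ 2))) ∧
    ∑' k : ℤ × ℤ, Real.exp (-(2 * b) * ((p.1 - (latticePt mesh k).1) ^ 2 +
      (p.2 - (latticePt mesh k).2) ^ 2)) ≤ (2 * (1 - Real.exp (-b))⁻¹) ^ 2 := by
  have hm := mesh_pos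
  have hms := mesh_sq
  have e : ∀ k : ℤ × ℤ, Real.exp (-(2 * b) * ((p.1 - (latticePt mesh k).1) ^ 2 +
      (p.2 - (latticePt mesh k).2) ^ 2)) = Real.exp (-b * (-(p.1 / mesh) + k.1) ^ 2) *
        Real.exp (-b * (-(p.2 / mesh) + k.2) ^ 2) := by
    intro k
    rw [← Real.exp_add]
    congr 1
    have h : ∀ (x : ℝ) (n : ℤ), (x - mesh * n) ^ 2 = (-(x / mesh) + n) ^ 2 / 2 := by
      intro x n
      rw [div_eq_mul_one_div _ (2 : ℝ), ← hms]
      field_simp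
      ring
    simp only [latticePt, h]
    ring
  simp only [e]
  have h1 := tsum_exp_neg_mul_sq_le hb (-(p.1 / mesh))
  have h2 := tsum_exp_neg_mul_sq_le hb (-(p.2 / mesh))
  have hs : Summable fun k : ℤ × ℤ => Real.exp (-b * (-(p.1 / mesh) + k.1) ^ 2) *
        Real.exp (-b * (-(p.2 / mesh) + k.2) ^ 2) :=
    h1.1.mul_of_nonneg h2.1 (fun _ => (Real.exp_pos _).le) (fun _ => (Real.exp_pos _).le)
  refine ⟨hs, ?_⟩
  rw [← h1.1.tsum_mul_tsum h2.1 hs, sq]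
  exact mul_le_mul h1.2 h2.2 (tsum_nonneg fun _ => (Real.exp_pos _).le)
    ((tsum_nonneg fun _ => (Real.exp_pos _).le).trans h1.2)

/-- The lattice Gaussian sum at b = π/4 is at most (2/(1 - e^{-π/4}))² < 14, whatever the size of Γ.
-/
theorem sum_norm_phaseFun_gaussBargmann_le (Γ : Finset (ℤ × ℤ)) (p : ℝ × ℝ) :
    ∑ k : Γ, ‖phaseFun (gaussBargmann (latticePt mesh k)) p‖ ≤ 14 := by
  have h := tsum_exp_neg_lattice_le (b := Real.pi / 4) (by positivity) p
  have e : 2 * (Real.pi / 4) = Real.pi / 2 := by ring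
  rw [e] at h
  simp only [norm_phaseFun_gaussBargmann]
  rw [Finset.sum_coe_sort Γ (fun k => Real.exp (-(Real.pi / 2) * ((p.1 - (latticePt mesh k).1) ^ 2 +
      (p.2 - (latticePt mesh k).2) ^ 2)))]
  refine (h.1.sum_le_tsum Γ fun _ _ => (Real.exp_pos _).le).trans (h.2.trans ?_)
  have hexp : Real.exp (-(Real.pi / 4)) ≤ 0.4625 := by
    have h1 : Real.exp (-(Real.pi / 4)) ≤ Real.exp (-0.78) :=
      Real.exp_le_exp.2 (by linarith [Real.pi_gt_d2])
    have h2 : (1 / 0.4625 : ℝ) ≤ Real.exp 0.78 := by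
      have := Real.sum_le_exp_of_nonneg (x := 0.78) (by norm_num) 5
      norm_num [Finset.sum_range_succ, Nat.factorial] at this ⊢
      linarith
    refine h1.trans ?_
    rw [Real.exp_neg, inv_le_comm₀ (Real.exp_pos _) (by norm_num)]
    norm_num at h2 ⊢
    linarith
  have h3 : (1 - Real.exp (-(Real.pi / 4)))⁻¹ ≤ (0.5375 : ℝ)⁻¹ :=
    inv_anti₀ (by norm_num) (by linarith)
  have h4 : 0 ≤ (1 - Real.exp (-(Real.pi / 4)))⁻¹ := inv_nonneg.2 (by linarith)
  calc _ ≤ (2 * (0.5375 : ℝ)⁻¹) ^ 2 := by gcongr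
    _ ≤ _ := by norm_num

theorem differentiable_ansatz {Γ : Finset (ℤ × ℤ)} (A : Matrix Γ Γ ℂ) :
    Differentiable ℂ (ansatz A) := by
  unfold ansatz
  simp only [ansatzPhi_eq]
  refine Differentiable.fun_sum fun k _ => Differentiable.fun_sum fun l _ => ?_
  exact (differentiable_crossExt (differentiable_gaussBargmann _)
    (differentiable_gaussBargmann _)).const_mul _

/-- Once all entries are bounded by the largest diagonal one, the double sum separates into two
Gaussian lattice sums, each at most 14, and 14² = 196. -/
theorem norm_ansatz_le {Γ : Finset (ℤ × ℤ)} {A : Matrix Γ Γ ℂ} (hA : A.PosSemidef) {m : ℝ}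
    (hm : maxDiag A ≤ m) (hm0 : 0 ≤ m) (x₁ y₁ x₂ y₂ : ℝ) :
    ‖ansatz A (x₁ + y₁ * Complex.I, x₂ + y₂ * Complex.I)‖ ≤
      196 * m * Real.exp (2 * Real.pi * (y₁ ^ 2 + y₂ ^ 2)) := by
  unfold ansatz
  have hterm : ∀ k l : Γ, ‖A k l * ansatzPhi (latticePt mesh k) (latticePt mesh l)
      (x₁ + y₁ * Complex.I, x₂ + y₂ * Complex.I)‖ ≤ m *
      (‖phaseFun (gaussBargmann (latticePt mesh k)) (x₁ + y₂, x₂ - y₁)‖ *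
      ‖phaseFun (gaussBargmann (latticePt mesh l)) (x₁ - y₂, x₂ + y₁)‖) *
        Real.exp (2 * Real.pi * (y₁ ^ 2 + y₂ ^ 2)) := by
    intro k l
    rw [norm_mul, ansatzPhi_eq, norm_crossExt, ← mul_assoc]
    gcongr
    exact (norm_entry_le_maxDiag hA k l).trans hm
  calc _ ≤ ∑ k : Γ, ∑ l : Γ, m *
      (‖phaseFun (gaussBargmann (latticePt mesh k)) (x₁ + y₂, x₂ - y₁)‖ *
      ‖phaseFun (gaussBargmann (latticePt mesh l)) (x₁ - y₂, x₂ + y₁)‖) *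
        Real.exp (2 * Real.pi * (y₁ ^ 2 + y₂ ^ 2)) := by
        refine (norm_sum_le _ _).trans (Finset.sum_le_sum fun k _ => (norm_sum_le _ _).trans
          (Finset.sum_le_sum fun l _ => hterm k l))
    _ = m * ((∑ k : Γ, ‖phaseFun (gaussBargmann (latticePt mesh k)) (x₁ + y₂, x₂ - y₁)‖) *
        ∑ l : Γ, ‖phaseFun (gaussBargmann (latticePt mesh l)) (x₁ - y₂, x₂ + y₁)‖) *
        Real.exp (2 * Real.pi * (y₁ ^ 2 + y₂ ^ 2)) := by
        rw [Finset.sum_mul_sum]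
        simp only [Finset.mul_sum, Finset.sum_mul]
    _ ≤ m * (14 * 14) * Real.exp (2 * Real.pi * (y₁ ^ 2 + y₂ ^ 2)) := by
        gcongr
        · exact sum_norm_phaseFun_gaussBargmann_le _ _
        · exact sum_norm_phaseFun_gaussBargmann_le _ _
    _ = _ := by ring

/-! ### The convolution inverse of the sequence `e^{-πk²}` -/

noncomputable section

/-- The sequence `e^{-πk²}` without its value at `0`. -/
def thetaOff (k : ℤ) : ℝ := if k = 0 then 0 else Real.exp (-Real.pi * (k : ℝ) ^ 2)

/-- Convolution powers of `thetaOff`. -/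
def thetaPow : ℕ → ℤ → ℝ
  | 0, k => if k = 0 then 1 else 0
  | n + 1, k => ∑' j : ℤ, thetaOff j * thetaPow n (k - j)

/-- The convolution inverse of `e^{-πk²}`. -/
def thetaInv (k : ℤ) : ℝ := ∑' n : ℕ, (-1) ^ n * thetaPow n k

end

/-- Young's inequality for a submultiplicative weight. In `ℝ≥0∞` no summability has to be known
beforehand, so the Neumann series is bounded before it is shown to converge. The weights used are 1
and e^{2.25|k|}. -/
theorem tsum_thetaPow_le {w : ℤ → ℝ≥0∞} (h0 : w 0 = 1) (hw : ∀ j k, w (j + k) ≤ w j * w k)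
    {ρ : ℝ≥0∞} (hρ : ∑' j, w j * ‖thetaOff j‖ₑ ≤ ρ) (n : ℕ) :
    ∑' k, w k * ‖thetaPow n k‖ₑ ≤ ρ ^ n := by
  induction n with
  | zero =>
    rw [tsum_eq_single 0]
    · simp [thetaPow, h0]
    · intro k hk; simp [thetaPow, hk]
  | succ n ih =>
    calc ∑' k, w k * ‖thetaPow (n + 1) k‖ₑ
        ≤ ∑' k, ∑' j, (w j * ‖thetaOff j‖ₑ) * (w (k - j) * ‖thetaPow n (k - j)‖ₑ) := by
          refine ENNReal.tsum_le_tsum fun k => ?_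
          rw [thetaPow]
          calc _ ≤ w k * ∑' j, ‖thetaOff j * thetaPow n (k - j)‖ₑ := by
                gcongr; exact enorm_tsum_le_tsum_enorm
            _ = ∑' j, w k * ‖thetaOff j * thetaPow n (k - j)‖ₑ := ENNReal.tsum_mul_left.symm
            _ ≤ _ := by
                refine ENNReal.tsum_le_tsum fun j => ?_
                rw [enorm_mul]
                calc _ ≤ (w j * w (k - j)) * (‖thetaOff j‖ₑ * ‖thetaPow n (k - j)‖ₑ) := by
                      gcongr
                      simpa using hw j (k - j)
                  _ = _ := by ring
      _ = ∑' j, ∑' k, (w j * ‖thetaOff j‖ₑ) * (w (k - j) * ‖thetaPow n (k - j)‖ₑ) :=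
          ENNReal.tsum_comm
      _ = ∑' j, (w j * ‖thetaOff j‖ₑ) * ∑' k, w k * ‖thetaPow n k‖ₑ := by
          refine tsum_congr fun j => ?_
          rw [ENNReal.tsum_mul_left]
          congr 1
          exact (Equiv.subRight j).tsum_eq (fun k => w k * ‖thetaPow n k‖ₑ)
      _ ≤ ρ * ρ ^ n := by
          rw [ENNReal.tsum_mul_right]
          gcongr
      _ = _ := (pow_succ' _ _).symm

theorem tsum_thetaInv_le {w : ℤ → ℝ≥0∞} (h0 : w 0 = 1) (hw : ∀ j k, w (j + k) ≤ w j * w k)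
    {ρ : ℝ≥0∞} (hρ : ∑' j, w j * ‖thetaOff j‖ₑ ≤ ρ) :
    ∑' k, w k * ‖thetaInv k‖ₑ ≤ (1 - ρ)⁻¹ := by
  calc _ ≤ ∑' k, ∑' n : ℕ, w k * ‖thetaPow n k‖ₑ := by
        refine ENNReal.tsum_le_tsum fun k => ?_
        rw [ENNReal.tsum_mul_left]
        gcongr
        refine (enorm_tsum_le_tsum_enorm).trans (le_of_eq (tsum_congr fun n => ?_))
        rw [enorm_mul, enorm_pow, enorm_neg, enorm_one, one_pow, one_mul]
    _ = ∑' n : ℕ, ∑' k, w k * ‖thetaPow n k‖ₑ := ENNReal.tsum_comm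
    _ ≤ ∑' n : ℕ, ρ ^ n := ENNReal.tsum_le_tsum fun n => tsum_thetaPow_le h0 hw hρ n
    _ = _ := ENNReal.tsum_geometric ρ

theorem tsum_weight_thetaOff_le {c a z : ℝ} (hz0 : 0 < z) (hz1 : z < 1)
    (hb : ∀ k : ℤ, k ≠ 0 → Real.exp (c * |(k : ℝ)|) * Real.exp (-Real.pi * (k : ℝ) ^ 2) ≤
      a * z ^ k.natAbs) :
    ∑' j : ℤ, ENNReal.ofReal (Real.exp (c * |(j : ℝ)|)) * ‖thetaOff j‖ₑ ≤
      ENNReal.ofReal (2 * (a * (z / (1 - z)))) := by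
  have hs := hasSum_int_geometric a hz0.le hz1
  have ha : 0 ≤ a := by
    have := (by positivity : (0:ℝ) ≤ Real.exp (c * |((1 : ℤ) : ℝ)|) *
      Real.exp (-Real.pi * ((1 : ℤ) : ℝ) ^ 2)).trans (hb 1 one_ne_zero)
    simp at this
    exact nonneg_of_mul_nonneg_left this hz0
  rw [← hs.tsum_eq, ENNReal.ofReal_tsum_of_nonneg (fun n => by split_ifs <;> positivity) hs.summable]
  refine ENNReal.tsum_le_tsum fun k => ?_
  rw [thetaOff]
  split_ifs with h
  · simp
  · rw [← ofReal_norm, Real.norm_of_nonneg (Real.exp_pos _).le,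
      ← ENNReal.ofReal_mul (Real.exp_pos _).le]
    exact ENNReal.ofReal_le_ofReal (hb k h)

theorem summable_thetaInv {c ρ : ℝ} (hc : 0 ≤ c) (hρ0 : 0 ≤ ρ) (hρ1 : ρ < 1)
    (hρ : ∑' j : ℤ, ENNReal.ofReal (Real.exp (c * |(j : ℝ)|)) * ‖thetaOff j‖ₑ ≤ ENNReal.ofReal ρ) :
    Summable (fun k : ℤ => Real.exp (c * |(k : ℝ)|) * |thetaInv k|) ∧
      ∑' k : ℤ, Real.exp (c * |(k : ℝ)|) * |thetaInv k| ≤ (1 - ρ)⁻¹ := by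
  have h1 := tsum_thetaInv_le (w := fun k : ℤ => ENNReal.ofReal (Real.exp (c * |(k : ℝ)|)))
    (by simp) (fun j k => by
      rw [← ENNReal.ofReal_mul (Real.exp_pos _).le, ← Real.exp_add, ← mul_add]
      refine ENNReal.ofReal_le_ofReal (Real.exp_le_exp.2 ?_)
      push_cast
      gcongr
      exact abs_add_le _ _) hρ
  have e : ∀ k : ℤ, ENNReal.ofReal (Real.exp (c * |(k : ℝ)|)) * ‖thetaInv k‖ₑ =
      ENNReal.ofReal (Real.exp (c * |(k : ℝ)|) * |thetaInv k|) := fun k => by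
    rw [← ofReal_norm, ← ENNReal.ofReal_mul (Real.exp_pos _).le, Real.norm_eq_abs]
  have h2 : (1 - ENNReal.ofReal ρ)⁻¹ ≤ ENNReal.ofReal (1 - ρ)⁻¹ := by
    rw [ENNReal.ofReal_inv_of_pos (by linarith)]
    refine ENNReal.inv_le_inv.2 (le_of_eq ?_)
    rw [ENNReal.ofReal_sub 1 hρ0, ENNReal.ofReal_one]
  simp only [e] at h1
  have h3 := h1.trans h2
  have hnn : ∀ k : ℤ, 0 ≤ Real.exp (c * |(k : ℝ)|) * |thetaInv k| := fun k => by positivity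
  have hs : Summable (fun k : ℤ => Real.exp (c * |(k : ℝ)|) * |thetaInv k|) := by
    have := ENNReal.summable_toReal (ne_top_of_le_ne_top ENNReal.ofReal_ne_top h3)
    simpa only [ENNReal.toReal_ofReal (hnn _)] using this
  refine ⟨hs, ?_⟩
  rw [← ENNReal.ofReal_tsum_of_nonneg hnn hs] at h3
  exact (ENNReal.ofReal_le_ofReal_iff (inv_nonneg.2 (by linarith))).1 h3

theorem tsum_thetaOff_le : ∑' j : ℤ, ENNReal.ofReal (Real.exp (0 * |(j : ℝ)|)) * ‖thetaOff j‖ₑ ≤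
    ENNReal.ofReal 0.1 := by
  have hz : Real.exp (-3) ≤ 0.0498 := by
    have h1 := Real.exp_neg_one_lt_d9
    have h2 : Real.exp (-3) = Real.exp (-1) ^ 3 := by rw [← Real.exp_nat_mul]; norm_num
    rw [h2]
    calc _ ≤ (0.36788 : ℝ) ^ 3 := by gcongr; linarith
      _ ≤ _ := by norm_num
  have hzπ : Real.exp (-Real.pi) ≤ 0.047 := by
    have h1 : Real.exp (-Real.pi) ≤ Real.exp (-3) * Real.exp (-0.14) := by
      rw [← Real.exp_add]; exact Real.exp_le_exp.2 (by linarith [Real.pi_gt_d2])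
    have h2 : Real.exp (-0.14) ≤ 0.88 := by
      rw [Real.exp_neg, inv_le_comm₀ (Real.exp_pos _) (by norm_num)]
      have := Real.add_one_le_exp (0.14 : ℝ)
      refine le_trans ?_ this
      norm_num
    calc _ ≤ (0.0498 : ℝ) * 0.88 := h1.trans (by gcongr)
      _ ≤ _ := by norm_num
  refine (tsum_weight_thetaOff_le (a := 1) (Real.exp_pos (-Real.pi)) (by linarith)
    fun k hk => ?_).trans (ENNReal.ofReal_le_ofReal ?_)
  · rw [zero_mul, Real.exp_zero, one_mul, one_mul, ← Real.exp_nat_mul]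
    refine Real.exp_le_exp.2 ?_
    have h1 : (k.natAbs : ℝ) ≤ (k : ℝ) ^ 2 := by
      rw [← sq_abs, ← Int.cast_abs, ← Nat.cast_natAbs]
      exact_mod_cast Nat.le_self_pow two_ne_zero k.natAbs
    nlinarith [Real.pi_pos]
  · have : Real.exp (-Real.pi) / (1 - Real.exp (-Real.pi)) ≤ 0.05 := by
      rw [div_le_iff₀ (by linarith)]; linarith
    linarith

/-- The rate 2.25 slightly exceeds π/√2, the cost of moving an envelope e^{-(π/2)|t|} by √2. At this
rate the off-diagonal mass is still below 1, so the Neumann series converges in the weighted norm as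
well. -/
theorem tsum_exp_thetaOff_le :
    ∑' j : ℤ, ENNReal.ofReal (Real.exp (2.25 * |(j : ℝ)|)) * ‖thetaOff j‖ₑ ≤
    ENNReal.ofReal 0.83 := by
  have hz : Real.exp (-7) ≤ 0.002 := by
    have h1 := Real.exp_neg_one_lt_d9
    have h2 : Real.exp (-7) = Real.exp (-1) ^ 7 := by rw [← Real.exp_nat_mul]; norm_num
    rw [h2]
    calc _ ≤ (0.36788 : ℝ) ^ 7 := by gcongr; linarith
      _ ≤ _ := by norm_num
  have hA : Real.exp (-0.89) ≤ 0.412 := by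
    rw [Real.exp_neg, inv_le_comm₀ (Real.exp_pos _) (by norm_num)]
    have := Real.sum_le_exp_of_nonneg (x := 0.89) (by norm_num) 6
    norm_num [Finset.sum_range_succ, Nat.factorial] at this ⊢
    linarith
  refine (tsum_weight_thetaOff_le (a := Real.exp (7 - 0.89)) (Real.exp_pos (-7)) (by linarith)
    fun k hk => ?_).trans (ENNReal.ofReal_le_ofReal ?_)
  · rw [← Real.exp_nat_mul, ← Real.exp_add, ← Real.exp_add]
    refine Real.exp_le_exp.2 ?_
    have hj : 1 ≤ k.natAbs := Nat.one_le_iff_ne_zero.2 (Int.natAbs_ne_zero.2 hk)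
    have hj' : (1 : ℝ) ≤ k.natAbs := by exact_mod_cast hj
    have e1 : |(k : ℝ)| = k.natAbs := by rw [Nat.cast_natAbs, Int.cast_abs]
    have e2 : (k : ℝ) ^ 2 = (k.natAbs : ℝ) ^ 2 := by rw [← e1, sq_abs]
    rw [e1, e2]
    have hpi := Real.pi_gt_d2
    -- No integer lies strictly between 1 and 2, so k² ≥ 3|k| - 2. This linear minorant is sharp at
    -- |k| = 1 and 2, where the mass sits, and produces the geometric ratio e^{-7}.
    have h3 : 0 ≤ ((k.natAbs : ℝ) - 1) * ((k.natAbs : ℝ) - 2) := by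
      rcases hj.eq_or_lt with h | h
      · rw [← h]; norm_num
      · have : (2 : ℝ) ≤ k.natAbs := by exact_mod_cast h
        exact mul_nonneg (by linarith) (by linarith)
    nlinarith
  · have e : Real.exp (7 - 0.89) * (Real.exp (-7) / (1 - Real.exp (-7))) =
        Real.exp (-0.89) / (1 - Real.exp (-7)) := by
      rw [← mul_div_assoc, ← Real.exp_add]; norm_num
    rw [e]
    have : Real.exp (-0.89) / (1 - Real.exp (-7)) ≤ 0.414 := by
      rw [div_le_iff₀ (by linarith)]; linarith
    linarith

theorem summable_abs_thetaInv : Summable (fun k : ℤ => |thetaInv k|) ∧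
    ∑' k : ℤ, |thetaInv k| ≤ 1.12 := by
  have := summable_thetaInv le_rfl (by norm_num) (by norm_num) tsum_thetaOff_le
  simp only [zero_mul, Real.exp_zero, one_mul] at this
  exact ⟨this.1, this.2.trans (by norm_num)⟩

theorem summable_exp_abs_thetaInv :
    Summable (fun k : ℤ => Real.exp (2.25 * |(k : ℝ)|) * |thetaInv k|) ∧
    ∑' k : ℤ, Real.exp (2.25 * |(k : ℝ)|) * |thetaInv k| ≤ 6 := by
  have := summable_thetaInv (by norm_num) (by norm_num) (by norm_num) tsum_exp_thetaOff_le
  exact ⟨this.1, this.2.trans (by norm_num)⟩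

theorem summable_theta : Summable fun k : ℤ => Real.exp (-Real.pi * (k : ℝ) ^ 2) := by
  simpa using (tsum_exp_neg_mul_sq_le Real.pi_pos 0).1

theorem summable_abs_theta : Summable fun k : ℤ => |Real.exp (-Real.pi * (k : ℝ) ^ 2)| := by
  simpa only [abs_of_pos (Real.exp_pos _)] using summable_theta

theorem thetaPow_bound (n : ℕ) (k : ℤ) : ‖thetaPow n k‖ₑ ≤ ENNReal.ofReal 0.1 ^ n := by
  have h := tsum_thetaPow_le (w := fun k : ℤ => ENNReal.ofReal (Real.exp (0 * |(k : ℝ)|)))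
    (by simp) (by simp) tsum_thetaOff_le n
  simp only [zero_mul, Real.exp_zero, ENNReal.ofReal_one, one_mul] at h
  exact (ENNReal.le_tsum k).trans h

theorem summable_thetaOff_mul_thetaInv (k : ℤ) :
    Summable fun j : ℤ => thetaOff j * thetaInv (k - j) := by
  have h2 : Summable fun j : ℤ => |thetaInv (k - j)| :=
    ((Equiv.subLeft k).summable_iff (f := fun j : ℤ => |thetaInv j|)).2 summable_abs_thetaInv.1
  refine Summable.of_norm_bounded h2 fun j => ?_
  rw [norm_mul, Real.norm_eq_abs (thetaInv _)]
  refine mul_le_of_le_one_left (abs_nonneg _) ?_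
  rw [thetaOff]
  split_ifs
  · simp
  · rw [Real.norm_of_nonneg (Real.exp_pos _).le, Real.exp_le_one_iff]
    nlinarith [Real.pi_pos, sq_nonneg (j : ℝ)]

/-- Convolution with the off-diagonal part turns the n-th Neumann term into minus the next one, so
only the unit at n = 0 is left over. The sums may be exchanged because the ℓ¹ norms decay
geometrically with ratio 0.1. -/
theorem tsum_thetaOff_mul_thetaInv (k : ℤ) :
    ∑' j : ℤ, thetaOff j * thetaInv (k - j) = (if k = 0 then 1 else 0) - thetaInv k := by
  have hpow : ∀ k, Summable fun n : ℕ => (-1 : ℝ) ^ n * thetaPow n k := by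
    intro k
    refine Summable.of_norm_bounded (summable_geometric_of_lt_one (r := (0.1 : ℝ)) (by norm_num)
      (by norm_num)) fun n => ?_
    rw [norm_mul, norm_pow, norm_neg, norm_one, one_pow, one_mul]
    have := thetaPow_bound n k
    rw [← ofReal_norm, ← ENNReal.ofReal_pow (by norm_num),
      ENNReal.ofReal_le_ofReal_iff (by positivity)] at this
    exact this
  have hsum : Summable (Function.uncurry fun (j : ℤ) (n : ℕ) =>
      thetaOff j * ((-1 : ℝ) ^ n * thetaPow n (k - j))) := by
    rw [← summable_norm_iff]
    have hfin : ∑' p : ℤ × ℕ, ‖Function.uncurry (fun (j : ℤ) (n : ℕ) =>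
      thetaOff j * ((-1 : ℝ) ^ n * thetaPow n (k - j))) p‖ₑ ≠ ⊤ := by
      rw [ENNReal.tsum_prod']
      refine ne_top_of_le_ne_top (b := ENNReal.ofReal 0.1 * (1 - ENNReal.ofReal 0.1)⁻¹) ?_ ?_
      · refine ENNReal.mul_ne_top ENNReal.ofReal_ne_top (ENNReal.inv_ne_top.2 ?_)
        rw [← ENNReal.ofReal_one, ← ENNReal.ofReal_sub _ (by norm_num)]
        simp; norm_num
      · calc _ ≤ ∑' (j : ℤ) (n : ℕ), ‖thetaOff j‖ₑ * ENNReal.ofReal 0.1 ^ n := by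
              refine ENNReal.tsum_le_tsum fun j => ENNReal.tsum_le_tsum fun n => ?_
              simp only [Function.uncurry_apply_pair]
              rw [enorm_mul, enorm_mul, enorm_pow, enorm_neg, enorm_one, one_pow, one_mul]
              gcongr
              exact thetaPow_bound n _
          _ = (∑' j, ‖thetaOff j‖ₑ) * (1 - ENNReal.ofReal 0.1)⁻¹ := by
              simp_rw [ENNReal.tsum_mul_left, ENNReal.tsum_geometric, ENNReal.tsum_mul_right]
          _ ≤ _ := by
              gcongr
              simpa using tsum_thetaOff_le
    have := ENNReal.summable_toReal hfin
    simpa only [toReal_enorm] using this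
  have h1 : ∀ j, thetaOff j * thetaInv (k - j) =
      ∑' n : ℕ, thetaOff j * ((-1 : ℝ) ^ n * thetaPow n (k - j)) := fun j => by
    rw [thetaInv, tsum_mul_left]
  rw [tsum_congr h1, ← hsum.tsum_comm]
  have h2 : ∀ n : ℕ, ∑' j : ℤ, thetaOff j * ((-1 : ℝ) ^ n * thetaPow n (k - j)) =
      -((-1) ^ (n + 1) * thetaPow (n + 1) k) := by
    intro n
    rw [thetaPow, ← tsum_mul_left, ← tsum_neg]
    refine tsum_congr fun j => ?_
    ring
  rw [tsum_congr h2, tsum_neg, thetaInv, (hpow k).tsum_eq_zero_add]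
  simp [thetaPow]

theorem hasSum_theta_mul_thetaInv (k : ℤ) :
    HasSum (fun j : ℤ => Real.exp (-Real.pi * (j : ℝ) ^ 2) * thetaInv (k - j))
      (if k = 0 then 1 else 0) := by
  have h1 := (summable_thetaOff_mul_thetaInv k).hasSum
  rw [tsum_thetaOff_mul_thetaInv] at h1
  have h2 := h1.add (hasSum_ite_eq (0 : ℤ) (thetaInv k))
  rw [sub_add_cancel] at h2
  have e : (fun j : ℤ => Real.exp (-Real.pi * (j : ℝ) ^ 2) * thetaInv (k - j)) = fun j : ℤ =>
      thetaOff j * thetaInv (k - j) + if j = 0 then thetaInv k else 0 := by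
    ext j
    rw [thetaOff]
    split_ifs with h
    · subst h; simp
    · rw [add_zero]
  rw [e]
  exact h2

/-! ### Inversion of theta series in a Banach algebra -/

section Algebra

variable {𝔄 : Type*} [NormedRing 𝔄] [NormedAlgebra ℂ 𝔄]

theorem summable_smul_of_norm_le {c : ℤ → ℝ} (hc : Summable fun k => |c k|) {W : ℤ → 𝔄}
    (hW : ∀ k, ‖W k‖ ≤ 1) : Summable fun k => ‖(c k : ℂ) • W k‖ := by
  refine Summable.of_nonneg_of_le (fun _ => norm_nonneg _) (fun k => ?_) hc
  rw [norm_smul, Complex.norm_real, Real.norm_eq_abs]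
  exact mul_le_of_le_one_right (abs_nonneg _) (hW k)

variable [CompleteSpace 𝔄]

/-- `(∑ₖ e^{-πk²} Wᵏ) (∑ₖ dₖ Wᵏ) = 1` for a bounded one-parameter group `W`. -/
theorem tsum_theta_mul_tsum_thetaInv {W : ℤ → 𝔄} (h0 : W 0 = 1)
    (hadd : ∀ j k, W (j + k) = W j * W k) (hW : ∀ k, ‖W k‖ ≤ 1) :
    (∑' k : ℤ, ((Real.exp (-Real.pi * (k : ℝ) ^ 2) : ℝ) : ℂ) • W k) *
      (∑' k : ℤ, (thetaInv k : ℂ) • W k) = 1 := by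
  have s1 := summable_smul_of_norm_le (W := W) summable_abs_theta hW
  have s2 := summable_smul_of_norm_le summable_abs_thetaInv.1 hW
  have hmul := summable_mul_of_summable_norm s1 s2
  rw [tsum_mul_tsum_of_summable_norm s1 s2]
  -- The substitution (n, j) ↦ (j, n - j) groups the product by the total exponent n, so that the
  -- inner sum is a convolution.
  let e : ℤ × ℤ ≃ ℤ × ℤ :=
    { toFun := fun p => (p.2, p.1 - p.2)
      invFun := fun q => (q.1 + q.2, q.1)
      left_inv := fun p => by simp
      right_inv := fun q => by simp }
  rw [← e.tsum_eq]
  refine (Summable.tsum_prod ((e.summable_iff).2 hmul)).trans ?_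
  have h : ∀ n : ℤ, ∑' j : ℤ, (((Real.exp (-Real.pi * ((e (n, j)).1 : ℝ) ^ 2) : ℝ) : ℂ) •
      W (e (n, j)).1 * (thetaInv (e (n, j)).2 : ℂ) • W (e (n, j)).2) =
      if n = 0 then 1 else 0 := by
    intro n
    have h1 := (Complex.hasSum_ofReal.2 (hasSum_theta_mul_thetaInv n)).smul_const (W n)
    have e1 : (fun j : ℤ => ((Real.exp (-Real.pi * ((e (n, j)).1 : ℝ) ^ 2) : ℝ) : ℂ) •
      W (e (n, j)).1 * (thetaInv (e (n, j)).2 : ℂ) • W (e (n, j)).2) = fun j : ℤ =>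
      ((Real.exp (-Real.pi * (j : ℝ) ^ 2) * thetaInv (n - j) : ℝ) : ℂ) • W n := by
      ext j
      simp only [e, Equiv.coe_fn_mk]
      rw [smul_mul_smul_comm, ← hadd, add_sub_cancel, ← Complex.ofReal_mul]
    rw [e1, h1.tsum_eq]
    split_ifs with hn
    · subst hn; simp [h0]
    · simp
  refine (tsum_congr h).trans ?_
  rw [tsum_ite_eq]

theorem tsum_thetaInv_mul_tsum_theta {W : ℤ → 𝔄} (h0 : W 0 = 1)
    (hadd : ∀ j k, W (j + k) = W j * W k) (hW : ∀ k, ‖W k‖ ≤ 1) :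
    (∑' k : ℤ, (thetaInv k : ℂ) • W k) *
      (∑' k : ℤ, ((Real.exp (-Real.pi * (k : ℝ) ^ 2) : ℝ) : ℂ) • W k) = 1 := by
  rw [← tsum_theta_mul_tsum_thetaInv h0 hadd hW]
  have hc : ∀ j k, Commute (W j) (W k) := fun j k => by
    rw [Commute, SemiconjBy, ← hadd, ← hadd, add_comm]
  refine Commute.eq (Commute.tsum_left _ fun j => Commute.tsum_right _ fun k => ?_)
  exact ((hc j k).smul_left _).smul_right _

end Algebra

/-! ### Time-frequency shifts on `L²(ℝ)` -/

/-- The Hilbert space `L²(ℝ)`. -/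
noncomputable abbrev L2R := Lp ℂ 2 (volume : Measure ℝ)

theorem norm_exp_freq (a t : ℝ) : ‖Complex.exp (2 * Real.pi * Complex.I * a * t)‖ = 1 := by
  have : (2 * Real.pi * Complex.I * a * t : ℂ) = ((2 * Real.pi * a * t : ℝ) : ℂ) * Complex.I := by
    push_cast; ring
  rw [this, Complex.norm_exp_ofReal_mul_I]

theorem norm_tfShift (p : ℝ × ℝ) (g : ℝ → ℂ) (t : ℝ) : ‖tfShift p g t‖ = ‖g (t - p.1)‖ := by
  rw [tfShift, norm_mul, norm_exp_freq, one_mul]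

theorem aestronglyMeasurable_tfShift (p : ℝ × ℝ) {g : ℝ → ℂ} (hg : AEStronglyMeasurable g volume) :
    AEStronglyMeasurable (tfShift p g) volume := by
  refine AEStronglyMeasurable.mul (Continuous.aestronglyMeasurable (by fun_prop)) ?_
  exact hg.comp_measurePreserving (measurePreserving_sub_right volume p.1)

theorem eLpNorm_tfShift (p : ℝ × ℝ) {g : ℝ → ℂ} (hg : AEStronglyMeasurable g volume) :
    eLpNorm (tfShift p g) 2 volume = eLpNorm g 2 volume := by
  rw [eLpNorm_congr_norm_ae (g := fun t => g (t - p.1)) (ae_of_all _ (norm_tfShift p g))]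
  exact eLpNorm_comp_measurePreserving hg (measurePreserving_sub_right volume p.1)

theorem memLp_tfShift (p : ℝ × ℝ) {g : ℝ → ℂ} (hg : MemLp g 2 volume) :
    MemLp (tfShift p g) 2 volume :=
  ⟨aestronglyMeasurable_tfShift p hg.1, by rw [eLpNorm_tfShift p hg.1]; exact hg.2⟩

theorem tfShift_congr_ae (p : ℝ × ℝ) {g h : ℝ → ℂ} (hgh : g =ᵐ[volume] h) :
    tfShift p g =ᵐ[volume] tfShift p h := by
  have := (measurePreserving_sub_right volume p.1).quasiMeasurePreserving.ae_eq_comp hgh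
  filter_upwards [this] with t ht
  simp only [Function.comp_apply] at ht
  rw [tfShift, tfShift, ht]

noncomputable section

/-- The time-frequency shift as an isometry of `L²(ℝ)`. -/
def shiftL (p : ℝ × ℝ) : L2R →ₗᵢ[ℂ] L2R where
  toFun h := (memLp_tfShift p (Lp.memLp h)).toLp _
  map_add' g h := by
    rw [← MemLp.toLp_add]
    refine MemLp.toLp_congr _ _ ?_
    refine (tfShift_congr_ae p (Lp.coeFn_add g h)).trans (ae_of_all _ fun t => ?_)
    simp [tfShift, mul_add]
  map_smul' c h := by
    rw [RingHom.id_apply, ← MemLp.toLp_const_smul]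
    refine MemLp.toLp_congr _ _ ?_
    refine (tfShift_congr_ae p (Lp.coeFn_smul c h)).trans (ae_of_all _ fun t => ?_)
    simp [tfShift, mul_left_comm]
  norm_map' h := by
    simp only [LinearMap.coe_mk, AddHom.coe_mk]
    rw [Lp.norm_toLp, eLpNorm_tfShift p (Lp.memLp h).1, Lp.norm_def]

theorem coeFn_shiftL (p : ℝ × ℝ) (h : L2R) : (shiftL p h : ℝ → ℂ) =ᵐ[volume] tfShift p h :=
  MemLp.coeFn_toLp (memLp_tfShift p (Lp.memLp h))

theorem tfShift_tfShift (p q : ℝ × ℝ) (g : ℝ → ℂ) (t : ℝ) :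
    tfShift p (tfShift q g) t =
      Complex.exp (-(2 * Real.pi * Complex.I * q.2 * p.1)) * tfShift (p + q) g t := by
  simp only [tfShift, ← mul_assoc, ← Complex.exp_add, Prod.fst_add, Prod.snd_add]
  rw [sub_sub]
  congr 2
  push_cast
  ring

theorem shiftL_shiftL (p q : ℝ × ℝ) (h : L2R) :
    shiftL p (shiftL q h) =
      Complex.exp (-(2 * Real.pi * Complex.I * q.2 * p.1)) • shiftL (p + q) h := by
  refine Lp.ext ?_
  filter_upwards [coeFn_shiftL p (shiftL q h), tfShift_congr_ae p (coeFn_shiftL q h),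
    Lp.coeFn_smul (Complex.exp (-(2 * Real.pi * Complex.I * q.2 * p.1))) (shiftL (p + q) h),
    coeFn_shiftL (p + q) h] with t h1 h2 h3 h4
  rw [h1, h2, tfShift_tfShift, h3, Pi.smul_apply, h4, smul_eq_mul]

theorem shiftL_zero (h : L2R) : shiftL 0 h = h := by
  refine Lp.ext ?_
  filter_upwards [coeFn_shiftL 0 h] with t h1
  rw [h1]; simp [tfShift]

/-- Shifts by points of the lattice `𝔞ℤ²`. -/
def latShift (k : ℤ × ℤ) : L2R →L[ℂ] L2R := (shiftL (latticePt mesh k)).toContinuousLinearMap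

theorem latShift_apply (k : ℤ × ℤ) (h : L2R) : latShift k h = shiftL (latticePt mesh k) h := rfl

theorem norm_latShift_le (k : ℤ × ℤ) : ‖latShift k‖ ≤ 1 :=
  (shiftL (latticePt mesh k)).norm_toContinuousLinearMap_le

theorem latticePt_add (c : ℝ) (j k : ℤ × ℤ) : latticePt c j + latticePt c k = latticePt c (j + k) := by
  ext <;> simp [latticePt] <;> ring

/-- Since 𝔞² = 1/2, the commutation phase is e^{-πi·k₂·j₁}, trivial when the product is even. Hence
shifts from the doubled lattice commute with every shift of 𝔞ℤ², and translations and modulations by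
√2 commute with each other. -/
theorem latShift_mul (j k : ℤ × ℤ) (n : ℤ) (hn : k.2 * j.1 = 2 * n) :
    latShift j * latShift k = latShift (j + k) := by
  ext1 h
  rw [mul_apply_eq_comp, latShift_apply, latShift_apply, latShift_apply, shiftL_shiftL,
    latticePt_add]
  have : Complex.exp (-(2 * Real.pi * Complex.I * (latticePt mesh k).2 * (latticePt mesh j).1)) = 1 := by
    rw [Complex.exp_eq_one_iff]
    refine ⟨-n, ?_⟩
    simp only [latticePt]
    have hm : (mesh : ℂ) ^ 2 = 1 / 2 := by rw [← Complex.ofReal_pow, mesh_sq]; norm_num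
    have hn' : (k.2 : ℂ) * j.1 = 2 * n := by exact_mod_cast hn
    push_cast
    linear_combination (-(2 * Real.pi * Complex.I * k.2 * j.1) : ℂ) * hm -
      (Real.pi * Complex.I : ℂ) * hn'
  rw [this, one_smul]

theorem latShift_zero : latShift 0 = 1 := by
  ext1 h
  rw [latShift_apply]
  have : latticePt mesh 0 = 0 := by simp [latticePt]
  rw [this, shiftL_zero]; rfl

theorem memLp_gaussian : MemLp gaussian 2 volume := by
  have := (memLp_exp_neg_mul_sq Real.pi_pos).const_mul ((2 : ℝ) ^ (1 / 4 : ℝ))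
  exact this.ofReal

/-- The Gaussian window as an element of `L²(ℝ)`. -/
def gaussL : L2R := memLp_gaussian.toLp gaussian

theorem gabor_congr_ae {f g : ℝ → ℂ} (h : f =ᵐ[volume] g) (p : ℝ × ℝ) : gabor f p = gabor g p := by
  refine integral_congr_ae ?_
  filter_upwards [h] with t ht
  rw [ht]

theorem inner_shiftL_gaussL (p : ℝ × ℝ) (h : L2R) : inner ℂ (shiftL p gaussL) h = gabor h p := by
  rw [L2.inner_def, gabor]
  refine integral_congr_ae ?_
  have h1 : (shiftL p gaussL : ℝ → ℂ) =ᵐ[volume] tfShift p gaussian :=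
    (coeFn_shiftL p gaussL).trans (tfShift_congr_ae p memLp_gaussian.coeFn_toLp)
  filter_upwards [h1] with t ht
  rw [ht, RCLike.inner_apply]

theorem inner_latShift_gaussL (k : ℤ × ℤ) (h : L2R) :
    inner ℂ (latShift k gaussL) h = gabor h (latticePt mesh k) := inner_shiftL_gaussL _ _

/-! ### The frame operator and its inverse -/

/-- Translations by multiples of `√2 = 2𝔞`. -/
def transW (k : ℤ) : L2R →L[ℂ] L2R := latShift (2 * k, 0)

/-- Modulations by multiples of `√2 = 2𝔞`. -/
def modW (k : ℤ) : L2R →L[ℂ] L2R := latShift (0, 2 * k)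

/-- The operator `∑ₖ e^{-πk²} Wₖ`. -/
def thetaOp (W : ℤ → L2R →L[ℂ] L2R) : L2R →L[ℂ] L2R :=
  ∑' k : ℤ, ((Real.exp (-Real.pi * (k : ℝ) ^ 2) : ℝ) : ℂ) • W k

/-- The operator `∑ₖ dₖ Wₖ`. -/
def thetaInvOp (W : ℤ → L2R →L[ℂ] L2R) : L2R →L[ℂ] L2R := ∑' k : ℤ, (thetaInv k : ℂ) • W k

/-- The frame operator of `(π(λ)φ)`. -/
def frameOp : L2R →L[ℂ] L2R := (2 : ℂ) • (thetaOp modW * thetaOp transW)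

/-- The inverse of the frame operator. -/
def frameInv : L2R →L[ℂ] L2R := (1 / 2 : ℂ) • (thetaInvOp transW * thetaInvOp modW)

theorem norm_transW_le (k : ℤ) : ‖transW k‖ ≤ 1 := norm_latShift_le _

theorem norm_modW_le (k : ℤ) : ‖modW k‖ ≤ 1 := norm_latShift_le _

theorem transW_zero : transW 0 = 1 := latShift_zero

theorem modW_zero : modW 0 = 1 := latShift_zero

theorem transW_add (j k : ℤ) : transW (j + k) = transW j * transW k := by
  rw [transW, transW, transW, latShift_mul _ _ 0 (by simp)]
  congr 1
  ext <;> simp [mul_add]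

theorem modW_add (j k : ℤ) : modW (j + k) = modW j * modW k := by
  rw [modW, modW, modW, latShift_mul _ _ 0 (by simp)]
  congr 1
  ext <;> simp [mul_add]

theorem frameInv_mul_frameOp : frameInv * frameOp = 1 := by
  rw [frameInv, frameOp, smul_mul_smul_comm, mul_assoc, ← mul_assoc (thetaInvOp modW),
    thetaInvOp, thetaInvOp, thetaOp, thetaOp,
    tsum_thetaInv_mul_tsum_theta modW_zero modW_add norm_modW_le, one_mul,
    tsum_thetaInv_mul_tsum_theta transW_zero transW_add norm_transW_le]
  norm_num

theorem frameOp_mul_frameInv : frameOp * frameInv = 1 := by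
  rw [frameInv, frameOp, smul_mul_smul_comm, mul_assoc, ← mul_assoc (thetaOp transW),
    thetaInvOp, thetaInvOp, thetaOp, thetaOp,
    tsum_theta_mul_tsum_thetaInv transW_zero transW_add norm_transW_le, one_mul,
    tsum_theta_mul_tsum_thetaInv modW_zero modW_add norm_modW_le]
  norm_num

/-- This absolutely convergent expansion in lattice shifts is the source of every quantitative fact
about the inverse: its norm, its commutation with shifts, the size of coefficients and the decay of
the dual window. -/
theorem hasSum_frameInv : HasSum (fun p : ℤ × ℤ =>
    ((1 / 2 * (thetaInv p.1 * thetaInv p.2) : ℝ) : ℂ) • latShift (2 * p.1, 2 * p.2)) frameInv := by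
  have s1 := summable_smul_of_norm_le summable_abs_thetaInv.1 norm_transW_le
  have s2 := summable_smul_of_norm_le summable_abs_thetaInv.1 norm_modW_le
  have h := ((summable_mul_of_summable_norm s1 s2).hasSum).const_smul (1 / 2 : ℂ)
  rw [← tsum_mul_tsum_of_summable_norm s1 s2] at h
  have e : (fun p : ℤ × ℤ => ((1 / 2 * (thetaInv p.1 * thetaInv p.2) : ℝ) : ℂ) •
      latShift (2 * p.1, 2 * p.2)) = fun p : ℤ × ℤ =>
      (1 / 2 : ℂ) • (((thetaInv p.1 : ℂ) • transW p.1) * ((thetaInv p.2 : ℂ) • modW p.2)) := by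
    ext1 p
    rw [smul_mul_smul_comm, smul_smul, transW, modW,
      latShift_mul (2 * p.1, 0) (0, 2 * p.2) (2 * p.2 * p.1) (by ring)]
    simp
  rw [e]
  exact h

theorem summable_thetaInv_prod :
    Summable (fun p : ℤ × ℤ => 1 / 2 * (|thetaInv p.1| * |thetaInv p.2|)) ∧
      ∑' p : ℤ × ℤ, 1 / 2 * (|thetaInv p.1| * |thetaInv p.2|) ≤ 0.63 := by
  have h := summable_abs_thetaInv
  have hs : Summable (fun p : ℤ × ℤ => |thetaInv p.1| * |thetaInv p.2|) :=
    h.1.mul_of_nonneg h.1 (fun _ => abs_nonneg _) (fun _ => abs_nonneg _)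
  refine ⟨hs.mul_left _, ?_⟩
  rw [tsum_mul_left, ← h.1.tsum_mul_tsum h.1 hs]
  have : (∑' k : ℤ, |thetaInv k|) * ∑' k : ℤ, |thetaInv k| ≤ 1.12 * 1.12 :=
    mul_le_mul h.2 h.2 (tsum_nonneg fun _ => abs_nonneg _) (by norm_num)
  linarith

theorem abs_frameInv_coeff (p : ℤ × ℤ) : ‖((1 / 2 * (thetaInv p.1 * thetaInv p.2) : ℝ) : ℂ)‖ =
    1 / 2 * (|thetaInv p.1| * |thetaInv p.2|) := by
  rw [Complex.norm_real, Real.norm_eq_abs, abs_mul, abs_mul, abs_of_pos (by norm_num : (0:ℝ) < 1/2)]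

theorem norm_frameInv_le : ‖frameInv‖ ≤ 0.63 := by
  rw [← hasSum_frameInv.tsum_eq]
  refine (tsum_of_norm_bounded summable_thetaInv_prod.1.hasSum fun p => ?_).trans
    summable_thetaInv_prod.2
  rw [norm_smul, abs_frameInv_coeff]
  exact mul_le_of_le_one_right (by positivity) (norm_latShift_le _)

theorem tsum_theta_le : ∑' k : ℤ, |Real.exp (-Real.pi * (k : ℝ) ^ 2)| ≤ 1.1 := by
  have h := tsum_thetaOff_le
  simp only [zero_mul, Real.exp_zero, ENNReal.ofReal_one, one_mul, ← ofReal_norm] at h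
  have hs : Summable fun k : ℤ => ‖thetaOff k‖ := by
    refine Summable.of_nonneg_of_le (fun _ => norm_nonneg _) (fun k => ?_) summable_theta
    rw [thetaOff]
    split_ifs
    · simp [(Real.exp_pos _).le]
    · rw [Real.norm_of_nonneg (Real.exp_pos _).le]
  rw [← ENNReal.ofReal_tsum_of_nonneg (fun _ => norm_nonneg _) hs,
    ENNReal.ofReal_le_ofReal_iff (by norm_num)] at h
  have h2 := hs.hasSum.add (hasSum_ite_eq (0 : ℤ) (1 : ℝ))
  have e : (fun k : ℤ => |Real.exp (-Real.pi * (k : ℝ) ^ 2)|) =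
      fun k : ℤ => ‖thetaOff k‖ + if k = 0 then 1 else 0 := by
    ext k
    rw [thetaOff]
    split_ifs with hk
    · subst hk; simp
    · rw [add_zero, Real.norm_eq_abs]
  rw [e, h2.tsum_eq]
  linarith

theorem norm_thetaOp_le {W : ℤ → L2R →L[ℂ] L2R} (hW : ∀ k, ‖W k‖ ≤ 1) : ‖thetaOp W‖ ≤ 1.1 := by
  refine (tsum_of_norm_bounded summable_abs_theta.hasSum fun k => ?_).trans tsum_theta_le
  rw [norm_smul, Complex.norm_real, Real.norm_eq_abs]
  exact mul_le_of_le_one_right (abs_nonneg _) (hW k)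

theorem norm_frameOp_le : ‖frameOp‖ ≤ 2.42 := by
  rw [frameOp, norm_smul, Complex.norm_two]
  have := (norm_mul_le (thetaOp modW) (thetaOp transW)).trans
    (mul_le_mul (norm_thetaOp_le norm_modW_le) (norm_thetaOp_le norm_transW_le) (norm_nonneg _)
      (by norm_num))
  linarith

theorem latShift_frameInv_comm (k : ℤ × ℤ) : latShift k * frameInv = frameInv * latShift k := by
  rw [← hasSum_frameInv.tsum_eq]
  refine Commute.eq (Commute.tsum_right _ fun p => Commute.smul_right ?_ _)
  rw [Commute, SemiconjBy, latShift_mul _ _ (p.2 * k.1) (by ring),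
    latShift_mul _ _ (k.2 * p.1) (by ring), add_comm]

end

/-! ### Completeness of the coherent states -/

open scoped FourierTransform ContDiff in
/-- A function all of whose Fourier coefficients vanish is zero. -/
theorem ae_eq_zero_of_fourier_eq_zero {F : ℝ → ℂ} (hF : Integrable F) (h : ∀ w, 𝓕 F w = 0) :
    F =ᵐ[volume] 0 := by
  refine ae_eq_zero_of_integral_contDiff_smul_eq_zero hF.locallyIntegrable fun g hg hgc => ?_
  have hgc' : HasCompactSupport fun x => (g x : ℂ) :=
    hgc.comp_left (g := fun x : ℝ => (x : ℂ)) Complex.ofReal_zero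
  have hg' : ContDiff ℝ ∞ fun x => (g x : ℂ) := Complex.ofRealCLM.contDiff.comp hg
  set G := hgc'.toSchwartzMap hg' with hG
  have hGx : ∀ x, G x = (g x : ℂ) := fun x => rfl
  have e : ∀ x, (g x : ℂ) = 𝓕 ((𝓕⁻ G : SchwartzMap ℝ ℂ) : ℝ → ℂ) x := by
    intro x
    rw [← hGx]
    exact (DFunLike.congr_fun (FourierTransform.fourier_fourierInv_eq (F := SchwartzMap ℝ ℂ) G)
      x).symm
  have hflip := VectorFourier.integral_fourierIntegral_smul_eq_flip (μ := volume) (ν := volume)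
    (L := innerₗ ℝ) (f := ((𝓕⁻ G : SchwartzMap ℝ ℂ) : ℝ → ℂ)) (g := F)
    Real.continuous_fourierChar continuous_inner (𝓕⁻ G).integrable hF
  have h1 : ∫ x, g x • F x = ∫ x, 𝓕 ((𝓕⁻ G : SchwartzMap ℝ ℂ) : ℝ → ℂ) x • F x := by
    refine integral_congr_ae (ae_of_all _ fun x => ?_)
    simp only
    rw [← e, Complex.real_smul, smul_eq_mul]
  rw [h1]
  refine hflip.trans ?_
  refine (integral_congr_ae (ae_of_all _ fun x => ?_)).trans (integral_zero ℝ ℂ)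
  have := h x
  have h2 : VectorFourier.fourierIntegral Real.fourierChar volume (innerₗ ℝ).flip F x = 0 := by
    rw [← this, flip_innerₗ]; rfl
  rw [h2, smul_zero]

theorem integrable_mul_gaussian {h : ℝ → ℂ} (hh : MemLp h 2 volume) :
    Integrable fun t => h t * gaussian t := hh.integrable_mul memLp_gaussian

-- The slice x = 0 suffices: there the Gabor transform is the Fourier transform of hφ, and φ has no
-- zeros.
open scoped FourierTransform in
theorem eq_zero_of_gabor_eq_zero {h : L2R} (hz : ∀ p, gabor h p = 0) : h = 0 := by
  have h1 := ae_eq_zero_of_fourier_eq_zero (integrable_mul_gaussian (Lp.memLp h)) fun w => by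
    rw [← hz (0, w), Real.fourier_real_eq_integral_exp_smul, gabor]
    refine integral_congr_ae (ae_of_all _ fun t => ?_)
    simp only [tfShift, map_mul, ← Complex.exp_conj, Complex.conj_ofReal, Complex.conj_I,
      map_ofNat, gaussian, sub_zero, smul_eq_mul]
    rw [show (2 * Real.pi * -Complex.I * w * t : ℂ) = ((-2 * Real.pi * t * w : ℝ) : ℂ) * Complex.I by
      push_cast; ring]
    ring
  refine Lp.ext ?_
  filter_upwards [h1, Lp.coeFn_zero ℂ 2 (volume : Measure ℝ)] with t ht h0
  rw [h0]
  refine (mul_eq_zero.1 ht).resolve_right ?_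
  rw [gaussian, Complex.ofReal_eq_zero]
  positivity

noncomputable section

/-- The coherent states. -/
def coh (p : ℝ × ℝ) : L2R := shiftL p gaussL

theorem coh_latticePt (k : ℤ × ℤ) : coh (latticePt mesh k) = latShift k gaussL := rfl

theorem inner_coh (p : ℝ × ℝ) (h : L2R) : inner ℂ (coh p) h = gabor h p := inner_shiftL_gaussL p h

theorem inner_coh_coh (p q : ℝ × ℝ) : inner ℂ (coh p) (coh q) =
    Complex.exp (-Real.pi * p.1 ^ 2 + (-Real.pi * q.1 ^ 2 +
      Real.pi / 2 * (p.1 - p.2 * Complex.I + q.1 + Complex.I * q.2) ^ 2)) := by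
  have h1 : (coh q : ℝ → ℂ) =ᵐ[volume] tfShift q gaussian :=
    (coeFn_shiftL q gaussL).trans (tfShift_congr_ae q memLp_gaussian.coeFn_toLp)
  rw [inner_coh, gabor_congr_ae h1, gabor_tfShift_gaussian, phaseFun, gaussBargmann,
    Complex.exp_add (-Real.pi * (p.1 : ℂ) ^ 2)]

theorem topologicalClosure_span_coh :
    (Submodule.span ℂ (Set.range coh)).topologicalClosure = ⊤ := by
  rw [Submodule.topologicalClosure_eq_top_iff, Submodule.eq_bot_iff]
  intro h hh
  refine eq_zero_of_gabor_eq_zero fun p => ?_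
  rw [← inner_coh]
  exact (Submodule.mem_orthogonal _ _).1 hh _ (Submodule.subset_span ⟨p, rfl⟩)

/-! ### The frame operator -/

theorem summable_exp_quadratic (b : ℂ) : Summable fun n : ℤ =>
    Complex.exp (-Real.pi / 2 * n ^ 2 + 2 * Real.pi * b * n) := by
  have := (summable_jacobiTheta₂_term_iff (-Complex.I * b) (Complex.I / 2)).2 (by norm_num)
  refine this.congr fun n => ?_
  rw [jacobiTheta₂_term]
  congr 1
  linear_combination (-2 * Real.pi * b * n + Real.pi * n ^ 2 / 2 : ℂ) * Complex.I_sq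

/-- Poisson summation in one variable. It converts Gaussian sums over 𝔞ℤ into sums over √2ℤ, which
is how the frame operator becomes a series of commuting shifts. -/
theorem tsum_exp_quadratic (b : ℂ) :
    ∑' n : ℤ, Complex.exp (-Real.pi / 2 * n ^ 2 + 2 * Real.pi * b * n) =
      (√2 : ℝ) * ∑' n : ℤ, Complex.exp (-2 * Real.pi * (n + Complex.I * b) ^ 2) := by
  have h := Complex.tsum_exp_neg_quadratic (a := 1 / 2) (by norm_num) b
  have e : (1 : ℂ) / (1 / 2) ^ (1 / 2 : ℂ) = ((√2 : ℝ) : ℂ) := by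
    rw [show (1 / 2 : ℂ) = ((1 / 2 : ℝ) : ℂ) by push_cast; ring, ← Complex.ofReal_cpow (by norm_num),
      ← Real.sqrt_eq_rpow, ← Complex.ofReal_one, ← Complex.ofReal_div]
    congr 1
    rw [Real.sqrt_div' _ two_pos.le]
    simp
  rw [e] at h
  rw [show (fun n : ℤ => Complex.exp (-Real.pi / 2 * n ^ 2 + 2 * Real.pi * b * n)) = fun n : ℤ =>
    Complex.exp (-Real.pi * (1 / 2) * n ^ 2 + 2 * Real.pi * b * n) by
      ext n; congr 1; ring, h]
  congr 3 with n
  congr 1; ring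

theorem summable_exp_quadratic_dual (b : ℂ) : Summable fun n : ℤ =>
    Complex.exp (-2 * Real.pi * (n + Complex.I * b) ^ 2) := by
  have := (summable_jacobiTheta₂_term_iff (-2 * b) (2 * Complex.I)).2 (by norm_num)
  refine (this.mul_left (Complex.exp (2 * Real.pi * b ^ 2))).congr fun n => ?_
  rw [jacobiTheta₂_term, ← Complex.exp_add]
  congr 1
  linear_combination (2 * Real.pi * n ^ 2 + 2 * Real.pi * b ^ 2 : ℂ) * Complex.I_sq

theorem hasSum_frameOp : HasSum (fun p : ℤ × ℤ =>
    ((2 * (Real.exp (-Real.pi * (p.1 : ℝ) ^ 2) * Real.exp (-Real.pi * (p.2 : ℝ) ^ 2)) : ℝ) : ℂ) •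
      latShift (2 * p.2, 2 * p.1)) frameOp := by
  have s1 := summable_smul_of_norm_le summable_abs_theta norm_modW_le
  have s2 := summable_smul_of_norm_le summable_abs_theta norm_transW_le
  have h := ((summable_mul_of_summable_norm s1 s2).hasSum).const_smul (2 : ℂ)
  rw [← tsum_mul_tsum_of_summable_norm s1 s2] at h
  refine h.congr_fun ?_
  intro p
  rw [smul_mul_smul_comm, smul_smul, transW, modW,
    latShift_mul (0, 2 * p.1) (2 * p.2, 0) 0 (by simp)]
  simp

theorem latShift_coh (k l : ℤ) (q : ℝ × ℝ) : latShift (2 * k, 2 * l) (coh q) =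
    Complex.exp (-(2 * Real.pi * Complex.I * q.2 * (2 * mesh * k))) •
      coh (2 * mesh * k + q.1, 2 * mesh * l + q.2) := by
  rw [latShift_apply, coh, shiftL_shiftL, coh]
  have : latticePt mesh (2 * k, 2 * l) + q = (2 * mesh * k + q.1, 2 * mesh * l + q.2) := by
    ext <;> simp [latticePt] <;> ring
  rw [this]
  congr 2
  simp only [latticePt]
  push_cast; ring

/-- The frame operator on coherent states, by Poisson summation in both variables. -/
theorem hasSum_inner_coh (p q : ℝ × ℝ) : HasSum (fun k : ℤ × ℤ =>
    inner ℂ (coh p) (latShift k gaussL) * inner ℂ (latShift k gaussL) (coh q))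
      (inner ℂ (coh p) (frameOp (coh q))) := by
  set P : ℂ := p.1 - p.2 * Complex.I with hP
  set Q : ℂ := q.1 + q.2 * Complex.I with hQ
  set b : ℂ := mesh * (P + Q) / 2 with hb
  set b' : ℂ := mesh * (Complex.I * (P - Q)) / 2 with hb'
  set c : ℂ := Complex.exp (-Real.pi * (p.1 ^ 2 + q.1 ^ 2) + Real.pi / 2 * (P ^ 2 + Q ^ 2)) with hc
  have hm : (mesh : ℂ) ^ 2 = 1 / 2 := by rw [← Complex.ofReal_pow, mesh_sq]; norm_num
  -- Inner products of coherent states are Gaussians, so the lattice sum factors into two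
  -- one-dimensional theta series with complex parameters b and b'.
  have hl : ∀ k : ℤ × ℤ, inner ℂ (coh p) (latShift k gaussL) * inner ℂ (latShift k gaussL) (coh q) =
      c * (Complex.exp (-Real.pi / 2 * k.1 ^ 2 + 2 * Real.pi * b * k.1) *
        Complex.exp (-Real.pi / 2 * k.2 ^ 2 + 2 * Real.pi * b' * k.2)) := by
    intro k
    rw [← coh_latticePt, inner_coh_coh, inner_coh_coh, hc, ← Complex.exp_add, ← Complex.exp_add,
      ← Complex.exp_add]
    congr 1
    simp only [latticePt, hb, hb', hP, hQ]
    push_cast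
    linear_combination (-Real.pi * (k.1 ^ 2 + k.2 ^ 2) : ℂ) * hm +
      (Real.pi * mesh ^ 2 * k.2 ^ 2 : ℂ) * Complex.I_sq
  have hr : ∀ k : ℤ × ℤ, inner ℂ (coh p) (((2 * (Real.exp (-Real.pi * (k.1 : ℝ) ^ 2) *
      Real.exp (-Real.pi * (k.2 : ℝ) ^ 2)) : ℝ) : ℂ) • latShift (2 * k.2, 2 * k.1) (coh q)) =
      2 * c * (Complex.exp (-2 * Real.pi * (((-k.1 : ℤ) : ℂ) + Complex.I * b) ^ 2) *
        Complex.exp (-2 * Real.pi * (k.2 + Complex.I * b') ^ 2)) := by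
    intro k
    rw [latShift_coh, inner_smul_right, inner_smul_right, inner_coh_coh, hc]
    -- The phase coupling translations and modulations is trivial on the doubled lattice, so the
    -- dual side factors too.
    have h1 : Complex.exp (-(2 * Real.pi * Complex.I * k.1 * k.2)) = 1 := by
      rw [Complex.exp_eq_one_iff]
      exact ⟨-(k.1 * k.2), by push_cast; ring⟩
    have key : Complex.exp ((-Real.pi * (k.1 : ℝ) ^ 2 : ℝ) : ℂ) *
        Complex.exp ((-Real.pi * (k.2 : ℝ) ^ 2 : ℝ) : ℂ) *
        (Complex.exp (-(2 * Real.pi * Complex.I * q.2 * (2 * mesh * k.2))) *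
        Complex.exp (-Real.pi * p.1 ^ 2 + (-Real.pi * ((2 * mesh * k.2 + q.1 : ℝ) : ℂ) ^ 2 +
          Real.pi / 2 * (p.1 - p.2 * Complex.I + ((2 * mesh * k.2 + q.1 : ℝ) : ℂ) +
            Complex.I * ((2 * mesh * k.1 + q.2 : ℝ) : ℂ)) ^ 2))) *
        Complex.exp (-(2 * Real.pi * Complex.I * k.1 * k.2)) =
        Complex.exp (-Real.pi * (p.1 ^ 2 + q.1 ^ 2) + Real.pi / 2 * (P ^ 2 + Q ^ 2)) *
        (Complex.exp (-2 * Real.pi * (((-k.1 : ℤ) : ℂ) + Complex.I * b) ^ 2) *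
        Complex.exp (-2 * Real.pi * (k.2 + Complex.I * b') ^ 2)) := by
      simp only [← Complex.exp_add]
      congr 1
      push_cast
      rw [hb, hb', hP, hQ]
      linear_combination (Real.pi * (-2 * k.1 ^ 2 - 2 * k.2 ^ 2 + 4 * Complex.I * k.1 * k.2 -
        2 * (p.1 - p.2 * Complex.I) * (q.1 + q.2 * Complex.I)) : ℂ) * hm +
        (Real.pi * (2 * mesh ^ 2 * k.1 ^ 2 +
          2 * mesh * k.2 * ((p.1 - p.2 * Complex.I) - (q.1 + q.2 * Complex.I)) +
          mesh ^ 2 * ((p.1 - p.2 * Complex.I) + (q.1 + q.2 * Complex.I)) ^ 2 / 2 +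
          (Complex.I ^ 2 - 1) * mesh ^ 2 *
            ((p.1 - p.2 * Complex.I) - (q.1 + q.2 * Complex.I)) ^ 2 / 2) : ℂ) * Complex.I_sq
    rw [h1, mul_one] at key
    rw [Complex.ofReal_mul, Complex.ofReal_mul, Complex.ofReal_exp, Complex.ofReal_exp,
      Complex.ofReal_ofNat]
    linear_combination 2 * key
  have s1 := summable_exp_quadratic b
  have s2 := summable_exp_quadratic b'
  have t1 := summable_exp_quadratic_dual b
  have t2 := summable_exp_quadratic_dual b'
  have t1' : Summable fun n : ℤ => Complex.exp (-2 * Real.pi * (((-n : ℤ) : ℂ) + Complex.I * b) ^ 2) :=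
    t1.comp_injective neg_injective
  have e1 : ∑' n : ℤ, Complex.exp (-2 * Real.pi * (((-n : ℤ) : ℂ) + Complex.I * b) ^ 2) =
      ∑' n : ℤ, Complex.exp (-2 * Real.pi * ((n : ℂ) + Complex.I * b) ^ 2) :=
    (Equiv.neg ℤ).tsum_eq fun n : ℤ => Complex.exp (-2 * Real.pi * ((n : ℂ) + Complex.I * b) ^ 2)
  have hL := (summable_mul_of_summable_norm s1.norm s2.norm).hasSum.mul_left c
  have hR := (summable_mul_of_summable_norm t1'.norm t2.norm).hasSum.mul_left (2 * c)
  rw [← tsum_mul_tsum_of_summable_norm s1.norm s2.norm, tsum_exp_quadratic, tsum_exp_quadratic] at hL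
  rw [← tsum_mul_tsum_of_summable_norm t1'.norm t2.norm, e1] at hR
  have h3 : HasSum (fun k : ℤ × ℤ => inner ℂ (coh p) (((2 * (Real.exp (-Real.pi * (k.1 : ℝ) ^ 2) *
      Real.exp (-Real.pi * (k.2 : ℝ) ^ 2)) : ℝ) : ℂ) • latShift (2 * k.2, 2 * k.1) (coh q)))
      (inner ℂ (coh p) (frameOp (coh q))) := by
    have := (hasSum_frameOp.mapL (ContinuousLinearMap.apply ℂ L2R (coh q))).mapL
      (innerSL ℂ (coh p))
    exact this
  simp only [hr] at h3
  simp only [hl]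
  have h2 : ((√2 : ℝ) : ℂ) * ((√2 : ℝ) : ℂ) = 2 := by
    rw [← Complex.ofReal_mul, Real.mul_self_sqrt two_pos.le, Complex.ofReal_ofNat]
  rw [h3.unique hR]
  convert! hL using 1
  linear_combination (-c * (∑' n : ℤ, Complex.exp (-2 * Real.pi * ((n : ℂ) + Complex.I * b) ^ 2)) *
    ∑' n : ℤ, Complex.exp (-2 * Real.pi * ((n : ℂ) + Complex.I * b') ^ 2)) * h2

theorem hasSum_inner_span {g h : L2R} (hg : g ∈ Submodule.span ℂ (Set.range coh))
    (hh : h ∈ Submodule.span ℂ (Set.range coh)) : HasSum (fun k : ℤ × ℤ =>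
    inner ℂ g (latShift k gaussL) * inner ℂ (latShift k gaussL) h)
      (inner ℂ g (frameOp h)) := by
  induction hg using Submodule.span_induction with
  | mem x hx =>
    obtain ⟨p, rfl⟩ := hx
    induction hh using Submodule.span_induction with
    | mem x hx => obtain ⟨q, rfl⟩ := hx; exact hasSum_inner_coh p q
    | zero => simp
    | add x y _ _ hx hy => simpa only [map_add, inner_add_right, mul_add] using hx.add hy
    | smul a x _ hx =>
      simpa only [map_smul, inner_smul_right, mul_left_comm] using hx.mul_left a
  | zero => simp
  | add x y _ _ hx hy => simpa only [inner_add_left, add_mul] using hx.add hy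
  | smul a x _ hx => simpa only [inner_smul_left, mul_assoc] using hx.mul_left (conj a)

/-- A Bessel bound: on the span of coherent states the sum is ⟨g, Sg⟩ with S the frame operator, and
2.42 ≤ 1.56². Finite partial sums are continuous in h, so the bound passes to the closure, which is
everything. -/
theorem sum_norm_sq_gabor_le (h : L2R) (F : Finset (ℤ × ℤ)) :
    ∑ k ∈ F, ‖inner ℂ (latShift k gaussL) h‖ ^ 2 ≤ (1.56 * ‖h‖) ^ 2 := by
  have hcl : IsClosed {h : L2R | ∑ k ∈ F, ‖inner ℂ (latShift k gaussL) h‖ ^ 2 ≤ (1.56 * ‖h‖) ^ 2} :=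
    isClosed_le (by fun_prop) (by fun_prop)
  have hmem : h ∈ closure (Submodule.span ℂ (Set.range coh) : Set L2R) := by
    rw [← Submodule.topologicalClosure_coe, topologicalClosure_span_coh]; trivial
  refine closure_minimal ?_ hcl hmem
  intro g hg
  have hs := hasSum_inner_span hg hg
  have hs' : HasSum (fun k : ℤ × ℤ => ‖inner ℂ (latShift k gaussL) g‖ ^ 2)
      (RCLike.re (inner ℂ g (frameOp g))) := by
    have := hs.mapL Complex.reCLM
    refine this.congr_fun fun k => ?_
    rw [← inner_conj_symm g, mul_comm, Complex.mul_conj, Complex.reCLM_apply, Complex.ofReal_re,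
      Complex.normSq_eq_norm_sq]
  have h1 := sum_le_hasSum F (fun k _ => sq_nonneg _) hs'
  have h2 : RCLike.re (inner ℂ g (frameOp g)) ≤ ‖g‖ * (2.42 * ‖g‖) :=
    (re_inner_le_norm _ _).trans (mul_le_mul_of_nonneg_left
      ((frameOp.le_opNorm g).trans (mul_le_mul_of_nonneg_right norm_frameOp_le (norm_nonneg _)))
      (norm_nonneg _))
  refine h1.trans (h2.trans ?_)
  nlinarith [sq_nonneg ‖g‖]

theorem memlp_gabor (h : L2R) :
    Memℓp (fun k : ℤ × ℤ => (inner ℂ (latShift k gaussL) h : ℂ)) 2 :=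
  memℓp_gen' (C := (1.56 * ‖h‖) ^ 2) fun F => by simpa using sum_norm_sq_gabor_le h F

/-- The analysis operator `h ↦ (⟨h, π(λ)φ⟩)_λ`. -/
def analysisOp : L2R →L[ℂ] lp (fun _ : ℤ × ℤ => ℂ) 2 :=
  LinearMap.mkContinuous
    { toFun := fun h => ⟨fun k => inner ℂ (latShift k gaussL) h, memlp_gabor h⟩
      map_add' := fun g h => by
        ext k; exact inner_add_right _ _ _
      map_smul' := fun c h => by
        ext k; exact inner_smul_right _ _ _ } 1.56 fun h => by
    refine lp.norm_le_of_forall_sum_le (by norm_num) (by positivity) fun F => ?_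
    simpa using sum_norm_sq_gabor_le h F

theorem analysisOp_apply (h : L2R) (k : ℤ × ℤ) :
    analysisOp h k = inner ℂ (latShift k gaussL) h := rfl

theorem norm_analysisOp_le : ‖analysisOp‖ ≤ 1.56 := LinearMap.mkContinuous_norm_le _ (by norm_num) _

theorem adjoint_analysisOp_single (k : ℤ × ℤ) (c : ℂ) :
    ContinuousLinearMap.adjoint analysisOp (lp.single 2 k c) = c • latShift k gaussL := by
  refine ext_inner_right ℂ fun h => ?_
  rw [ContinuousLinearMap.adjoint_inner_left, lp.inner_single_left, analysisOp_apply,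
    inner_smul_left, RCLike.inner_apply, mul_comm]

/-- Both operators are bounded, so it is enough to compare them on the coherent states, which are
total. There the matrix elements are given by the Poisson computation. -/
theorem adjoint_analysisOp_comp : ContinuousLinearMap.adjoint analysisOp ∘L analysisOp = frameOp := by
  refine ContinuousLinearMap.ext_on (s := Set.range coh) ?_ ?_
  · exact (Submodule.dense_iff_topologicalClosure_eq_top).2 topologicalClosure_span_coh
  · rintro _ ⟨q, rfl⟩
    rw [← sub_eq_zero]
    refine eq_zero_of_gabor_eq_zero fun p => ?_
    rw [← inner_coh, inner_sub_right, sub_eq_zero, ContinuousLinearMap.comp_apply,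
      ContinuousLinearMap.adjoint_inner_right]
    refine (lp.hasSum_inner (analysisOp (coh p)) (analysisOp (coh q))).unique ?_
    refine (hasSum_inner_coh p q).congr_fun fun k => ?_
    rw [analysisOp_apply, analysisOp_apply, RCLike.inner_apply, inner_conj_symm, mul_comm]

/-- Frame expansion with respect to the Gaussian window. -/
theorem hasSum_frame (h : L2R) :
    HasSum (fun k : ℤ × ℤ => gabor h (latticePt mesh k) • latShift k gaussL) (frameOp h) := by
  have := (lp.hasSum_single (p := 2) (by norm_num) (analysisOp h)).mapL
    (ContinuousLinearMap.adjoint analysisOp)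
  rw [← adjoint_analysisOp_comp]
  refine this.congr_fun fun k => ?_
  rw [adjoint_analysisOp_single, analysisOp_apply, inner_latShift_gaussL]

/-- The canonical dual window. -/
def dualL : L2R := frameInv gaussL

theorem frameInv_latShift_gaussL (k : ℤ × ℤ) : frameInv (latShift k gaussL) = latShift k dualL := by
  have := DFunLike.congr_fun (latShift_frameInv_comm k) gaussL
  exact this.symm

/-- Frame expansion with respect to the dual window. -/
theorem hasSum_dual (h : L2R) :
    HasSum (fun k : ℤ × ℤ => gabor h (latticePt mesh k) • latShift k dualL) h := by
  have := (hasSum_frame h).mapL frameInv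
  rw [← mul_apply_eq_comp, frameInv_mul_frameOp] at this
  refine this.congr_fun fun k => ?_
  rw [map_smul, frameInv_latShift_gaussL]

/-- Synthesis with the dual window is the inverse frame operator after the adjoint of analysis, and
0.63·1.56 < 1. Coefficient errors thus pass to L² without loss. -/
theorem norm_sum_dual_le (F : Finset (ℤ × ℤ)) (c : ℤ × ℤ → ℂ) :
    ‖∑ k ∈ F, c k • latShift k dualL‖ ≤ √(∑ k ∈ F, ‖c k‖ ^ 2) := by
  set x : lp (fun _ : ℤ × ℤ => ℂ) 2 := ∑ k ∈ F, lp.single 2 k (c k) with hx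
  have h1 : ∑ k ∈ F, c k • latShift k dualL =
      frameInv (ContinuousLinearMap.adjoint analysisOp x) := by
    rw [hx, map_sum, map_sum]
    refine Finset.sum_congr rfl fun k _ => ?_
    rw [adjoint_analysisOp_single, map_smul, frameInv_latShift_gaussL]
  have h2 : ‖x‖ = √(∑ k ∈ F, ‖c k‖ ^ 2) := by
    have := lp.norm_sum_single (p := 2) (E := fun _ : ℤ × ℤ => ℂ) (by norm_num) c F
    rw [← Real.sqrt_sq (norm_nonneg x)]
    congr 1
    simpa using this
  rw [h1, ← h2]
  have h3 : ‖ContinuousLinearMap.adjoint analysisOp x‖ ≤ 1.56 * ‖x‖ := by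
    refine (ContinuousLinearMap.le_opNorm _ _).trans (mul_le_mul_of_nonneg_right ?_ (norm_nonneg _))
    rw [LinearIsometryEquiv.norm_map]
    exact norm_analysisOp_le
  have h4 := (frameInv.le_opNorm (ContinuousLinearMap.adjoint analysisOp x)).trans
    (mul_le_mul norm_frameInv_le h3 (norm_nonneg _) (by norm_num))
  nlinarith [norm_nonneg x]

end

/-! ### The canonical dual window -/

theorem coeFn_latShift_gaussL (k : ℤ × ℤ) :
    (latShift k gaussL : ℝ → ℂ) =ᵐ[volume] tfShift (latticePt mesh k) gaussian :=
  (coeFn_shiftL _ gaussL).trans (tfShift_congr_ae _ memLp_gaussian.coeFn_toLp)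

theorem coeFn_sum_smul {ι : Type*} (F : Finset ι) (c : ι → ℂ) (g : ι → L2R) (u : ι → ℝ → ℂ)
    (hu : ∀ i, (g i : ℝ → ℂ) =ᵐ[volume] u i) :
    ((∑ i ∈ F, c i • g i : L2R) : ℝ → ℂ) =ᵐ[volume] fun t => ∑ i ∈ F, c i * u i t := by
  classical
  induction F using Finset.induction_on with
  | empty =>
    simp only [Finset.sum_empty]
    exact Lp.coeFn_zero ℂ 2 (volume : Measure ℝ)
  | insert a F ha ih =>
    rw [Finset.sum_insert ha]
    filter_upwards [ih, Lp.coeFn_add (c a • g a) (∑ i ∈ F, c i • g i), Lp.coeFn_smul (c a) (g a), hu a]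
      with t h1 h2 h3 h4
    rw [h2, Pi.add_apply, h1, h3, Pi.smul_apply, h4, Finset.sum_insert ha, smul_eq_mul]

theorem isCanonicalDualWindow_iff (ψ : ℝ → ℂ) : IsCanonicalDualWindow ψ ↔ MemLp ψ 2 volume ∧
    HasSum (fun k : ℤ × ℤ => gabor ψ (latticePt mesh k) • latShift k gaussL) gaussL := by
  refine and_congr_right fun _ => ?_
  have key : ∀ F : Finset (ℤ × ℤ), eLpNorm (fun t : ℝ => gaussian t -
      ∑ k ∈ F, gabor ψ (latticePt mesh k) * tfShift (latticePt mesh k) gaussian t) 2 volume =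
      ‖(∑ k ∈ F, gabor ψ (latticePt mesh k) • latShift k gaussL) - gaussL‖ₑ := by
    intro F
    rw [← enorm_neg, neg_sub, Lp.enorm_def]
    refine eLpNorm_congr_ae ?_
    filter_upwards [Lp.coeFn_sub gaussL (∑ k ∈ F, gabor ψ (latticePt mesh k) • latShift k gaussL),
      coeFn_sum_smul F (fun k => gabor ψ (latticePt mesh k)) (fun k => latShift k gaussL) _
        coeFn_latShift_gaussL, memLp_gaussian.coeFn_toLp] with t h1 h2 h3
    rw [h1, Pi.sub_apply, h2]
    congr 1
    exact h3.symm
  simp only [key]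
  rw [HasSum, tendsto_iff_norm_sub_tendsto_zero]
  simp only [← ofReal_norm]
  rw [← ENNReal.ofReal_zero]
  constructor
  · intro h
    have := (ENNReal.tendsto_toReal (by simp)).comp h
    simpa [Function.comp_def] using this
  · exact fun h => ENNReal.tendsto_ofReal h

theorem isCanonicalDualWindow_dualL : IsCanonicalDualWindow dualL := by
  rw [isCanonicalDualWindow_iff]
  refine ⟨Lp.memLp _, ?_⟩
  have := hasSum_frame dualL
  rwa [dualL, ← mul_apply_eq_comp, frameOp_mul_frameInv] at this

/-- The frame operator is injective, so the choice of ψ made in the algorithm is immaterial. -/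
theorem IsCanonicalDualWindow.ae_eq_dualL {ψ : ℝ → ℂ} (h : IsCanonicalDualWindow ψ) :
    ψ =ᵐ[volume] dualL := by
  obtain ⟨hψ, hs⟩ := (isCanonicalDualWindow_iff ψ).1 h
  have h1 := hasSum_frame (hψ.toLp ψ)
  simp only [gabor_congr_ae hψ.coeFn_toLp] at h1
  have h2 : frameInv (frameOp (hψ.toLp ψ)) = frameInv gaussL := by rw [h1.unique hs]
  rw [← mul_apply_eq_comp, frameInv_mul_frameOp] at h2
  have h3 : hψ.toLp ψ = dualL := h2
  exact hψ.coeFn_toLp.symm.trans (by rw [h3])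

/-! ### Pointwise decay of the dual window and size of the coefficients -/

theorem ae_norm_le_of_hasSum {ι : Type*} [Countable ι] {g : ι → L2R} {h : L2R} (hs : HasSum g h)
    {w : ι → ℝ} (hw : Summable w) (hw0 : ∀ i, 0 ≤ w i) {E : ℝ → ℝ} (hE : ∀ t, 0 ≤ E t)
    (hb : ∀ i, ∀ᵐ t, ‖g i t‖ ≤ w i * E t) : ∀ᵐ t, ‖h t‖ ≤ (∑' i, w i) * E t := by
  classical
  have hF : ∀ F : Finset ι, ∀ᵐ t, ‖(∑ i ∈ F, g i : L2R) t‖ ≤ (∑' i, w i) * E t := by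
    intro F
    have h1 := coeFn_sum_smul F (fun _ => 1) g (fun i => g i) fun i => EventuallyEq.rfl
    simp only [one_smul, one_mul] at h1
    filter_upwards [h1, (ae_all_iff.2 hb)] with t ht hbt
    rw [ht]
    refine (norm_sum_le _ _).trans ((Finset.sum_le_sum fun i _ => hbt i).trans ?_)
    rw [← Finset.sum_mul]
    exact mul_le_mul_of_nonneg_right (hw.sum_le_tsum F fun i _ => hw0 i) (hE t)
  -- L² convergence gives almost everywhere convergence only along a sequence of finite sets, which
  -- is enough since the bound holds for all finite sums.
  have hm : TendstoInMeasure volume (fun F : Finset ι => ((∑ i ∈ F, g i : L2R) : ℝ → ℂ)) atTop h :=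
    tendstoInMeasure_of_tendsto_Lp hs
  obtain ⟨ns, -, hns⟩ := hm.exists_seq_tendsto_ae'
  filter_upwards [hns, ae_all_iff.2 fun n => hF (ns n)] with t h1 h2
  exact le_of_tendsto h1.norm (Eventually.of_forall h2)

/-- Completing the square, -πx² ≤ π/16 - (π/2)|x|, and 2^{1/4}·e^{π/16} < 1.4484. The translation by
√2·k costs e^{(π/√2)|k|}, where π/√2 < 2.25. -/
theorem norm_gaussian_shift_le (t : ℝ) (k : ℤ) : ‖gaussian (t - mesh * (2 * k))‖ ≤
    1.4484 * Real.exp (2.25 * |(k : ℝ)|) * Real.exp (-(Real.pi / 2) * |t|) := by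
  rw [gaussian, Complex.norm_real, Real.norm_of_nonneg (by positivity)]
  have h1 : (2 : ℝ) ^ (1 / 4 : ℝ) ≤ 1.19 := by
    rw [← Real.rpow_le_rpow_iff (z := 4) (by positivity) (by norm_num) (by norm_num),
      ← Real.rpow_mul two_pos.le]
    norm_num
  have h2 : Real.exp (Real.pi / 16) ≤ 1.2171 := by
    have hp := Real.pi_lt_d6
    refine (Real.exp_le_exp.2 (by linarith : Real.pi / 16 ≤ 0.1964)).trans ?_
    have := Real.exp_bound' (x := 0.1964) (by norm_num) (by norm_num) (n := 5) (by norm_num)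
    refine this.trans ?_
    norm_num [Finset.sum_range_succ, Nat.factorial]
  set x : ℝ := t - mesh * (2 * k)
  have hm : mesh * 2 * Real.pi / 2 ≤ 2.25 := by
    have hm0 := mesh_pos
    have hms := mesh_sq
    have : mesh ≤ 0.7072 := by nlinarith
    nlinarith [Real.pi_lt_d4, Real.pi_pos]
  have hx : |t| - mesh * 2 * |(k : ℝ)| ≤ |x| := by
    have h3 : |mesh * (2 * (k : ℝ))| = mesh * 2 * |(k : ℝ)| := by
      rw [abs_mul, abs_mul, abs_of_pos mesh_pos, abs_of_pos two_pos, mul_assoc]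
    rw [← h3]; exact abs_sub_abs_le_abs_sub _ _
  have h4 : Real.exp (-Real.pi * x ^ 2) ≤ Real.exp (Real.pi / 16) *
      (Real.exp (2.25 * |(k : ℝ)|) * Real.exp (-(Real.pi / 2) * |t|)) := by
    rw [← Real.exp_add, ← Real.exp_add, Real.exp_le_exp]
    have hp := Real.pi_pos
    have h5 : -Real.pi * x ^ 2 ≤ Real.pi / 16 - Real.pi / 2 * |x| := by
      rw [← sq_abs x]
      nlinarith [mul_nonneg hp.le (sq_nonneg (|x| - 1 / 4))]
    nlinarith [mul_le_mul_of_nonneg_right hm (abs_nonneg (k : ℝ)),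
      mul_le_mul_of_nonneg_left hx hp.le]
  have hpos : 0 < Real.exp (2.25 * |(k : ℝ)|) * Real.exp (-(Real.pi / 2) * |t|) := by positivity
  calc _ ≤ 1.19 * (1.2171 * (Real.exp (2.25 * |(k : ℝ)|) * Real.exp (-(Real.pi / 2) * |t|))) := by
        gcongr
        exact h4.trans (by gcongr)
    _ ≤ _ := by nlinarith

/-- The series for the inverse frame operator is applied to φ termwise. The weighted sum pays for
translations, the unweighted one for modulations: ½·1.4484·6·1.12 < 5. -/
theorem ae_norm_dualL_le : ∀ᵐ t, ‖dualL t‖ ≤ 5 * Real.exp (-(Real.pi / 2) * |t|) := by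
  have hs : HasSum (fun p : ℤ × ℤ => ((1 / 2 * (thetaInv p.1 * thetaInv p.2) : ℝ) : ℂ) •
      latShift (2 * p.1, 2 * p.2) gaussL) dualL :=
    hasSum_frameInv.mapL (ContinuousLinearMap.apply ℂ L2R gaussL)
  have h1 := summable_abs_thetaInv
  have h2 := summable_exp_abs_thetaInv
  have hp : Summable fun p : ℤ × ℤ => (Real.exp (2.25 * |(p.1 : ℝ)|) * |thetaInv p.1|) *
      |thetaInv p.2| :=
    h2.1.mul_of_nonneg h1.1 (fun _ => by positivity) (fun _ => abs_nonneg _)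
  have hle : ∑' p : ℤ × ℤ, (1 / 2 * 1.4484) * ((Real.exp (2.25 * |(p.1 : ℝ)|) * |thetaInv p.1|) *
      |thetaInv p.2|) ≤ 5 := by
    rw [tsum_mul_left, ← h2.1.tsum_mul_tsum h1.1 hp]
    have := mul_le_mul h2.2 h1.2 (tsum_nonneg fun _ => abs_nonneg _) (by norm_num)
    linarith
  have := ae_norm_le_of_hasSum hs (hp.mul_left (1 / 2 * 1.4484)) (fun i => by positivity)
    (E := fun t => Real.exp (-(Real.pi / 2) * |t|)) (fun t => by positivity) fun p => by
      filter_upwards [Lp.coeFn_smul ((1 / 2 * (thetaInv p.1 * thetaInv p.2) : ℝ) : ℂ)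
        (latShift (2 * p.1, 2 * p.2) gaussL), coeFn_latShift_gaussL (2 * p.1, 2 * p.2)] with t h3 h4
      rw [h3, Pi.smul_apply, h4, norm_smul, abs_frameInv_coeff, norm_tfShift]
      have := norm_gaussian_shift_le t p.1
      have e : t - (latticePt mesh (2 * p.1, 2 * p.2)).1 = t - mesh * (2 * p.1) := by
        simp [latticePt]
      rw [e]
      calc _ ≤ 1 / 2 * (|thetaInv p.1| * |thetaInv p.2|) *
            (1.4484 * Real.exp (2.25 * |(p.1 : ℝ)|) * Real.exp (-(Real.pi / 2) * |t|)) := by gcongr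
        _ = _ := by ring
  filter_upwards [this] with t ht
  exact ht.trans (by gcongr)

/-- A supremum bound, independent of the L² norm of f: the coefficient is an ℓ¹-weighted combination
of values of 𝒢f at other lattice points, because shifts of the doubled lattice can be moved onto the
Gaussian without a phase. -/
theorem norm_inner_latShift_frameInv_le {f : L2R} (hf : ∀ p, ‖gabor f p‖ ≤ 1) (k : ℤ × ℤ) :
    ‖gabor (frameInv f) (latticePt mesh k)‖ ≤ 0.63 := by
  have hs := (hasSum_frameInv.mapL (ContinuousLinearMap.apply ℂ L2R f)).mapL
    (innerSL ℂ (latShift k gaussL))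
  rw [ContinuousLinearMap.apply_apply, innerSL_apply_apply, inner_latShift_gaussL] at hs
  rw [← hs.tsum_eq]
  refine (tsum_of_norm_bounded summable_thetaInv_prod.1.hasSum fun p => ?_).trans
    summable_thetaInv_prod.2
  rw [ContinuousLinearMap.apply_apply, smul_apply, innerSL_apply_apply,
    inner_smul_right, norm_mul, abs_frameInv_coeff]
  refine mul_le_of_le_one_right (by positivity) ?_
  have e : latShift k gaussL =
      latShift (2 * p.1, 2 * p.2) (latShift (k - (2 * p.1, 2 * p.2)) gaussL) := by
    rw [← mul_apply_eq_comp, latShift_mul _ _ ((k.2 - 2 * p.2) * p.1) (by simp; ring)]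
    congr 2
    abel
  rw [e, latShift_apply, latShift_apply _ f, LinearIsometry.inner_map_map, inner_latShift_gaussL]
  exact hf _

theorem hasSum_gabor_expansion (f : L2R) (p : ℝ × ℝ) :
    HasSum (fun k : ℤ × ℤ => gabor (frameInv f) (latticePt mesh k) *
      phaseFun (gaussBargmann (latticePt mesh k)) p) (gabor f p) := by
  have h := (hasSum_frame (frameInv f)).mapL (innerSL ℂ (coh p))
  rw [← mul_apply_eq_comp, frameOp_mul_frameInv, innerSL_apply_apply] at h
  change HasSum _ (inner ℂ (coh p) f) at h
  rw [inner_coh] at h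
  refine h.congr_fun fun k => ?_
  rw [innerSL_apply_apply, inner_smul_right, ← coh_latticePt, inner_coh_coh, phaseFun, gaussBargmann,
    Complex.exp_add (-Real.pi * (p.1 : ℂ) ^ 2)]

/-! ### Feasibility of the first program -/

theorem ansatz_vecMulVec {Γ : Finset (ℤ × ℤ)} (c : ℤ × ℤ → ℂ) (x₁ x₂ : ℝ) :
    ansatz (Matrix.vecMulVec (fun k : Γ => c k) (star fun k : Γ => c k)) ((x₁ : ℂ), (x₂ : ℂ)) =
      ((‖∑ k ∈ Γ, c k * phaseFun (gaussBargmann (latticePt mesh k)) (x₁, x₂)‖ ^ 2 : ℝ) : ℂ) := by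
  rw [← Complex.normSq_eq_norm_sq, ← Complex.mul_conj, map_sum, ← Finset.sum_coe_sort Γ,
    ← Finset.sum_coe_sort Γ, Finset.sum_mul_sum, ansatz]
  refine Finset.sum_congr rfl fun k _ => Finset.sum_congr rfl fun l _ => ?_
  rw [Matrix.vecMulVec_apply, ansatzPhi_eq, crossExt_ofReal, map_mul, Pi.star_apply, RCLike.star_def]
  ring

/-- Lattice points outside Γ are at distance at least R. The Gaussian e^{-(π/2)d²} is split into
e^{-0.45πR²}, which supplies the smallness, and e^{-0.05πd²}, which is summed over the lattice. -/
theorem norm_gabor_sub_sum_le {f : L2R} (hf : ∀ p, ‖gabor f p‖ ≤ 1) {X Y R ε : ℝ} (hε : 0 < ε)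
    (hε1 : ε ≤ Real.exp (-1)) (hR : 2.1 + 0.9 * √(Real.log (1 / ε)) ≤ R) {x₁ x₂ : ℝ}
    (hx₁ : |x₁| ≤ X + R) (hx₂ : |x₂| ≤ Y + R) :
    ‖gabor f (x₁, x₂) - ∑ k ∈ latticeRect mesh (X + 2 * R) (Y + 2 * R),
      gabor (frameInv f) (latticePt mesh k) * phaseFun (gaussBargmann (latticePt mesh k)) (x₁, x₂)‖ ≤
      ε / 5 := by
  set Γ := latticeRect mesh (X + 2 * R) (Y + 2 * R)
  have hR0 : 0 < R := by
    have := Real.sqrt_nonneg (Real.log (1 / ε)); linarith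
  have hs := hasSum_gabor_expansion f (x₁, x₂)
  set u : ℤ × ℤ → ℂ := fun k => gabor (frameInv f) (latticePt mesh k) *
    phaseFun (gaussBargmann (latticePt mesh k)) (x₁, x₂) with hu
  have hΓ : HasSum (fun k => if k ∈ Γ then u k else 0) (∑ k ∈ Γ, u k) := by
    have : HasSum (fun k => if k ∈ Γ then u k else 0) (∑ k ∈ Γ, if k ∈ Γ then u k else 0) :=
      hasSum_sum_of_ne_finset_zero fun k hk => if_neg hk
    rwa [Finset.sum_congr rfl fun k hk => if_pos hk] at this
  have hb := tsum_exp_neg_lattice_le (b := Real.pi / 40) (by positivity) (x₁, x₂)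
  rw [← (hs.sub hΓ).tsum_eq]
  refine (tsum_of_norm_bounded
    (hb.1.hasSum.mul_left (0.63 * Real.exp (-(0.45 * Real.pi) * R ^ 2))) fun k => ?_).trans ?_
  · by_cases hk : k ∈ Γ
    · simp only [hk, if_true, sub_self, norm_zero]; positivity
    · simp only [hk, if_false, sub_zero, hu, norm_mul, norm_phaseFun_gaussBargmann]
      have hd : R ^ 2 ≤ (x₁ - (latticePt mesh k).1) ^ 2 + (x₂ - (latticePt mesh k).2) ^ 2 := by
        rw [mem_latticeRect mesh_pos, Set.mem_prod, Set.mem_Icc, Set.mem_Icc, ← abs_le, ← abs_le,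
          not_and_or, not_le, not_le] at hk
        rcases hk with hk | hk
        · have h1 : R ≤ |x₁ - (latticePt mesh k).1| := by
            have := abs_sub_abs_le_abs_sub (latticePt mesh k).1 x₁
            rw [abs_sub_comm] at this
            linarith
          nlinarith [sq_abs (x₁ - (latticePt mesh k).1), sq_nonneg (x₂ - (latticePt mesh k).2)]
        · have h1 : R ≤ |x₂ - (latticePt mesh k).2| := by
            have := abs_sub_abs_le_abs_sub (latticePt mesh k).2 x₂
            rw [abs_sub_comm] at this
            linarith
          nlinarith [sq_abs (x₂ - (latticePt mesh k).2), sq_nonneg (x₁ - (latticePt mesh k).1)]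
      rw [mul_assoc, ← Real.exp_add]
      refine mul_le_mul (norm_inner_latShift_frameInv_le hf k) ?_ (Real.exp_pos _).le (by norm_num)
      rw [Real.exp_le_exp]
      nlinarith [Real.pi_pos, mul_le_mul_of_nonneg_left hd Real.pi_pos.le]
  · have hpi := Real.pi_gt_d4
    have hpi2 := Real.pi_lt_d4
    have hL : 1 ≤ Real.log (1 / ε) := by
      rw [one_div, Real.log_inv, ← neg_neg (1 : ℝ), ← Real.log_exp (-1)]
      exact neg_le_neg (Real.log_le_log hε hε1)
    have hsq : 1 ≤ √(Real.log (1 / ε)) := Real.one_le_sqrt.2 hL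
    have hss := Real.sq_sqrt (zero_le_one.trans hL)
    -- Squaring the lower bound for R, with logarithm at least 1, gives 2.1² + 2·2.1·0.9 = 8.19. The
    -- factor 0.45π turns this into more than 11 + log(1/ε).
    have hR2 : 8.19 + 0.81 * Real.log (1 / ε) ≤ R ^ 2 := by nlinarith
    have he : Real.exp (-(0.45 * Real.pi) * R ^ 2) ≤ Real.exp (-11) * ε := by
      rw [← Real.exp_log hε, ← Real.exp_add, Real.exp_le_exp]
      rw [one_div, Real.log_inv] at hR2 hL
      nlinarith [mul_le_mul_of_nonneg_left hR2 Real.pi_pos.le,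
        mul_nonneg (sub_nonneg.2 hpi.le) (zero_le_one.trans hL)]
    have he11 : Real.exp (-11) ≤ 1 / 50000 := by
      have h1 := Real.exp_one_gt_d9
      have h2 : Real.exp 11 = Real.exp 1 ^ 11 := by rw [← Real.exp_nat_mul]; norm_num
      rw [Real.exp_neg, h2, inv_eq_one_div]
      refine one_div_le_one_div_of_le (by norm_num) ?_
      calc (50000 : ℝ) ≤ 2.7 ^ 11 := by norm_num
        _ ≤ _ := by gcongr; linarith
    have hinv : (1 - Real.exp (-(Real.pi / 40)))⁻¹ ≤ 14 := by
      have h1 := Real.add_one_le_exp (Real.pi / 40)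
      have h2 : Real.exp (-(Real.pi / 40)) ≤ 1 / (1 + Real.pi / 40) := by
        rw [Real.exp_neg, inv_eq_one_div]
        exact one_div_le_one_div_of_le (by positivity) (by linarith)
      have h3 : 1 / (1 + Real.pi / 40) ≤ 13 / 14 := by
        rw [div_le_div_iff₀ (by positivity) (by norm_num)]; linarith
      rw [inv_eq_one_div, div_le_iff₀ (by linarith)]
      linarith
    have hinv0 : 0 ≤ (1 - Real.exp (-(Real.pi / 40)))⁻¹ := by
      rw [inv_nonneg, sub_nonneg, Real.exp_le_one_iff]; linarith
    have hb2 := hb.2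
    have hsq2 : (2 * (1 - Real.exp (-(Real.pi / 40)))⁻¹) ^ 2 ≤ 784 := by nlinarith
    calc _ ≤ 0.63 * (1 / 50000 * ε) * 784 := by
          gcongr
          · exact he.trans (by gcongr)
          · exact hb2.trans hsq2
      _ ≤ _ := by nlinarith

/-- The witness is the rank-one matrix cc*, where c holds the coefficients of f in the Gaussian
frame: F_A is then the squared modulus of the truncated expansion. Truncation uses at most ε/2 of
the tolerance, noise the other ε/2, and the diagonal is at most 0.63² < 0.4. -/
theorem exists_feasible {f : ℝ → ℂ} (hf : MemLp f 2 volume) (hf1 : ∀ p, ‖gabor f p‖ ≤ 1)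
    {T S R s ε : ℝ} (hs : 0 < s) (hε : 0 < ε)
    (hε1 : ε ≤ Real.exp (-1)) (hR : 2.1 + 0.9 * √(Real.log (1 / ε)) ≤ R)
    (σ : setΩ T S R s → ℝ)
    (hσ : ∀ k : setΩ T S R s, |σ k - spectrogram f (latticePt s k)| ≤ ε / 2) :
    ∃ A : Matrix (setΓ T S R) (setΓ T S R) ℂ, Feasible₁ s ε σ A ∧ maxDiag A ≤ 0.4 := by
  set F : L2R := hf.toLp f
  have hF : ∀ p, gabor F p = gabor f p := gabor_congr_ae hf.coeFn_toLp
  have hF1 : ∀ p, ‖gabor F p‖ ≤ 1 := fun p => by rw [hF]; exact hf1 p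
  set c : ℤ × ℤ → ℂ := fun k => gabor (frameInv F) (latticePt mesh k)
  refine ⟨Matrix.vecMulVec (fun k : setΓ T S R => c k) (star fun k : setΓ T S R => c k),
    ⟨Matrix.posSemidef_vecMulVec_self_star _, fun k => ?_⟩, ?_⟩
  · rw [ansatz_vecMulVec, ← Complex.ofReal_sub, Complex.norm_real, Real.norm_eq_abs]
    have hk := (mem_latticeRect hs k).1 k.2
    rw [Set.mem_prod, Set.mem_Icc, Set.mem_Icc, ← abs_le, ← abs_le] at hk
    have h1 := norm_gabor_sub_sum_le hF1 hε hε1 hR hk.1 hk.2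
    rw [hF] at h1
    have h2 := hσ k
    rw [spectrogram] at h2
    set p : ℝ × ℝ := latticePt s k
    set z := gabor f p
    change ‖z - _‖ ≤ _ at h1
    set w := ∑ k ∈ setΓ T S R, c k * phaseFun (gaussBargmann (latticePt mesh k)) (p.1, p.2)
    have hz : ‖z‖ ≤ 1 := hf1 p
    have h3 : |‖z‖ - ‖w‖| ≤ ε / 5 := (abs_norm_sub_norm_le z w).trans h1
    have hε2 : ε ≤ 1 / 2 := hε1.trans (by
      have := Real.exp_one_gt_d9
      rw [Real.exp_neg, inv_eq_one_div]; gcongr; linarith)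
    have h4 : |‖w‖ ^ 2 - ‖z‖ ^ 2| ≤ ε / 2 := by
      rw [abs_le] at h3 ⊢
      constructor <;> nlinarith [norm_nonneg z, norm_nonneg w]
    calc |‖w‖ ^ 2 - σ k| ≤ |‖w‖ ^ 2 - ‖z‖ ^ 2| + |‖z‖ ^ 2 - σ k| := abs_sub_le _ _ _
      _ ≤ ε / 2 + ε / 2 := add_le_add h4 (by rw [abs_sub_comm]; exact h2)
      _ = ε := by ring
  · refine Real.iSup_le (fun k => ?_) (by norm_num)
    rw [Matrix.vecMulVec_apply, Pi.star_apply, RCLike.star_def, Complex.mul_conj, Complex.ofReal_re,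
      Complex.normSq_eq_norm_sq]
    have : ‖c k‖ ≤ 0.63 := norm_inner_latShift_frameInv_le hF1 k
    nlinarith [norm_nonneg (c k)]

/-! ### Quadratic forms in an eigenbasis -/

section Spectral

variable {𝕜 V : Type*} [RCLike 𝕜] [Fintype V] [DecidableEq V] {M : Matrix V V 𝕜}

theorem sum_star_dotProduct_eigenvector (hM : M.IsHermitian) (x y : V → 𝕜) :
    ∑ i, (star x ⬝ᵥ (hM.eigenvectorBasis i).ofLp) * (star (hM.eigenvectorBasis i).ofLp ⬝ᵥ y) =
      star x ⬝ᵥ y := by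
  have := hM.eigenvectorBasis.sum_inner_mul_inner (WithLp.toLp 2 x) (WithLp.toLp 2 y)
  simp only [EuclideanSpace.inner_eq_star_dotProduct] at this
  simpa only [dotProduct_comm (star _)] using this

theorem star_eigenvector_dotProduct_mulVec (hM : M.IsHermitian) (i : V) (y : V → 𝕜) :
    star (hM.eigenvectorBasis i).ofLp ⬝ᵥ M.mulVec y =
      (hM.eigenvalues i : 𝕜) * (star (hM.eigenvectorBasis i).ofLp ⬝ᵥ y) := by
  have h := hM.mulVec_eigenvectorBasis i
  rw [Matrix.dotProduct_mulVec]
  have h2 : Matrix.vecMul (star (hM.eigenvectorBasis i).ofLp) M =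
      star (M.mulVec (hM.eigenvectorBasis i).ofLp) := by
    rw [Matrix.star_mulVec, hM.eq]
  rw [h2, h, RCLike.real_smul_eq_coe_smul (K := 𝕜), star_smul, smul_dotProduct, smul_eq_mul]
  simp

theorem star_dotProduct_eigenvector (hM : M.IsHermitian) (x : V → 𝕜) (i : V) :
    star x ⬝ᵥ (hM.eigenvectorBasis i).ofLp = star (star (hM.eigenvectorBasis i).ofLp ⬝ᵥ x) := by
  rw [Matrix.star_dotProduct]

/-- The quadratic form of a Hermitian matrix in its eigenbasis. -/
theorem star_dotProduct_mulVec_eq (hM : M.IsHermitian) (x : V → 𝕜) :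
    star x ⬝ᵥ M.mulVec x =
      ((∑ i, hM.eigenvalues i * ‖star (hM.eigenvectorBasis i).ofLp ⬝ᵥ x‖ ^ 2 : ℝ) : 𝕜) := by
  rw [← sum_star_dotProduct_eigenvector hM]
  push_cast
  refine Finset.sum_congr rfl fun i _ => ?_
  rw [star_eigenvector_dotProduct_mulVec, star_dotProduct_eigenvector, mul_left_comm,
    RCLike.star_def, RCLike.conj_mul]

theorem sum_norm_sq_eigenvector (hM : M.IsHermitian) (x : V → 𝕜) :
    ∑ i, ‖star (hM.eigenvectorBasis i).ofLp ⬝ᵥ x‖ ^ 2 = ∑ u, ‖x u‖ ^ 2 := by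
  have h := sum_star_dotProduct_eigenvector hM x x
  simp only [star_dotProduct_eigenvector, RCLike.star_def, RCLike.conj_mul] at h
  have h2 : star x ⬝ᵥ x = ((∑ u, ‖x u‖ ^ 2 : ℝ) : 𝕜) := by
    simp only [dotProduct, Pi.star_apply, RCLike.star_def, RCLike.conj_mul]
    push_cast; rfl
  rw [h2] at h
  exact_mod_cast h

end Spectral

/-! ### The Laplacian of a vertex-weighted graph -/

section Graph

open Classical

variable {V : Type*} [Fintype V] (G : SimpleGraph V) (α : V → ℝ)

/-- Symmetrizing over the orientation of the edges exhibits a Dirichlet form, which is nonnegative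
and annihilates √α. -/
theorem dotProduct_vwLaplacian (hα : ∀ u, 0 ≤ α u) (x : V → ℝ) :
    x ⬝ᵥ (vwLaplacian G α).mulVec x =
      1 / 2 * ∑ u, ∑ v, if G.Adj u v then (√(α v) * x u - √(α u) * x v) ^ 2 else 0 := by
  have h1 : ∀ u v, vwLaplacian G α u v * x v =
      (if u = v then (∑ z, if G.Adj u z then α z else 0) * x v else 0) -
        if G.Adj u v then √(α u) * √(α v) * x v else 0 := by
    intro u v
    rw [vwLaplacian, Matrix.of_apply]
    by_cases h : u = v
    · subst h; simp
    · by_cases h' : G.Adj u v <;> simp [h, h', Real.sqrt_mul (hα u)]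
  have h2 : ∀ u, (vwLaplacian G α).mulVec x u =
      ∑ v, if G.Adj u v then α v * x u - √(α u) * √(α v) * x v else 0 := by
    intro u
    rw [Matrix.mulVec, dotProduct, Finset.sum_congr rfl fun v _ => h1 u v, Finset.sum_sub_distrib]
    simp only [Finset.sum_ite_eq, Finset.mem_univ, if_true]
    rw [Finset.sum_mul, ← Finset.sum_sub_distrib]
    refine Finset.sum_congr rfl fun v _ => ?_
    split_ifs <;> ring
  have h3 : ∑ u, ∑ v, (if G.Adj u v then α v * x u ^ 2 - √(α u) * √(α v) * x u * x v else 0) =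
      ∑ u, ∑ v, if G.Adj u v then α u * x v ^ 2 - √(α u) * √(α v) * x u * x v else 0 := by
    rw [Finset.sum_comm]
    refine Finset.sum_congr rfl fun u _ => Finset.sum_congr rfl fun v _ => ?_
    rw [G.adj_comm v u]
    split_ifs <;> ring
  have h4 : x ⬝ᵥ (vwLaplacian G α).mulVec x =
      ∑ u, ∑ v, (if G.Adj u v then α v * x u ^ 2 - √(α u) * √(α v) * x u * x v else 0) := by
    rw [dotProduct]
    refine Finset.sum_congr rfl fun u _ => ?_
    rw [h2, Finset.mul_sum]
    refine Finset.sum_congr rfl fun v _ => ?_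
    split_ifs <;> ring
  have h5 : (∑ u, ∑ v, if G.Adj u v then (√(α v) * x u - √(α u) * x v) ^ 2 else 0) =
      (∑ u, ∑ v, (if G.Adj u v then α v * x u ^ 2 - √(α u) * √(α v) * x u * x v else 0)) +
      ∑ u, ∑ v, if G.Adj u v then α u * x v ^ 2 - √(α u) * √(α v) * x u * x v else 0 := by
    simp only [← Finset.sum_add_distrib]
    refine Finset.sum_congr rfl fun u _ => Finset.sum_congr rfl fun v _ => ?_
    split_ifs
    · have e1 := Real.sq_sqrt (hα u)
      have e2 := Real.sq_sqrt (hα v)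
      linear_combination x u ^ 2 * e2 + x v ^ 2 * e1
    · ring
  rw [h5, ← h3, h4]; ring

theorem eigenvalues_vwLaplacian_nonneg (hα : ∀ u, 0 ≤ α u) (i : V) :
    0 ≤ (vwLaplacian_isHermitian G α).eigenvalues i := by
  have hP : (vwLaplacian G α).PosSemidef := by
    refine Matrix.PosSemidef.of_dotProduct_mulVec_nonneg (vwLaplacian_isHermitian G α) fun x => ?_
    rw [star_trivial, dotProduct_vwLaplacian G α hα]
    refine mul_nonneg (by norm_num) (Finset.sum_nonneg fun u _ => Finset.sum_nonneg fun v _ => ?_)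
    split_ifs <;> positivity
  exact hP.eigenvalues_nonneg i

theorem spectralGap_nonneg (hα : ∀ u, 0 ≤ α u) : 0 ≤ spectralGap G α := by
  rw [spectralGap]
  split_ifs with h
  · have := eigenvalues_vwLaplacian_nonneg G α hα
      ((Fintype.equivOfCardEq (Fintype.card_fin _)) ⟨Fintype.card V - 2, by omega⟩)
    rwa [Matrix.IsHermitian.eigenvalues, Equiv.symm_apply_apply] at this
  · exact le_rfl

/-- The variational characterization of the spectral gap. -/
theorem spectralGap_mul_le (hα : ∀ u, 0 ≤ α u) (h0 : 0 < ∑ u, α u) (hgap : 0 < spectralGap G α)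
    (x : V → ℝ) : spectralGap G α * (∑ u, x u ^ 2 - (∑ u, √(α u) * x u) ^ 2 / ∑ u, α u) ≤
      1 / 2 * ∑ u, ∑ v, if G.Adj u v then (√(α v) * x u - √(α u) * x v) ^ 2 else 0 := by
  have hcard : 2 ≤ Fintype.card V := by
    by_contra h
    rw [spectralGap, dif_neg h] at hgap
    exact lt_irrefl _ hgap
  set hL := vwLaplacian_isHermitian G α
  set e := Fintype.equivOfCardEq (Fintype.card_fin (Fintype.card V))
  -- Eigenvalues are listed in decreasing order, so the last index carries the smallest one and all
  -- others are at least the gap.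
  set i₀ : V := e ⟨Fintype.card V - 1, by omega⟩ with hi₀
  have hgap' : spectralGap G α = hL.eigenvalues₀ ⟨Fintype.card V - 2, by omega⟩ := by
    rw [spectralGap, dif_pos hcard]
  have hev : ∀ i, i ≠ i₀ → spectralGap G α ≤ hL.eigenvalues i := by
    intro i hi
    rw [hgap', Matrix.IsHermitian.eigenvalues]
    refine hL.eigenvalues₀_antitone ?_
    rw [Fin.le_def]
    have h1 := (e.symm i).2
    have h2 : (e.symm i : ℕ) ≠ Fintype.card V - 1 := by
      intro h
      apply hi
      rw [hi₀, ← e.apply_symm_apply i]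
      congr 1
      exact Fin.ext h
    change (e.symm i : ℕ) ≤ Fintype.card V - 2
    omega
  set c : (V → ℝ) → V → ℝ := fun y i => star (hL.eigenvectorBasis i).ofLp ⬝ᵥ y with hc
  set w : V → ℝ := fun u => √(α u) with hw
  have hww : ∑ u, w u ^ 2 = ∑ u, α u := Finset.sum_congr rfl fun u _ => Real.sq_sqrt (hα u)
  have hquad : ∀ y, y ⬝ᵥ (vwLaplacian G α).mulVec y = ∑ i, hL.eigenvalues i * c y i ^ 2 := by
    intro y
    have := star_dotProduct_mulVec_eq hL y
    simp only [star_trivial, Real.norm_eq_abs, sq_abs] at this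
    simp only [hc, star_trivial]
    exact this
  have hpars : ∀ y, ∑ i, c y i ^ 2 = ∑ u, y u ^ 2 := by
    intro y
    have := sum_norm_sq_eigenvector hL y
    simpa only [Real.norm_eq_abs, sq_abs] using this
  have hnn := eigenvalues_vwLaplacian_nonneg G α hα
  -- The vector √α has zero energy, while all eigenvalues other than the one at `i₀` are positive;
  -- so √α lies in the direction of that single eigenvector.
  have hwz : ∀ i, i ≠ i₀ → c w i = 0 := by
    intro i hi
    have h1 : ∑ i, hL.eigenvalues i * c w i ^ 2 = 0 := by
      rw [← hquad, dotProduct_vwLaplacian G α hα]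
      refine mul_eq_zero_of_right _ (Finset.sum_eq_zero fun u _ => Finset.sum_eq_zero fun v _ => ?_)
      split_ifs
      · simp only [hw]; ring
      · rfl
    have h2 := (Finset.sum_eq_zero_iff_of_nonneg fun i _ =>
      mul_nonneg (hnn i) (sq_nonneg _)).1 h1 i (Finset.mem_univ i)
    have h3 := hgap.trans_le (hev i hi)
    exact pow_eq_zero_iff two_ne_zero |>.1 ((mul_eq_zero.1 h2).resolve_left h3.ne')
  have hwE : c w i₀ ^ 2 = ∑ u, α u := by
    rw [← hww, ← hpars w, Finset.sum_eq_single i₀]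
    · intro i _ hi; rw [hwz i hi]; ring
    · simp
  have hwx : ∑ u, √(α u) * x u = c w i₀ * c x i₀ := by
    have := sum_star_dotProduct_eigenvector hL w x
    simp only [star_trivial] at this
    have h2 : w ⬝ᵥ x = ∑ u, √(α u) * x u := rfl
    rw [← h2, ← this, Finset.sum_eq_single i₀]
    · rw [dotProduct_comm w]; rfl
    · intro i _ hi
      have := hwz i hi
      simp only [hc, star_trivial] at this
      rw [dotProduct_comm w, this, zero_mul]
    · simp
  rw [← dotProduct_vwLaplacian G α hα, hquad, hwx, mul_pow, hwE, mul_comm (∑ u, α u),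
    mul_div_assoc, div_self h0.ne', mul_one, ← hpars x,
    ← Finset.add_sum_erase _ _ (Finset.mem_univ i₀), add_sub_cancel_left,
    ← Finset.add_sum_erase _ _ (Finset.mem_univ i₀), Finset.mul_sum]
  refine le_add_of_nonneg_of_le (mul_nonneg (hnn i₀) (sq_nonneg _)) ?_
  exact Finset.sum_le_sum fun i hi => mul_le_mul_of_nonneg_right (hev i (Finset.ne_of_mem_erase hi))
    (sq_nonneg _)

theorem spectralGap_mul_le_complex (hα : ∀ u, 0 ≤ α u) (h0 : 0 < ∑ u, α u)
    (hgap : 0 < spectralGap G α) (z : V → ℂ) :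
    spectralGap G α * (∑ u, ‖z u‖ ^ 2 - ‖∑ u, (√(α u) : ℂ) * z u‖ ^ 2 / ∑ u, α u) ≤
      1 / 2 * ∑ u, ∑ v, if G.Adj u v then ‖(√(α v) : ℂ) * z u - (√(α u) : ℂ) * z v‖ ^ 2 else 0 := by
  have h1 := spectralGap_mul_le G α hα h0 hgap fun u => (z u).re
  have h2 := spectralGap_mul_le G α hα h0 hgap fun u => (z u).im
  have hn : ∀ w : ℂ, ‖w‖ ^ 2 = w.re ^ 2 + w.im ^ 2 := fun w => by
    rw [← Complex.normSq_eq_norm_sq, Complex.normSq_apply]; ring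
  have e1 : ∑ u, ‖z u‖ ^ 2 = ∑ u, (z u).re ^ 2 + ∑ u, (z u).im ^ 2 := by
    rw [← Finset.sum_add_distrib]; exact Finset.sum_congr rfl fun u _ => hn _
  have e2 : ‖∑ u, (√(α u) : ℂ) * z u‖ ^ 2 =
      (∑ u, √(α u) * (z u).re) ^ 2 + (∑ u, √(α u) * (z u).im) ^ 2 := by
    rw [hn, Complex.re_sum, Complex.im_sum]
    simp only [Complex.re_ofReal_mul, Complex.im_ofReal_mul]
  have e3 : (∑ u, ∑ v, if G.Adj u v then ‖(√(α v) : ℂ) * z u - (√(α u) : ℂ) * z v‖ ^ 2 else 0) =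
      (∑ u, ∑ v, if G.Adj u v then (√(α v) * (z u).re - √(α u) * (z v).re) ^ 2 else 0) +
      ∑ u, ∑ v, if G.Adj u v then (√(α v) * (z u).im - √(α u) * (z v).im) ^ 2 else 0 := by
    simp only [← Finset.sum_add_distrib]
    refine Finset.sum_congr rfl fun u _ => Finset.sum_congr rfl fun v _ => ?_
    split_ifs
    · rw [hn, Complex.sub_re, Complex.sub_im]
      simp only [Complex.re_ofReal_mul, Complex.im_ofReal_mul]
    · ring
  rw [e1, e2, e3, add_div]
  linarith

/-- The gap inequality twisted by the phases of `a`. -/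
theorem spectralGap_mul_le_phase (a : V → ℂ) (h0 : 0 < ∑ u, ‖a u‖ ^ 2)
    (hgap : 0 < spectralGap G fun u => ‖a u‖ ^ 2) (y : V → ℂ) :
    spectralGap G (fun u => ‖a u‖ ^ 2) *
        (∑ u, ‖y u‖ ^ 2 - ‖∑ u, conj (a u) * y u‖ ^ 2 / ∑ u, ‖a u‖ ^ 2) ≤
      1 / 2 * ∑ u, ∑ v, if G.Adj u v then ‖a v‖ ^ 2 * ‖y u‖ ^ 2 + ‖a u‖ ^ 2 * ‖y v‖ ^ 2 -
        2 * (conj (a u) * a v * (y u * conj (y v))).re else 0 := by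
  -- Multiplication by the conjugate phases of a reduces to nonnegative weights |a|; at a zero of a
  -- any phase will do.
  have hph : ∀ u, ∃ p : ℂ, ‖p‖ = 1 ∧ a u = ‖a u‖ * p := by
    intro u
    by_cases h : a u = 0
    · exact ⟨1, by simp, by simp [h]⟩
    · refine ⟨a u / ‖a u‖, ?_, ?_⟩
      · rw [norm_div, Complex.norm_real, norm_norm, div_self (norm_ne_zero_iff.2 h)]
      · rw [mul_div_cancel₀]; exact_mod_cast norm_ne_zero_iff.2 h
  choose p hp1 hp using hph
  have h := spectralGap_mul_le_complex G (fun u => ‖a u‖ ^ 2) (fun u => sq_nonneg _) h0 hgap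
    fun u => conj (p u) * y u
  have hsq : ∀ u, √(‖a u‖ ^ 2) = ‖a u‖ := fun u => Real.sqrt_sq (norm_nonneg _)
  have hca : ∀ u, (‖a u‖ : ℂ) * conj (p u) = conj (a u) := by
    intro u
    conv_rhs => rw [hp u, map_mul, Complex.conj_ofReal]
  simp only [hsq, ← mul_assoc, hca, norm_mul, RCLike.norm_conj, hp1, one_mul] at h
  refine h.trans (le_of_eq ?_)
  congr 1
  refine Finset.sum_congr rfl fun u _ => Finset.sum_congr rfl fun v _ => ?_
  split_ifs
  · have e : ‖(‖a v‖ : ℂ) * conj (p u) * y u - ‖a u‖ * conj (p v) * y v‖ ^ 2 =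
        ‖(‖a v‖ : ℂ) * conj (p u) * y u‖ ^ 2 + ‖(‖a u‖ : ℂ) * conj (p v) * y v‖ ^ 2 -
        2 * (((‖a v‖ : ℂ) * conj (p u) * y u) * conj ((‖a u‖ : ℂ) * conj (p v) * y v)).re := by
      simp only [← Complex.normSq_eq_norm_sq]
      rw [Complex.normSq_sub]
    rw [e]
    congr 1
    · simp only [norm_mul, RCLike.norm_conj, hp1, mul_one, Complex.norm_real, norm_norm, mul_pow]
    · congr 2
      simp only [map_mul, Complex.conj_ofReal, Complex.conj_conj]
      have h1 := hp v
      rw [← hca]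
      linear_combination (‖a u‖ * conj (p u) * y u * conj (y v) : ℂ) * (- h1)
  · rfl

/-- Gap inequality for positive semidefinite matrices close to `a a*` on the edges. -/
theorem trace_sub_le_of_close (a : V → ℂ) (h0 : 0 < ∑ u, ‖a u‖ ^ 2)
    (hgap : 0 < spectralGap G fun u => ‖a u‖ ^ 2) {Y : Matrix V V ℂ} (hY : Y.PosSemidef) {η D : ℝ}
    (hd : ∀ u, ‖Y u u - a u * conj (a u)‖ ≤ η)
    (hadj : ∀ u v, G.Adj u v → ‖Y u v - a u * conj (a v)‖ ≤ η)
    (hD : ∀ u, (∑ v, if G.Adj u v then (1 : ℝ) else 0) ≤ D) (hη : 0 ≤ η) :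
    spectralGap G (fun u => ‖a u‖ ^ 2) *
      (Y.trace.re - (star a ⬝ᵥ Y.mulVec a).re / ∑ u, ‖a u‖ ^ 2) ≤ 2 * η * D * ∑ u, ‖a u‖ ^ 2 := by
  set E := ∑ u, ‖a u‖ ^ 2
  set g := spectralGap G fun u => ‖a u‖ ^ 2
  -- Both sides are linear in Y, so the gap inequality is applied to each rank-one summand of Y and
  -- then summed.
  have hstep : g * (Y.trace.re - (star a ⬝ᵥ Y.mulVec a).re / E) ≤
      1 / 2 * ∑ u, ∑ v, if G.Adj u v then ‖a v‖ ^ 2 * (Y u u).re + ‖a u‖ ^ 2 * (Y v v).re -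
        2 * (conj (a u) * a v * Y u v).re else 0 := by
    obtain ⟨m, B, rfl⟩ := Matrix.posSemidef_iff_eq_sum_vecMulVec.1 hY
    have hent : ∀ u v, (∑ i : Fin m, Matrix.vecMulVec (B i) (star (B i))) u v =
        ∑ i, B i u * conj (B i v) := by
      intro u v
      rw [Matrix.sum_apply]; rfl
    have hdiag : ∀ u, ((∑ i : Fin m, Matrix.vecMulVec (B i) (star (B i))) u u).re =
        ∑ i, ‖B i u‖ ^ 2 := by
      intro u
      rw [hent, Complex.re_sum]
      refine Finset.sum_congr rfl fun i _ => ?_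
      rw [Complex.mul_conj, Complex.ofReal_re, Complex.normSq_eq_norm_sq]
    have htr : (∑ i : Fin m, Matrix.vecMulVec (B i) (star (B i))).trace.re =
        ∑ i, ∑ u, ‖B i u‖ ^ 2 := by
      rw [Matrix.trace, Complex.re_sum, Finset.sum_comm]
      exact Finset.sum_congr rfl fun u _ => hdiag u
    have hq : (star a ⬝ᵥ (∑ i : Fin m, Matrix.vecMulVec (B i) (star (B i))).mulVec a).re =
        ∑ i, ‖∑ u, conj (a u) * B i u‖ ^ 2 := by
      rw [Matrix.sum_mulVec, dotProduct_sum, Complex.re_sum]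
      refine Finset.sum_congr rfl fun i _ => ?_
      rw [Matrix.vecMulVec_mulVec, dotProduct_smul, ← Complex.normSq_eq_norm_sq,
        ← Complex.ofReal_re (Complex.normSq _), ← Complex.mul_conj, map_sum]
      simp only [dotProduct, Pi.star_apply, RCLike.star_def, map_mul, Complex.conj_conj,
        MulOpposite.smul_eq_mul_unop, MulOpposite.unop_op]
      congr 2
      refine Finset.sum_congr rfl fun u _ => ?_
      ring
    rw [htr, hq, Finset.sum_div, ← Finset.sum_sub_distrib, Finset.mul_sum]
    refine (Finset.sum_le_sum fun i _ => spectralGap_mul_le_phase G a h0 hgap (B i)).trans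
      (le_of_eq ?_)
    rw [← Finset.mul_sum, Finset.sum_comm]
    congr 1
    refine Finset.sum_congr rfl fun u _ => ?_
    rw [Finset.sum_comm]
    refine Finset.sum_congr rfl fun v _ => ?_
    split_ifs
    · rw [hdiag, hdiag, hent, Finset.mul_sum, Finset.mul_sum, Finset.mul_sum, Complex.re_sum,
        Finset.mul_sum, ← Finset.sum_add_distrib, ← Finset.sum_sub_distrib]
    · simp
  refine hstep.trans ?_
  -- For Y = aa* the edge term vanishes identically; what remains is the error η(|a_u| + |a_v|)², at
  -- most 2η(|a_u|² + |a_v|²).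
  have hterm : ∀ u v, (if G.Adj u v then ‖a v‖ ^ 2 * (Y u u).re + ‖a u‖ ^ 2 * (Y v v).re -
      2 * (conj (a u) * a v * Y u v).re else 0) ≤
      (if G.Adj u v then (1 : ℝ) else 0) * (2 * η * ‖a u‖ ^ 2) +
        (if G.Adj u v then (1 : ℝ) else 0) * (2 * η * ‖a v‖ ^ 2) := by
    intro u v
    split_ifs with h
    · have hre : ∀ w, (Y w w).re ≤ ‖a w‖ ^ 2 + η := by
        intro w
        have h1 := (Complex.abs_re_le_norm _).trans (hd w)
        rw [Complex.sub_re, Complex.mul_conj, Complex.ofReal_re, Complex.normSq_eq_norm_sq] at h1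
        linarith [(abs_le.1 h1).2]
      have h2 : ‖a u‖ ^ 2 * ‖a v‖ ^ 2 - ‖a u‖ * ‖a v‖ * η ≤ (conj (a u) * a v * Y u v).re := by
        have e : conj (a u) * a v * Y u v = ((‖a u‖ ^ 2 * ‖a v‖ ^ 2 : ℝ) : ℂ) +
            conj (a u) * a v * (Y u v - a u * conj (a v)) := by
          rw [← Complex.normSq_eq_norm_sq, ← Complex.normSq_eq_norm_sq, Complex.ofReal_mul,
            ← Complex.mul_conj, ← Complex.mul_conj]
          ring
        rw [e, Complex.add_re, Complex.ofReal_re]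
        have h3 : ‖conj (a u) * a v * (Y u v - a u * conj (a v))‖ ≤ ‖a u‖ * ‖a v‖ * η := by
          rw [norm_mul, norm_mul, RCLike.norm_conj]
          exact mul_le_mul_of_nonneg_left (hadj u v h) (by positivity)
        linarith [(abs_le.1 ((Complex.abs_re_le_norm _).trans h3)).1]
      nlinarith [hre u, hre v, mul_le_mul_of_nonneg_left (hre u) (sq_nonneg ‖a v‖),
        mul_le_mul_of_nonneg_left (hre v) (sq_nonneg ‖a u‖),
        mul_nonneg hη (sq_nonneg (‖a u‖ - ‖a v‖))]
    · simp
  have hsum : ∑ u, ∑ v, (if G.Adj u v then (1 : ℝ) else 0) * (2 * η * ‖a u‖ ^ 2) ≤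
      D * (2 * η * E) := by
    rw [Finset.mul_sum, Finset.mul_sum]
    refine Finset.sum_le_sum fun u _ => ?_
    rw [← Finset.sum_mul]
    exact mul_le_mul_of_nonneg_right (hD u) (by positivity)
  have hsum2 : ∑ u, ∑ v, (if G.Adj u v then (1 : ℝ) else 0) * (2 * η * ‖a v‖ ^ 2) ≤
      D * (2 * η * E) := by
    rw [Finset.sum_comm]
    refine le_trans (le_of_eq ?_) hsum
    refine Finset.sum_congr rfl fun u _ => Finset.sum_congr rfl fun v _ => ?_
    rw [G.adj_comm]
  calc _ ≤ 1 / 2 * (∑ u, ∑ v, (if G.Adj u v then (1 : ℝ) else 0) * (2 * η * ‖a u‖ ^ 2) +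
        ∑ u, ∑ v, (if G.Adj u v then (1 : ℝ) else 0) * (2 * η * ‖a v‖ ^ 2)) := by
        simp only [← Finset.sum_add_distrib]
        gcongr with u _ v _
        exact hterm u v
    _ ≤ 1 / 2 * (D * (2 * η * E) + D * (2 * η * E)) := by gcongr
    _ = _ := by ring

end Graph

/-! ### Top eigenvectors of nearly rank-one matrices -/

section TopEigenvector

variable {V : Type*} [Fintype V]

theorem star_dotProduct_self_eq (x : V → ℂ) : star x ⬝ᵥ x = ((∑ u, ‖x u‖ ^ 2 : ℝ) : ℂ) := by
  simp only [dotProduct, Pi.star_apply, RCLike.star_def, ← Complex.normSq_eq_norm_sq,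
    mul_comm (conj _), Complex.mul_conj]
  push_cast
  rfl

/-- The quadratic form of a positive semidefinite matrix is bounded by its trace. -/
theorem re_dotProduct_mulVec_le_trace {Z : Matrix V V ℂ} (hZ : Z.PosSemidef) (x : V → ℂ) :
    (star x ⬝ᵥ Z.mulVec x).re ≤ Z.trace.re * ∑ u, ‖x u‖ ^ 2 := by
  classical
  have hH := hZ.1
  have h := star_dotProduct_mulVec_eq hH x
  have ht : Z.trace.re = ∑ i, hH.eigenvalues i := by
    rw [hH.trace_eq_sum_eigenvalues, Complex.re_sum]; rfl
  rw [h, ht, ← sum_norm_sq_eigenvector hH x, Finset.sum_mul]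
  change Complex.re (Complex.ofReal _) ≤ _
  rw [Complex.ofReal_re]
  refine Finset.sum_le_sum fun i _ => mul_le_mul_of_nonneg_left ?_ (hZ.eigenvalues_nonneg i)
  exact Finset.single_le_sum (f := fun i => ‖star (hH.eigenvectorBasis i).ofLp ⬝ᵥ x‖ ^ 2)
    (fun i _ => sq_nonneg _) (Finset.mem_univ i)

/-- Splitting off an eigenvector from a quadratic form. -/
theorem dotProduct_mulVec_split {Y : Matrix V V ℂ} (hY : Y.IsHermitian) {v : V → ℂ} {μ : ℝ}
    (hv : Y.mulVec v = (μ : ℂ) • v) (hv1 : star v ⬝ᵥ v = 1) (x : V → ℂ) :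
    star x ⬝ᵥ Y.mulVec x = ((μ * ‖star v ⬝ᵥ x‖ ^ 2 : ℝ) : ℂ) +
      star (x - (star v ⬝ᵥ x) • v) ⬝ᵥ Y.mulVec (x - (star v ⬝ᵥ x) • v) := by
  set s := star v ⬝ᵥ x with hs
  have hxv : star x ⬝ᵥ v = conj s := by
    rw [hs, ← RCLike.star_def, Matrix.star_dotProduct]
  have hvY : star v ⬝ᵥ Y.mulVec x = μ * s := by
    rw [Matrix.dotProduct_mulVec, ← hY.eq, ← Matrix.star_mulVec, hv, star_smul, smul_dotProduct,
      smul_eq_mul, ← hs]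
    simp
  have hss : ((μ * ‖s‖ ^ 2 : ℝ) : ℂ) = μ * (s * conj s) := by
    rw [Complex.mul_conj, Complex.normSq_eq_norm_sq]; push_cast; rfl
  rw [hss]
  simp only [Matrix.mulVec_sub, Matrix.mulVec_smul, hv, star_sub, star_smul, sub_dotProduct,
    dotProduct_sub, smul_dotProduct, dotProduct_smul, hxv, hvY, hv1, smul_eq_mul, RCLike.star_def]
  ring

/-- Write s = ⟨v, a⟩ with v the top eigenvector. Up to β, the direction of a captures the whole
trace t, so the top eigenvalue μ is at least t - β and the deflated matrix Y - μvv* has trace at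
most β. Comparing the quadratic forms at a gives (t - β)(E - |s|²) ≤ βE. Aligning the phase of s,
the squared distance is t + E - 2√t|s| = (√t - √E)² + 2√t(√E - |s|). -/
theorem exists_phase_close {Λ : Finset (ℤ × ℤ)} {Y : Matrix Λ Λ ℂ} (hY : Y.PosSemidef)
    {v : Λ → ℂ} (hv : IsTopEigenvector Y v) {a : Λ → ℂ} (hE : 0 < ∑ u, ‖a u‖ ^ 2) {β : ℝ}
    (hβ : Y.trace.re - (star a ⬝ᵥ Y.mulVec a).re / ∑ u, ‖a u‖ ^ 2 ≤ β) (hβt : β < Y.trace.re) :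
    ∃ c : ℂ, ‖c‖ = 1 ∧ ∑ u, ‖((√Y.trace.re : ℝ) : ℂ) * v u - c * a u‖ ^ 2 ≤
      (√Y.trace.re - √(∑ u, ‖a u‖ ^ 2)) ^ 2 +
        2 * √Y.trace.re * √(∑ u, ‖a u‖ ^ 2) * (β / (Y.trace.re - β)) := by
  classical
  obtain ⟨hv1, μ, hμ, hmax⟩ := hv
  set t := Y.trace.re
  set E := ∑ u, ‖a u‖ ^ 2
  have hH := hY.1
  have hvv : star v ⬝ᵥ v = 1 := by rw [star_dotProduct_self_eq, hv1, Complex.ofReal_one]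
  set s := star v ⬝ᵥ a with hs
  have hquad : (star a ⬝ᵥ Y.mulVec a).re ≤ μ * E := by
    have hEe : E = _ := (sum_norm_sq_eigenvector hH a).symm
    rw [star_dotProduct_mulVec_eq hH, hEe, Finset.mul_sum]
    change Complex.re (Complex.ofReal _) ≤ _
    rw [Complex.ofReal_re]
    refine Finset.sum_le_sum fun i _ => mul_le_mul_of_nonneg_right ?_ (sq_nonneg _)
    refine hmax _ (hH.eigenvectorBasis i).ofLp (fun h => ?_) ?_
    · have h1 := hH.eigenvectorBasis.orthonormal.1 i
      have h2 : hH.eigenvectorBasis i = 0 := by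
        rw [← WithLp.toLp_ofLp 2 (hH.eigenvectorBasis i), h]; rfl
      rw [h2, norm_zero] at h1
      exact zero_ne_one h1
    · have := hH.mulVec_eigenvectorBasis i
      rw [this]
      ext u
      simp
  -- The deflated matrix remains positive semidefinite, so its form at the component of a orthogonal
  -- to v is bounded by its trace t - μ.
  set Z : Matrix Λ Λ ℂ := Y - (μ : ℂ) • Matrix.vecMulVec v (star v) with hZ
  have hZq : ∀ x, star x ⬝ᵥ Z.mulVec x =
      star x ⬝ᵥ Y.mulVec x - ((μ * ‖star v ⬝ᵥ x‖ ^ 2 : ℝ) : ℂ) := by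
    intro x
    rw [hZ, Matrix.sub_mulVec, dotProduct_sub, Matrix.smul_mulVec, Matrix.vecMulVec_mulVec,
      dotProduct_smul, dotProduct_smul]
    congr 1
    have : star x ⬝ᵥ v = conj (star v ⬝ᵥ x) := by
      rw [← RCLike.star_def, Matrix.star_dotProduct]
    rw [this, MulOpposite.smul_eq_mul_unop, MulOpposite.unop_op, mul_comm (conj _), Complex.mul_conj,
      Complex.normSq_eq_norm_sq, smul_eq_mul]
    push_cast; rfl
  have hZp : Z.PosSemidef := by
    refine Matrix.PosSemidef.of_dotProduct_mulVec_nonneg ?_ fun x => ?_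
    · refine hH.sub ?_
      rw [Matrix.IsHermitian, Matrix.conjTranspose_smul, Matrix.conjTranspose_vecMulVec]
      simp
    · rw [hZq, dotProduct_mulVec_split hH hμ hvv x, add_sub_cancel_left]
      exact hY.dotProduct_mulVec_nonneg _
  have hZt : Z.trace.re = t - μ := by
    rw [hZ, Matrix.trace_sub, Matrix.trace_smul, Matrix.trace_vecMulVec, dotProduct_comm, hvv]
    simp [t]
  have hZt0 : 0 ≤ t - μ := by
    rw [← hZt]
    exact (Complex.le_def.1 hZp.trace_nonneg).1
  set b := a - s • v with hb
  have hvb : star v ⬝ᵥ b = 0 := by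
    rw [hb, dotProduct_sub, dotProduct_smul, hvv, ← hs]; simp
  have hbE : ∑ u, ‖b u‖ ^ 2 = E - ‖s‖ ^ 2 := by
    have h1 : star b ⬝ᵥ b = ((E - ‖s‖ ^ 2 : ℝ) : ℂ) := by
      have h2 : star a ⬝ᵥ a = (E : ℂ) := star_dotProduct_self_eq a
      have h3 : star a ⬝ᵥ v = conj s := by rw [hs, ← RCLike.star_def, Matrix.star_dotProduct]
      have h4 : star b ⬝ᵥ b = star a ⬝ᵥ b := by
        conv_lhs => rw [hb]
        rw [star_sub, sub_dotProduct, ← hb, star_smul, smul_dotProduct, hvb, smul_zero, sub_zero]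
      rw [h4, hb, dotProduct_sub, dotProduct_smul, h2, h3, smul_eq_mul, Complex.mul_conj,
        Complex.normSq_eq_norm_sq]
      push_cast; rfl
    rw [star_dotProduct_self_eq] at h1
    exact_mod_cast h1
  have hbE0 : 0 ≤ E - ‖s‖ ^ 2 := by rw [← hbE]; positivity
  have hqa : (star a ⬝ᵥ Y.mulVec a).re ≤ μ * ‖s‖ ^ 2 + (t - μ) * (E - ‖s‖ ^ 2) := by
    rw [dotProduct_mulVec_split hH hμ hvv a, Complex.add_re, Complex.ofReal_re, ← hs, ← hb]
    have h1 := re_dotProduct_mulVec_le_trace hZp b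
    rw [hZq, hvb, norm_zero, hZt, hbE] at h1
    simp only [ne_eq, OfNat.ofNat_ne_zero, not_false_eq_true, zero_pow, mul_zero, Complex.ofReal_zero,
      sub_zero] at h1
    linarith
  have hq : (t - β) * E ≤ (star a ⬝ᵥ Y.mulVec a).re := by
    have : t - β ≤ (star a ⬝ᵥ Y.mulVec a).re / E := by linarith
    rwa [le_div_iff₀ hE] at this
  have hμβ : t - β ≤ μ := by
    have := hq.trans hquad
    exact le_of_mul_le_mul_right this hE
  have hov : (t - β) * (E - ‖s‖ ^ 2) ≤ β * E := by
    have h1 : μ * ‖s‖ ^ 2 ≤ t * ‖s‖ ^ 2 := by gcongr; linarith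
    have h2 : (t - μ) * (E - ‖s‖ ^ 2) ≤ β * (E - ‖s‖ ^ 2) := by gcongr; linarith
    nlinarith
  have htβ : 0 < t - β := by linarith
  have hβ0 : 0 ≤ β := by linarith
  have ht0 : 0 ≤ t := by linarith
  obtain ⟨p, hp1, hp⟩ : ∃ p : ℂ, ‖p‖ = 1 ∧ p * s = ‖s‖ := by
    by_cases h : s = 0
    · exact ⟨1, by simp, by simp [h]⟩
    · have hs0 : (‖s‖ : ℂ) ≠ 0 := by exact_mod_cast norm_ne_zero_iff.2 h
      refine ⟨conj s / ‖s‖, ?_, ?_⟩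
      · rw [norm_div, Complex.norm_real, norm_norm, RCLike.norm_conj, div_self (norm_ne_zero_iff.2 h)]
      · rw [div_mul_eq_mul_div, div_eq_iff hs0, mul_comm, Complex.mul_conj, Complex.normSq_eq_norm_sq]
        push_cast; ring
  refine ⟨p, hp1, ?_⟩
  have hsum : ∑ u, ‖((√t : ℝ) : ℂ) * v u - p * a u‖ ^ 2 = t + E - 2 * √t * ‖s‖ := by
    have hterm : ∀ u, ‖((√t : ℝ) : ℂ) * v u - p * a u‖ ^ 2 = t * ‖v u‖ ^ 2 + ‖a u‖ ^ 2 -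
        2 * √t * (p * (star v u * a u)).re := by
      intro u
      rw [← norm_sub_rev]
      simp only [← Complex.normSq_eq_norm_sq]
      rw [Complex.normSq_sub, Complex.normSq_mul, Complex.normSq_mul, Complex.normSq_ofReal,
        Real.mul_self_sqrt ht0, Complex.normSq_eq_norm_sq p, hp1]
      have : (p * a u * conj (((√t : ℝ) : ℂ) * v u)).re = √t * (p * (star v u * a u)).re := by
        rw [← Complex.re_ofReal_mul, map_mul, Complex.conj_ofReal, Pi.star_apply, RCLike.star_def]
        congr 1; ring
      rw [this]; ring
    rw [Finset.sum_congr rfl fun u _ => hterm u, Finset.sum_sub_distrib, Finset.sum_add_distrib,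
      ← Finset.mul_sum, hv1, mul_one, ← Finset.mul_sum, ← Complex.re_sum, ← Finset.mul_sum]
    have : ∑ u, star v u * a u = s := rfl
    rw [this, hp, Complex.ofReal_re]
  rw [hsum]
  have hsE : ‖s‖ ≤ √E := Real.le_sqrt_of_sq_le (by linarith)
  have hEs := Real.sq_sqrt hE.le
  have hts := Real.sq_sqrt ht0
  have hEp : 0 < √E := Real.sqrt_pos.2 hE
  have h1 : √E - ‖s‖ ≤ √E * (β / (t - β)) := by
    have h2 : E - ‖s‖ ^ 2 ≤ E * (β / (t - β)) := by
      rw [mul_div_assoc', le_div_iff₀ htβ]; linarith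
    have h3 : √E * (√E - ‖s‖) ≤ √E * (√E * (β / (t - β))) := by
      have h4 : ‖s‖ ^ 2 ≤ √E * ‖s‖ := by
        rw [sq]; exact mul_le_mul_of_nonneg_right hsE (norm_nonneg s)
      have h5 : √E * (√E * (β / (t - β))) = E * (β / (t - β)) := by
        rw [← mul_assoc, ← sq, hEs]
      rw [h5, mul_sub, ← sq, hEs]
      linarith
    exact le_of_mul_le_mul_left h3 hEp
  nlinarith [mul_le_mul_of_nonneg_left h1 (Real.sqrt_nonneg t)]

end TopEigenvector

/-- Degrees in the signal graph. -/
theorem degree_signalGraph_le (Λ : Finset (ℤ × ℤ)) {r : ℝ} (hr : 0 < r) (u : Λ) :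
    open Classical in
    (∑ v, if (signalGraph Λ r).Adj u v then (1 : ℝ) else 0) ≤ 16 * r ^ 2 := by
  classical
  set N : ℕ := ⌊√2 * r⌋₊
  -- Differences of neighbours lie in a punctured box of half-side N = ⌊√2·r⌋, with 4N² + 4N ≤ 8N² ≤
  -- 16r² points.
  set B : Finset (ℤ × ℤ) := (Finset.Icc (-(N : ℤ)) N ×ˢ Finset.Icc (-(N : ℤ)) N).erase 0
  have hN : (N : ℝ) ≤ √2 * r := Nat.floor_le (by positivity)
  have hBc : (B.card : ℝ) ≤ 16 * r ^ 2 := by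
    have h1 : B.card = (2 * N + 1) * (2 * N + 1) - 1 := by
      rw [Finset.card_erase_of_mem (by simp), Finset.card_product, Int.card_Icc]
      congr 2 <;> omega
    have h2 : B.card ≤ 8 * N ^ 2 := by
      rw [h1]
      have := Nat.le_self_pow (two_ne_zero) N
      rw [Nat.sub_le_iff_le_add]
      nlinarith
    have h3 : (B.card : ℝ) ≤ 8 * (N : ℝ) ^ 2 := by exact_mod_cast h2
    have h4 : (N : ℝ) ^ 2 ≤ (√2 * r) ^ 2 := by gcongr
    rw [mul_pow, Real.sq_sqrt two_pos.le] at h4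
    linarith
  refine le_trans ?_ hBc
  rw [Finset.sum_boole]
  norm_cast
  refine Finset.card_le_card_of_injOn (fun v => (v : ℤ × ℤ) - u) (fun v hv => ?_) ?_
  · have hv : (signalGraph Λ r).Adj u v := by simpa using hv
    obtain ⟨h1, h2⟩ := hv
    have hsq : dist₂ (latticePt mesh u) (latticePt mesh v) ^ 2 =
        (((v.1.1 - u.1.1 : ℤ) : ℝ) ^ 2 + ((v.1.2 - u.1.2 : ℤ) : ℝ) ^ 2) / 2 := by
      rw [dist₂, Real.sq_sqrt (by positivity)]
      simp only [latticePt]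
      push_cast
      linear_combination ((u.1.1 - v.1.1 : ℝ) ^ 2 + (u.1.2 - v.1.2 : ℝ) ^ 2) * mesh_sq
    have hlt : ((v.1.1 - u.1.1 : ℤ) : ℝ) ^ 2 + ((v.1.2 - u.1.2 : ℤ) : ℝ) ^ 2 < (√2 * r) ^ 2 := by
      rw [mul_pow, Real.sq_sqrt two_pos.le]; nlinarith
    have hbd : ∀ m : ℤ, (m : ℝ) ^ 2 < (√2 * r) ^ 2 → m ∈ Finset.Icc (-(N : ℤ)) N := by
      intro m hm
      have h3 : |(m : ℝ)| < √2 * r := by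
        rw [← sq_abs] at hm
        exact lt_of_pow_lt_pow_left₀ 2 (by positivity) hm
      have h4 : m.natAbs ≤ N := Nat.le_floor (by rw [Nat.cast_natAbs]; push_cast; exact h3.le)
      rw [Finset.mem_Icc]; omega
    simp only [B, Finset.coe_erase, Set.mem_sdiff, Finset.mem_coe, Finset.mem_product,
      Set.mem_singleton_iff]
    refine ⟨⟨hbd _ (by simp only [Prod.fst_sub]; nlinarith [sq_nonneg ((v.1.2 - u.1.2 : ℤ) : ℝ)]),
      hbd _ (by simp only [Prod.snd_sub]; nlinarith [sq_nonneg ((v.1.1 - u.1.1 : ℤ) : ℝ)])⟩, ?_⟩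
    intro h
    rw [sub_eq_zero] at h
    rw [h] at h1
    simp [dist₂] at h1
  · intro v _ w _ h
    exact Subtype.ext (sub_left_injective h)

/-- Here 64ηr²E/g comes from the gap inequality with error 2η and degree 16r². The calibration makes
it at most (64·0.2331/192)E < 0.0778E, and n ≥ 9 gives |t - E| < 0.0519E. So t is comparable with E,
and (√t - √E)² ≤ (t - E)²/E ≤ η. -/
theorem phase_error_numeric {t E n η r g : ℝ} (hE : 0 < E) (hη : 0 < η) (hr : 0 < r) (hg : 0 < g)
    (hn : 9 ≤ n) (htE : |t - E| ≤ n * (2 * η)) (hηn : η * n ^ 2 ≤ 0.2331 * E)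
    (hηg : η * (192 * r ^ 2) ≤ 0.2331 * g) :
    64 * η * r ^ 2 * E / g < t ∧ (√t - √E) ^ 2 + 2 * √t * √E *
      (64 * η * r ^ 2 * E / g / (t - 64 * η * r ^ 2 * E / g)) ≤
      η * (1 + 20 * r * √(E / g)) ^ 2 := by
  set β := 64 * η * r ^ 2 * E / g with hβ
  have hβ0 : 0 ≤ β := by rw [hβ]; positivity
  have hβE : β ≤ 0.0778 * E := by
    rw [hβ, div_le_iff₀ hg]
    nlinarith
  have hηn1 : n * (2 * η) ≤ 0.0519 * E := by nlinarith
  have htl := (abs_le.1 htE).1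
  have htu := (abs_le.1 htE).2
  refine ⟨by linarith, ?_⟩
  have hts := Real.sq_sqrt (show 0 ≤ t by linarith)
  have hEs := Real.sq_sqrt hE.le
  have hEp := Real.sqrt_pos.2 hE
  have ht0 := Real.sqrt_nonneg t
  have h1 : (√t - √E) ^ 2 ≤ η := by
    have h2 : (t - E) ^ 2 ≤ (n * (2 * η)) ^ 2 := sq_le_sq' (by linarith) htu
    have h3 : (√t - √E) ^ 2 * E ≤ (t - E) ^ 2 := by
      have h4 : t - E = (√t - √E) * (√t + √E) := by linear_combination hEs - hts
      rw [h4, mul_pow]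
      refine mul_le_mul_of_nonneg_left ?_ (sq_nonneg _)
      nlinarith
    have h5 : (n * (2 * η)) ^ 2 ≤ η * E := by nlinarith
    exact le_of_mul_le_mul_right (h3.trans (h2.trans h5)) hE
  have h2 : 2 * √t * √E * (β / (t - β)) ≤ 160 * η * r ^ 2 * (E / g) := by
    have h3 : √t ≤ 1.03 * √E := by
      rw [Real.sqrt_le_left (by positivity), mul_pow, hEs]; nlinarith
    have h4 : β / (t - β) ≤ β / (0.87 * E) := by gcongr; linarith
    have h5 : 0 ≤ β / (t - β) := div_nonneg hβ0 (by linarith)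
    calc _ ≤ 2 * (1.03 * √E) * √E * (β / (0.87 * E)) := by gcongr
      _ = 2 * 1.03 * (√E ^ 2) * (β / (0.87 * E)) := by ring
      _ = 2.06 / 0.87 * β := by
        rw [hEs]; field_simp; norm_num; ring
      _ ≤ 2.5 * β := by gcongr; norm_num
      _ = _ := by rw [hβ]; ring
  have hEg : 0 ≤ E / g := by positivity
  have hx := Real.sq_sqrt hEg
  have hx0 := Real.sqrt_nonneg (E / g)
  refine (add_le_add h1 h2).trans ?_
  have e : η * (1 + 20 * r * √(E / g)) ^ 2 =
      η + 40 * η * (r * √(E / g)) + 400 * η * r ^ 2 * (√(E / g) ^ 2) := by ring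
  rw [e, hx]
  have h7 : 0 ≤ 40 * η * (r * √(E / g)) := by positivity
  have h8 : 160 * η * r ^ 2 * (E / g) ≤ 400 * η * r ^ 2 * (E / g) := by gcongr; norm_num
  linarith

/-- Stability of the reconstruction of the lattice samples from the top eigenvector. -/
theorem exists_phase_samples_close {f : ℝ → ℂ} {Λ : Finset (ℤ × ℤ)} {r η : ℝ} (hr : 0 < r)
    (hη : 0 < η) (hcard : 9 ≤ Λ.card) (hE : 0 < gaborEnergy f Λ) (hgap : 0 < signalGap f Λ r)
    (hη1 : η ≤ 0.2331 * (gaborEnergy f Λ / (Λ.card : ℝ) ^ 2))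
    (hη2 : η ≤ 0.2331 * (signalGap f Λ r / (192 * r ^ 2)))
    {Y : Matrix Λ Λ ℂ} (hY : Y.PosSemidef)
    (hclose : ∀ u v : Λ, dist₂ (latticePt mesh u) (latticePt mesh v) ≤ r →
      ‖Y v u - gabor f (latticePt mesh v) * conj (gabor f (latticePt mesh u))‖ ≤ 2 * η)
    {v : Λ → ℂ} (hv : IsTopEigenvector Y v) :
    ∃ c : ℂ, ‖c‖ = 1 ∧
      √(∑ u : Λ, ‖((√Y.trace.re : ℝ) : ℂ) * v u - c * gabor f (latticePt mesh u)‖ ^ 2) ≤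
        √η * (1 + 20 * r * √(gaborEnergy f Λ / signalGap f Λ r)) := by
  classical
  set a : Λ → ℂ := fun u => gabor f (latticePt mesh u) with ha
  set E := gaborEnergy f Λ with hEdef
  have hEs : ∑ u, ‖a u‖ ^ 2 = E := by
    rw [hEdef, gaborEnergy, ← Finset.sum_coe_sort Λ]
  set g := signalGap f Λ r with hg
  have hgs : spectralGap (signalGraph Λ r) (fun u => ‖a u‖ ^ 2) = g := rfl
  set n : ℝ := (Λ.card : ℝ) with hn
  have hn9 : 9 ≤ n := by rw [hn]; exact_mod_cast hcard
  have hself : ∀ u : Λ, dist₂ (latticePt mesh u) (latticePt mesh u) ≤ r := fun u => by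
    simp [dist₂, hr.le]
  have htr := trace_sub_le_of_close (signalGraph Λ r) a (by rw [hEs]; exact hE)
    (by rw [hgs]; exact hgap) hY (η := 2 * η) (D := 16 * r ^ 2) (fun u => hclose u u (hself u))
    (fun u v h => hclose v u h.symm.2.le) (degree_signalGraph_le Λ hr) (by positivity)
  rw [hgs, hEs] at htr
  set t := Y.trace.re with ht
  set β := 64 * η * r ^ 2 * E / g with hβ
  have hβ1 : t - (star a ⬝ᵥ Y.mulVec a).re / E ≤ β := by
    rw [hβ, le_div_iff₀ hgap]; linarith
  have htE : |t - E| ≤ n * (2 * η) := by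
    have h1 : t - E = ∑ u : Λ, (Y u u - a u * conj (a u)).re := by
      rw [← hEs, ht, Matrix.trace, Complex.re_sum, ← Finset.sum_sub_distrib]
      refine Finset.sum_congr rfl fun u _ => ?_
      rw [Complex.sub_re, Complex.mul_conj, Complex.ofReal_re, Complex.normSq_eq_norm_sq]
      rfl
    rw [h1]
    refine (Finset.abs_sum_le_sum_abs _ _).trans ((Finset.sum_le_sum fun u _ =>
      (Complex.abs_re_le_norm _).trans (hclose u u (hself u))).trans (le_of_eq ?_))
    rw [Finset.sum_const, nsmul_eq_mul, Finset.card_univ, Fintype.card_coe]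
  have hηn : η * n ^ 2 ≤ 0.2331 * E := by
    rw [← le_div_iff₀ (by positivity), mul_div_assoc]; exact hη1
  have hηg : η * (192 * r ^ 2) ≤ 0.2331 * g := by
    rw [← le_div_iff₀ (by positivity), mul_div_assoc]; exact hη2
  obtain ⟨h1, h2⟩ := phase_error_numeric hE hη hr hgap hn9 htE hηn hηg
  obtain ⟨c, hc1, hc⟩ := exists_phase_close hY hv (a := a) (by rw [hEs]; exact hE) (β := β)
    (by rw [hEs]; exact hβ1) h1
  refine ⟨c, hc1, ?_⟩
  rw [hEs] at hc
  rw [Real.sqrt_le_left (by positivity), mul_pow, Real.sq_sqrt hη.le]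
  exact hc.trans h2

/-! ### A mean value inequality for the Gabor transform -/

/-- The mean value property is applied to the holomorphic square H², so no subharmonicity is needed.
The reflection of θ matches the coordinate u - iv. -/
theorem enorm_sq_le_circle {H : ℂ → ℂ} (hH : Differentiable ℂ H) (ρ : ℝ) :
    ENNReal.ofReal (2 * Real.pi) * ‖H 0‖ₑ ^ 2 ≤
      ∫⁻ θ in Set.Ioo (-Real.pi) Real.pi,
        ‖H (ρ * Real.cos θ - ρ * Real.sin θ * Complex.I)‖ₑ ^ 2 := by
  have hpi := Real.pi_pos
  have h1 := (DiffContOnCl.circleAverage (f := fun z => H z ^ 2) (c := 0) (R := ρ)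
    (hH.pow 2).diffContOnCl)
  rw [Real.circleAverage_def] at h1
  have hper : Function.Periodic (fun θ : ℝ => H (circleMap 0 ρ θ) ^ 2) (2 * Real.pi) := fun θ => by
    simp only [periodic_circleMap 0 ρ θ]
  have h2 : ∫ θ in (0 : ℝ)..2 * Real.pi, H (circleMap 0 ρ θ) ^ 2 =
      ∫ θ in (-Real.pi)..Real.pi, H (circleMap 0 ρ θ) ^ 2 := by
    have := hper.intervalIntegral_add_eq 0 (-Real.pi)
    rwa [zero_add, show -Real.pi + 2 * Real.pi = Real.pi by ring] at this
  have h3 : ∫ θ in (-Real.pi)..Real.pi, H (circleMap 0 ρ θ) ^ 2 =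
      ∫ θ in (-Real.pi)..Real.pi, H (ρ * Real.cos θ - ρ * Real.sin θ * Complex.I) ^ 2 := by
    have := intervalIntegral.integral_comp_neg (a := -Real.pi) (b := Real.pi)
      (fun θ : ℝ => H (circleMap 0 ρ θ) ^ 2)
    rw [neg_neg] at this
    rw [← this]
    congr 1 with θ
    congr 2
    rw [circleMap_zero, Complex.ofReal_neg, Complex.exp_mul_I, Complex.cos_neg, Complex.sin_neg]
    push_cast; ring
  rw [h2, h3, inv_smul_eq_iff₀ (by positivity)] at h1
  have h4 := enorm_integral_le_lintegral_enorm (μ := volume.restrict (Set.Ioc (-Real.pi) Real.pi))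
    (fun θ : ℝ => H (ρ * Real.cos θ - ρ * Real.sin θ * Complex.I) ^ 2)
  rw [← intervalIntegral.integral_of_le (by linarith), h1, enorm_smul, enorm_pow,
    Real.enorm_of_nonneg (by positivity)] at h4
  simp only [enorm_pow] at h4
  rw [restrict_Ioo_eq_restrict_Ioc]
  exact h4

/-- The Gabor transform near `p` is, up to a Gaussian factor, an entire function. -/
theorem exists_entire_gabor {f : ℝ → ℂ} (hf : MemLp f 2 volume) (p : ℝ × ℝ) :
    ∃ H : ℂ → ℂ, Differentiable ℂ H ∧ ∀ u v : ℝ, ‖H (u - v * Complex.I)‖ =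
      ‖gabor f (p.1 + u, p.2 + v)‖ * Real.exp (Real.pi / 2 * (u ^ 2 + v ^ 2)) := by
  refine ⟨fun z => Complex.exp (-Real.pi * p.1 ^ 2 - 2 * Real.pi * p.1 * z - Real.pi / 2 * z ^ 2) *
    bargmann f (p.1 - p.2 * Complex.I + z), ?_, fun u v => ?_⟩
  · exact Differentiable.mul (by fun_prop) ((differentiable_bargmann hf).comp (by fun_prop))
  · rw [gabor_eq_phaseFun, phaseFun, norm_mul, norm_mul, Complex.norm_exp, Complex.norm_exp,
      mul_right_comm (Real.exp _) ‖_‖, ← Real.exp_add]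
    congr 2
    · have e1 : (-(Real.pi : ℂ) * p.1 ^ 2 - 2 * Real.pi * p.1 * (u - v * Complex.I) -
          Real.pi / 2 * (u - v * Complex.I) ^ 2) =
          ((-Real.pi * (p.1 + u) ^ 2 + Real.pi / 2 * (u ^ 2 + v ^ 2) : ℝ) : ℂ) +
          ((2 * Real.pi * p.1 * v + Real.pi * u * v : ℝ) : ℂ) * Complex.I := by
        push_cast
        linear_combination (-Real.pi / 2 * v ^ 2 : ℂ) * Complex.I_sq
      have e2 : (-(Real.pi : ℂ) * ((p.1 + u : ℝ) : ℂ) ^ 2) = ((-Real.pi * (p.1 + u) ^ 2 : ℝ) : ℂ) := by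
        push_cast; ring
      rw [e1, e2, Complex.add_re, Complex.ofReal_re, Complex.re_ofReal_mul, Complex.I_re,
        Complex.ofReal_re]
      ring
    · push_cast; ring_nf

/-- Circle means of the local entire function are integrated over radii below 𝔞/2, that is, over a
disc inside the cell. There the Gaussian factor e^{πρ²} is at most e^{π/8}, the radial integral is
1/16, and 3.8·e^{-π/8}·2π/16 ≥ 1. -/
theorem enorm_gabor_sq_le {f : ℝ → ℂ} (hf : MemLp f 2 volume) (p : ℝ × ℝ) :
    ‖gabor f p‖ₑ ^ 2 ≤ ENNReal.ofReal 3.8 *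
      ∫⁻ q in Set.Ioo (p.1 - mesh / 2) (p.1 + mesh / 2) ×ˢ
        Set.Ioo (p.2 - mesh / 2) (p.2 + mesh / 2), ‖gabor f q‖ₑ ^ 2 := by
  obtain ⟨H, hH, hHn⟩ := exists_entire_gabor hf p
  have hpi := Real.pi_pos
  have hm := mesh_pos
  have hms := mesh_sq
  have hc := continuous_gabor hf
  set Q := Set.Ioo (p.1 - mesh / 2) (p.1 + mesh / 2) ×ˢ
        Set.Ioo (p.2 - mesh / 2) (p.2 + mesh / 2) with hQ
  set g : ℝ × ℝ → ℝ≥0∞ := Q.indicator fun q => ‖gabor f q‖ₑ ^ 2 with hg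
  have hQm : MeasurableSet Q := measurableSet_Ioo.prod measurableSet_Ioo
  have hgm : Measurable g := (by fun_prop : Measurable fun q => ‖gabor f q‖ₑ ^ 2).indicator hQm
  have hH0 : ‖H 0‖ = ‖gabor f p‖ := by
    have := hHn 0 0
    simpa using this
  have h1 : ∫⁻ q in Q, ‖gabor f q‖ₑ ^ 2 = ∫⁻ q, g (p + q) := by
    rw [lintegral_add_left_eq_self, lintegral_indicator hQm]
  rw [h1, ← lintegral_comp_polarCoord_symm]
  have hgm2 : Measurable fun x : ℝ × ℝ =>
      ENNReal.ofReal x.1 • g (p + (x.1 * Real.cos x.2, x.1 * Real.sin x.2)) := by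
    simp only [smul_eq_mul]
    exact (by fun_prop : Measurable fun x : ℝ × ℝ => ENNReal.ofReal x.1).mul
      (hgm.comp (by fun_prop))
  have h2 : ∫⁻ x in polarCoord.target, ENNReal.ofReal x.1 • g (p + polarCoord.symm x) =
      ∫⁻ ρ in Set.Ioi 0, ∫⁻ θ in Set.Ioo (-Real.pi) Real.pi,
        ENNReal.ofReal ρ • g (p + (ρ * Real.cos θ, ρ * Real.sin θ)) := by
    rw [polarCoord_target, Measure.volume_eq_prod, ← Measure.prod_restrict,
      ← lintegral_prod _ hgm2.aemeasurable]
    rfl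
  rw [h2]
  have hexp : Real.exp (-(Real.pi / 8)) * (Real.pi / 8) * 3.8 ≥ 1 := by
    have h3 : Real.exp (Real.pi / 8) ≤ 1.4815 := by
      have hp := Real.pi_lt_d6
      refine (Real.exp_le_exp.2 (by linarith : Real.pi / 8 ≤ 0.3928)).trans ?_
      have := Real.exp_bound' (x := 0.3928) (by norm_num) (by norm_num) (n := 5) (by norm_num)
      refine this.trans ?_
      norm_num [Finset.sum_range_succ, Nat.factorial]
    rw [Real.exp_neg, inv_eq_one_div, mul_assoc, one_div_mul_eq_div, ge_iff_le,
      le_div_iff₀ (Real.exp_pos _)]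
    nlinarith [Real.pi_gt_d4]
  have hring : ∀ ρ ∈ Set.Ioo (0 : ℝ) (mesh / 2),
      ENNReal.ofReal ρ * (ENNReal.ofReal (Real.exp (-(Real.pi / 8)) * (2 * Real.pi)) *
        ‖gabor f p‖ₑ ^ 2) ≤
      ∫⁻ θ in Set.Ioo (-Real.pi) Real.pi,
        ENNReal.ofReal ρ • g (p + (ρ * Real.cos θ, ρ * Real.sin θ)) := by
    intro ρ hρ
    simp only [smul_eq_mul]
    rw [lintegral_const_mul' _ _ ENNReal.ofReal_ne_top]
    refine mul_le_mul_right ?_ _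
    have h3 := enorm_sq_le_circle hH ρ
    rw [← ofReal_norm (H 0), hH0, ofReal_norm] at h3
    rw [ENNReal.ofReal_mul (Real.exp_pos _).le, mul_assoc]
    refine (mul_le_mul_right h3 _).trans ?_
    rw [← lintegral_const_mul' _ _ ENNReal.ofReal_ne_top]
    refine lintegral_mono fun θ => ?_
    have hcs := Real.cos_sq_add_sin_sq θ
    have hmem : p + (ρ * Real.cos θ, ρ * Real.sin θ) ∈ Q := by
      have hρ1 : |ρ * Real.cos θ| < mesh / 2 := by
        rw [abs_mul, abs_of_pos hρ.1]
        nlinarith [Real.abs_cos_le_one θ, hρ.1, hρ.2]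
      have hρ2 : |ρ * Real.sin θ| < mesh / 2 := by
        rw [abs_mul, abs_of_pos hρ.1]
        nlinarith [Real.abs_sin_le_one θ, hρ.1, hρ.2]
      rw [abs_lt] at hρ1 hρ2
      simp only [hQ, Set.mem_prod, Set.mem_Ioo, Prod.fst_add, Prod.snd_add]
      exact ⟨⟨by linarith [hρ1.1], by linarith [hρ1.2]⟩, by linarith [hρ2.1], by linarith [hρ2.2]⟩
    rw [hg, Set.indicator_of_mem hmem]
    have h4 := hHn (ρ * Real.cos θ) (ρ * Real.sin θ)
    have hle : Real.exp (-(Real.pi / 8)) * ‖H (ρ * Real.cos θ - ρ * Real.sin θ * Complex.I)‖ ^ 2 ≤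
        ‖gabor f (p.1 + ρ * Real.cos θ, p.2 + ρ * Real.sin θ)‖ ^ 2 := by
      rw [Complex.ofReal_mul, Complex.ofReal_mul] at h4
      rw [h4, mul_pow, ← Real.exp_nat_mul]
      have h5 : Real.exp (-(Real.pi / 8)) * Real.exp ((2 : ℕ) * (Real.pi / 2 *
          ((ρ * Real.cos θ) ^ 2 + (ρ * Real.sin θ) ^ 2))) ≤ 1 := by
        rw [← Real.exp_add, Real.exp_le_one_iff]
        have : (ρ * Real.cos θ) ^ 2 + (ρ * Real.sin θ) ^ 2 = ρ ^ 2 := by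
          linear_combination ρ ^ 2 * hcs
        rw [this]
        have : ρ ^ 2 ≤ 1 / 8 := by nlinarith [hρ.1, hρ.2]
        push_cast
        nlinarith
      nlinarith [sq_nonneg ‖gabor f (p.1 + ρ * Real.cos θ, p.2 + ρ * Real.sin θ)‖]
    have h6 := ENNReal.ofReal_le_ofReal hle
    rw [ENNReal.ofReal_mul (Real.exp_pos _).le, ENNReal.ofReal_pow (norm_nonneg _),
      ENNReal.ofReal_pow (norm_nonneg _), ofReal_norm, ofReal_norm] at h6
    exact h6
  have hr : ∫⁻ ρ in Set.Ioo (0 : ℝ) (mesh / 2), ENNReal.ofReal ρ = ENNReal.ofReal (1 / 16) := by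
    rw [restrict_Ioo_eq_restrict_Ioc, ← ofReal_integral_eq_lintegral_ofReal,
      ← intervalIntegral.integral_of_le (by positivity), integral_id]
    · congr 1; linarith
    · exact (continuous_id.integrableOn_Icc (a := (0 : ℝ)) (b := mesh / 2)).mono_set
        Set.Ioc_subset_Icc_self
    · exact (ae_restrict_mem measurableSet_Ioc).mono fun x hx => hx.1.le
  calc ‖gabor f p‖ₑ ^ 2 = 1 * ‖gabor f p‖ₑ ^ 2 := (one_mul _).symm
    _ ≤ ENNReal.ofReal (Real.exp (-(Real.pi / 8)) * (Real.pi / 8) * 3.8) * ‖gabor f p‖ₑ ^ 2 := by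
      gcongr
      rw [ENNReal.one_le_ofReal]
      exact hexp
    _ = ENNReal.ofReal 3.8 * (ENNReal.ofReal (1 / 16) *
        (ENNReal.ofReal (Real.exp (-(Real.pi / 8)) * (2 * Real.pi)) * ‖gabor f p‖ₑ ^ 2)) := by
      rw [← mul_assoc, ← mul_assoc, ← ENNReal.ofReal_mul (by norm_num),
        ← ENNReal.ofReal_mul (by norm_num)]
      congr 2; ring
    _ = ENNReal.ofReal 3.8 * ∫⁻ ρ in Set.Ioo (0 : ℝ) (mesh / 2), ENNReal.ofReal ρ *
        (ENNReal.ofReal (Real.exp (-(Real.pi / 8)) * (2 * Real.pi)) * ‖gabor f p‖ₑ ^ 2) := by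
      rw [lintegral_mul_const _ (by fun_prop), hr]
    _ ≤ _ := by
      refine mul_le_mul_right ?_ _
      refine (setLIntegral_mono' measurableSet_Ioo hring).trans ?_
      exact lintegral_mono_set fun x hx => hx.1

/-- The cells of one column are disjoint, so the mean value bounds add up to an integral over a
strip of width 𝔞, to which a bound on vertical slices applies. -/
theorem sum_enorm_gabor_sq_le {f : ℝ → ℂ} (hf : MemLp f 2 volume) (m : ℤ) (N : Finset ℤ)
    {W : Set ℝ} (hW : ∀ n ∈ N, Set.Ioo (mesh * n - mesh / 2) (mesh * n + mesh / 2) ⊆ W) {C : ℝ≥0∞}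
    (hC : ∀ x, ∫⁻ w in W, ‖gabor f (x, w)‖ₑ ^ 2 ≤ C) :
    ∑ n ∈ N, ‖gabor f (latticePt mesh (m, n))‖ₑ ^ 2 ≤
      ENNReal.ofReal 3.8 * (ENNReal.ofReal mesh * C) := by
  have hm := mesh_pos
  have hc := continuous_gabor hf
  set I : ℤ → Set ℝ := fun n => Set.Ioo (mesh * n - mesh / 2) (mesh * n + mesh / 2) with hI
  have h1 : ∀ n ∈ N, ‖gabor f (latticePt mesh (m, n))‖ₑ ^ 2 ≤ ENNReal.ofReal 3.8 *
      ∫⁻ x in I m, ∫⁻ w in I n, ‖gabor f (x, w)‖ₑ ^ 2 := by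
    intro n _
    have h2 := enorm_gabor_sq_le hf (latticePt mesh (m, n))
    rw [Measure.volume_eq_prod, ← Measure.prod_restrict,
      lintegral_prod _ (by fun_prop)] at h2
    exact h2
  refine (Finset.sum_le_sum h1).trans ?_
  rw [← Finset.mul_sum]
  refine mul_le_mul_right ?_ _
  have hmeas : ∀ n, Measurable fun x => ∫⁻ w in I n, ‖gabor f (x, w)‖ₑ ^ 2 := fun n =>
    Measurable.lintegral_prod_right' (f := fun q : ℝ × ℝ => ‖gabor f q‖ₑ ^ 2) (by fun_prop)
  rw [← lintegral_finsetSum _ fun n _ => hmeas n]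
  have hdisj : Set.PairwiseDisjoint (N : Set ℤ) I := by
    intro j _ k _ hjk
    refine Set.disjoint_left.2 fun x hx hx' => hjk ?_
    have h3 : mesh * ((j : ℝ) - k) < mesh * 1 := by nlinarith [hx.1, hx'.2]
    have h4 : mesh * ((k : ℝ) - j) < mesh * 1 := by nlinarith [hx'.1, hx.2]
    have h5 : j - k < 1 := by exact_mod_cast lt_of_mul_lt_mul_left h3 hm.le
    have h6 : k - j < 1 := by exact_mod_cast lt_of_mul_lt_mul_left h4 hm.le
    omega
  have h2 : ∀ x, ∑ n ∈ N, ∫⁻ w in I n, ‖gabor f (x, w)‖ₑ ^ 2 ≤ C := by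
    intro x
    rw [← lintegral_biUnion_finset hdisj fun n _ => measurableSet_Ioo]
    exact (lintegral_mono_set (Set.iUnion₂_subset hW)).trans (hC x)
  refine (lintegral_mono h2).trans (le_of_eq ?_)
  rw [setLIntegral_const, mul_comm]
  congr 1
  rw [Real.volume_Ioo]
  congr 1; ring

theorem lintegral_le_kappa_sq (f : ℝ → ℂ) (S x : ℝ) :
    ∫⁻ w in {w : ℝ | S < |w|}, ‖gabor f (x, w)‖ₑ ^ 2 ≤ kappa S f ^ 2 := by
  have h := le_iSup (fun x : ℝ => eLpNorm (fun ω : ℝ => gabor f (x, ω)) 2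
    (volume.restrict {ω : ℝ | S < |ω|})) x
  have h2 := pow_le_pow_left' h 2
  have h3 := eLpNorm_nnreal_pow_eq_lintegral (μ := volume.restrict {ω : ℝ | S < |ω|})
    (f := fun ω : ℝ => gabor f (x, ω)) (p := 2) two_ne_zero
  simp only [NNReal.coe_ofNat, ENNReal.coe_ofNat, ENNReal.rpow_ofNat] at h3
  rw [← h3]
  exact h2

theorem lintegral_gabor_sq_le {f : ℝ → ℂ} (hf1 : ∀ p, ‖gabor f p‖ ≤ 1) {S : ℝ} (x : ℝ) :
    ∫⁻ w in Set.univ, ‖gabor f (x, w)‖ₑ ^ 2 ≤ ENNReal.ofReal (2 * S) + kappa S f ^ 2 := by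
  have hms : MeasurableSet {w : ℝ | S < |w|} := measurableSet_lt measurable_const (by fun_prop)
  rw [Measure.restrict_univ, ← lintegral_add_compl _ hms, add_comm]
  refine add_le_add ?_ (lintegral_le_kappa_sq f S x)
  have h1 : ∀ w, ‖gabor f (x, w)‖ₑ ^ 2 ≤ 1 := fun w => by
    rw [← ofReal_norm]
    exact pow_le_one' (ENNReal.ofReal_le_one.2 (hf1 _)) 2
  refine (lintegral_mono h1).trans ?_
  rw [lintegral_one, Measure.restrict_apply_univ]
  have h2 : {w : ℝ | S < |w|}ᶜ = Set.Icc (-S) S := by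
    ext w; simp [abs_le]
  rw [h2, Real.volume_Icc]
  refine le_of_eq ?_
  congr 1; ring

theorem sum_norm_gabor_sq_le {f : ℝ → ℂ} (hf : MemLp f 2 volume) (hf1 : ∀ p, ‖gabor f p‖ ≤ 1)
    {S : ℝ} (hS : 0 ≤ S) (hκ : kappa S f ≠ ⊤) (m : ℤ) (N : Finset ℤ) :
    ∑ n ∈ N, ‖gabor f (latticePt mesh (m, n))‖ ^ 2 ≤ 3.8 * mesh * (2 * S + (kappa S f).toReal ^ 2) := by
  have h := sum_enorm_gabor_sq_le hf m N (fun n _ => Set.subset_univ _)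
    (lintegral_gabor_sq_le hf1 (S := S))
  have hm := mesh_pos
  rw [← ENNReal.ofReal_toReal hκ, ← ENNReal.ofReal_pow ENNReal.toReal_nonneg,
    ← ENNReal.ofReal_add (by positivity) (by positivity), ← ENNReal.ofReal_mul hm.le,
    ← ENNReal.ofReal_mul (by norm_num), ← mul_assoc] at h
  simp only [← ofReal_norm, ← ENNReal.ofReal_pow (norm_nonneg _)] at h
  rw [← ENNReal.ofReal_sum_of_nonneg fun n _ => by positivity] at h
  rwa [ENNReal.ofReal_le_ofReal_iff (by positivity)] at h

/-- Here S must lie on the lattice: the next row is then at height at least S + 𝔞, and its cells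
stay inside |ω| > S. -/
theorem sum_norm_gabor_sq_le_of_gt {f : ℝ → ℂ} (hf : MemLp f 2 volume)
    {S : ℝ} (hS : ∃ n : ℕ, S = mesh * n) (hκ : kappa S f ≠ ⊤) (m : ℤ) (N : Finset ℤ)
    (hN : ∀ n ∈ N, S < |mesh * n|) :
    ∑ n ∈ N, ‖gabor f (latticePt mesh (m, n))‖ ^ 2 ≤ 3.8 * mesh * (kappa S f).toReal ^ 2 := by
  have hm := mesh_pos
  have h := sum_enorm_gabor_sq_le hf m N (W := {w : ℝ | S < |w|}) (fun n hn w hw => ?_)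
    (lintegral_le_kappa_sq f S)
  · rw [← ENNReal.ofReal_toReal hκ, ← ENNReal.ofReal_pow ENNReal.toReal_nonneg,
      ← ENNReal.ofReal_mul hm.le, ← ENNReal.ofReal_mul (by norm_num), ← mul_assoc] at h
    simp only [← ofReal_norm, ← ENNReal.ofReal_pow (norm_nonneg _)] at h
    rw [← ENNReal.ofReal_sum_of_nonneg fun n _ => by positivity] at h
    rwa [ENNReal.ofReal_le_ofReal_iff (by positivity)] at h
  · obtain ⟨M, rfl⟩ := hS
    have h1 := hN n hn
    rw [abs_mul, abs_of_pos hm, mul_lt_mul_iff_right₀ hm] at h1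
    have h2 : (M : ℤ) + 1 ≤ |n| := by
      have : (M : ℤ) < |n| := by exact_mod_cast h1
      omega
    have h3 : (M : ℝ) + 1 ≤ |(n : ℝ)| := by exact_mod_cast h2
    have h4 : |mesh * n - w| < mesh / 2 := by
      rw [abs_lt]; constructor <;> linarith [hw.1, hw.2]
    have h5 := abs_sub_abs_le_abs_sub (mesh * (n : ℝ)) w
    rw [abs_mul, abs_of_pos hm] at h5
    change mesh * M < |w|
    nlinarith

/-! ### Trigonometric polynomials -/

theorem intervalIntegral_exp_freq {n : ℤ} (hn : n ≠ 0) (x : ℝ) (k : ℕ) :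
    ∫ t in x..(x + k / mesh), Complex.exp (2 * Real.pi * Complex.I * mesh * n * t) = 0 := by
  have hm := mesh_pos
  have hm' : (mesh : ℂ) ≠ 0 := by exact_mod_cast hm.ne'
  have hc : (2 * Real.pi * Complex.I * mesh * n : ℂ) ≠ 0 := by
    have : (n : ℂ) ≠ 0 := by exact_mod_cast hn
    exact mul_ne_zero (mul_ne_zero Complex.two_pi_I_ne_zero hm') this
  rw [integral_exp_mul_complex hc]
  have : Complex.exp (2 * Real.pi * Complex.I * mesh * n * ((x + k / mesh : ℝ) : ℂ)) =
      Complex.exp (2 * Real.pi * Complex.I * mesh * n * x) := by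
    rw [Complex.exp_eq_exp_iff_exists_int]
    refine ⟨n * k, ?_⟩
    push_cast
    field_simp
  rw [this, sub_self, zero_div]

theorem intervalIntegral_trigPoly (N : Finset ℤ) (c : ℤ → ℂ) (x : ℝ) (k : ℕ) :
    ∫ t in x..(x + k / mesh), ‖∑ n ∈ N, c n * Complex.exp (2 * Real.pi * Complex.I * mesh * n * t)‖ ^ 2
      = k / mesh * ∑ n ∈ N, ‖c n‖ ^ 2 := by
  have h1 : ∀ t : ℝ, ((‖∑ n ∈ N, c n * Complex.exp (2 * Real.pi * Complex.I * mesh * n * t)‖ ^ 2 : ℝ) : ℂ)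
      = ∑ n ∈ N, ∑ l ∈ N, c n * conj (c l) *
        Complex.exp (2 * Real.pi * Complex.I * mesh * ((n - l : ℤ) : ℂ) * t) := by
    intro t
    rw [← Complex.normSq_eq_norm_sq, ← Complex.mul_conj, map_sum, Finset.sum_mul_sum]
    refine Finset.sum_congr rfl fun n _ => Finset.sum_congr rfl fun l _ => ?_
    rw [map_mul, ← Complex.exp_conj]
    simp only [map_mul, Complex.conj_ofReal, Complex.conj_I, map_ofNat, map_intCast]
    rw [mul_mul_mul_comm, ← Complex.exp_add]
    congr 2
    push_cast; ring
  rw [← Complex.ofReal_inj, ← intervalIntegral.integral_ofReal]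
  simp only [h1]
  have hInt : ∀ n l : ℤ, IntervalIntegrable (fun t : ℝ => c n * conj (c l) *
        Complex.exp (2 * Real.pi * Complex.I * mesh * ((n - l : ℤ) : ℂ) * t)) volume x (x + k / mesh) :=
    fun n l => Continuous.intervalIntegrable (by fun_prop) _ _
  refine (intervalIntegral.integral_finsetSum fun n _ =>
    Continuous.intervalIntegrable (by fun_prop) _ _).trans ?_
  simp only [intervalIntegral.integral_finsetSum fun l _ => hInt _ l, Finset.mul_sum,
    Complex.ofReal_sum]
  refine Finset.sum_congr rfl fun n hn => ?_
  rw [Finset.sum_eq_single_of_mem n hn]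
  · simp only [sub_self, Int.cast_zero, mul_zero, zero_mul, Complex.exp_zero, mul_one,
      intervalIntegral.integral_const, add_sub_cancel_left, Complex.mul_conj,
      Complex.normSq_eq_norm_sq, Complex.real_smul]
    push_cast; ring
  · intro l _ hl
    rw [intervalIntegral.integral_const_mul, intervalIntegral_exp_freq (sub_ne_zero.2 hl.symm),
      mul_zero]

/-- The interval is covered by ⌈2τ𝔞⌉ full periods of length 1/𝔞 = √2, on which Parseval's identity
is exact; rounding up adds at most √2 to the length. -/
theorem eLpNorm_trigPoly_le {τ : ℝ} (hτ : 0 < τ) (N : Finset ℤ) (c : ℤ → ℂ) :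
    eLpNorm (fun t : ℝ => ∑ n ∈ N, c n * Complex.exp (2 * Real.pi * Complex.I * mesh * n * t)) 2
      (volume.restrict (Set.Ioo (-τ) τ)) ≤
      ENNReal.ofReal √((2 * τ + √2) * ∑ n ∈ N, ‖c n‖ ^ 2) := by
  have hm := mesh_pos
  set P : ℝ → ℂ := fun t => ∑ n ∈ N, c n * Complex.exp (2 * Real.pi * Complex.I * mesh * n * t)
  have hP : Continuous P := by fun_prop
  set k : ℕ := ⌈2 * τ * mesh⌉₊
  have hk1 : 2 * τ ≤ k / mesh := by rw [le_div_iff₀ hm]; exact Nat.le_ceil _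
  have hk2 : k / mesh ≤ 2 * τ + √2 := by
    have h1 : (k : ℝ) < 2 * τ * mesh + 1 := Nat.ceil_lt_add_one (by positivity)
    have h2 : √2 * mesh = 1 := by rw [mesh]; field_simp
    rw [div_le_iff₀ hm]; nlinarith
  have h3 := eLpNorm_nnreal_pow_eq_lintegral (μ := volume.restrict (Set.Ioo (-τ) τ))
    (f := P) (p := 2) two_ne_zero
  simp only [NNReal.coe_ofNat, ENNReal.coe_ofNat, ENNReal.rpow_ofNat] at h3
  have h4 : ∫⁻ t in Set.Ioo (-τ) τ, ‖P t‖ₑ ^ 2 ≤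
      ENNReal.ofReal ((2 * τ + √2) * ∑ n ∈ N, ‖c n‖ ^ 2) := by
    calc _ ≤ ∫⁻ t in Set.Ioc (-τ) (-τ + k / mesh), ‖P t‖ₑ ^ 2 :=
          lintegral_mono_set fun t ht => ⟨ht.1, by linarith [ht.2]⟩
      _ = ENNReal.ofReal (∫ t in (-τ)..(-τ + k / mesh), ‖P t‖ ^ 2) := by
          rw [intervalIntegral.integral_of_le (by linarith),
            ofReal_integral_eq_lintegral_ofReal]
          · simp only [← ofReal_norm, ← ENNReal.ofReal_pow (norm_nonneg _)]
          · exact ((hP.norm.pow 2).integrableOn_Icc).mono_set Set.Ioc_subset_Icc_self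
          · exact ae_of_all _ fun t => by positivity
      _ ≤ _ := by
          rw [intervalIntegral_trigPoly]
          exact ENNReal.ofReal_le_ofReal (mul_le_mul_of_nonneg_right hk2 (by positivity))
  rw [← h3] at h4
  refine (ENNReal.pow_le_pow_left_iff two_ne_zero).1 ?_
  rw [← ENNReal.ofReal_pow (Real.sqrt_nonneg _), Real.sq_sqrt (by positivity)]
  exact h4

/-! ### Truncation of the frame expansion -/

/-- The `L²`-seminorm on `(-τ, τ)`. -/
noncomputable abbrev localNorm (τ : ℝ) (h : ℝ → ℂ) : ℝ≥0∞ :=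
  eLpNorm h 2 (volume.restrict (Set.Ioo (-τ) τ))

theorem localNorm_congr_ae {τ : ℝ} {g h : ℝ → ℂ} (hgh : g =ᵐ[volume] h) :
    localNorm τ g = localNorm τ h := eLpNorm_congr_ae (ae_restrict_of_ae hgh)

theorem localNorm_le (τ : ℝ) (h : L2R) : localNorm τ h ≤ ‖h‖ₑ := by
  rw [Lp.enorm_def]
  exact eLpNorm_mono_measure _ Measure.restrict_le_self

theorem localNorm_add_le (τ : ℝ) (g h : L2R) :
    localNorm τ (g + h : L2R) ≤ localNorm τ g + localNorm τ h := by
  rw [localNorm_congr_ae (Lp.coeFn_add g h)]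
  exact eLpNorm_add_le (Lp.memLp g).1.restrict (Lp.memLp h).1.restrict (by norm_num)

theorem localNorm_sum_le {ι : Type*} (τ : ℝ) (F : Finset ι) (h : ι → L2R) :
    localNorm τ (∑ i ∈ F, h i : L2R) ≤ ∑ i ∈ F, localNorm τ (h i) := by
  classical
  induction F using Finset.induction_on with
  | empty =>
    simp only [Finset.sum_empty]
    exact (localNorm_le τ 0).trans (by simp)
  | insert a F ha ih =>
    rw [Finset.sum_insert ha, Finset.sum_insert ha]
    exact (localNorm_add_le τ _ _).trans (add_le_add le_rfl ih)

theorem coeFn_latShift_dualL (k : ℤ × ℤ) :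
    (latShift k dualL : ℝ → ℂ) =ᵐ[volume] tfShift (latticePt mesh k) dualL := coeFn_shiftL _ _

/-- Contribution of a single column of lattice points. -/
theorem localNorm_column_le {τ : ℝ} (hτ : 0 < τ) (m : ℤ) (N : Finset ℤ) (c : ℤ → ℂ) :
    localNorm τ (∑ n ∈ N, c n • latShift (m, n) dualL : L2R) ≤
      ENNReal.ofReal (5 * Real.exp (-(Real.pi / 2) * (mesh * |(m : ℝ)| - τ)) *
        √((2 * τ + √2) * ∑ n ∈ N, ‖c n‖ ^ 2)) := by
  set P : ℝ → ℂ := fun t => ∑ n ∈ N, c n * Complex.exp (2 * Real.pi * Complex.I * mesh * n * t)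
  set A : ℝ := 5 * Real.exp (-(Real.pi / 2) * (mesh * |(m : ℝ)| - τ)) with hA
  have hA0 : 0 ≤ A := by positivity
  have h1 := coeFn_sum_smul N c (fun n => latShift (m, n) dualL) _ fun n => coeFn_latShift_dualL (m, n)
  have h2 : ∀ᵐ t : ℝ, ‖dualL (t - mesh * m)‖ ≤
      5 * Real.exp (-(Real.pi / 2) * |t - mesh * m|) :=
    (measurePreserving_sub_right volume (mesh * (m : ℝ))).quasiMeasurePreserving.ae ae_norm_dualL_le
  have h3 : ∀ᵐ t ∂volume.restrict (Set.Ioo (-τ) τ),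
      ‖(∑ n ∈ N, c n • latShift (m, n) dualL : L2R) t‖ ≤ ‖((A : ℂ) • P) t‖ := by
    filter_upwards [ae_restrict_of_ae h1, ae_restrict_of_ae h2, ae_restrict_mem measurableSet_Ioo]
      with t ht1 ht2 ht
    rw [ht1]
    -- All shifts of one column share the same translate of the dual window, so the column is a
    -- trigonometric polynomial times a function with a pointwise bound.
    have e : ∑ n ∈ N, c n * tfShift (latticePt mesh (m, n)) dualL t = P t * dualL (t - mesh * m) := by
      rw [Finset.sum_mul]
      refine Finset.sum_congr rfl fun n _ => ?_
      simp only [tfShift, latticePt]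
      rw [show (2 * Real.pi * Complex.I * ((mesh * n : ℝ) : ℂ) * t : ℂ) =
        2 * Real.pi * Complex.I * mesh * n * t by push_cast; ring]
      ring
    rw [e, norm_mul, Pi.smul_apply, norm_smul, Complex.norm_real, Real.norm_of_nonneg hA0, mul_comm]
    refine mul_le_mul_of_nonneg_right (ht2.trans ?_) (norm_nonneg _)
    rw [hA]
    gcongr 5 * Real.exp ?_
    have h4 : mesh * |(m : ℝ)| - τ ≤ |t - mesh * m| := by
      have h5 := abs_sub_abs_le_abs_sub (mesh * (m : ℝ)) t
      rw [abs_mul, abs_of_pos mesh_pos, abs_sub_comm] at h5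
      have h6 : |t| ≤ τ := abs_le.2 ⟨ht.1.le, ht.2.le⟩
      linarith
    nlinarith [Real.pi_pos]
  refine (eLpNorm_mono_ae h3).trans ?_
  rw [eLpNorm_const_smul, ENNReal.ofReal_mul hA0, ← ofReal_norm, Complex.norm_real,
    Real.norm_of_nonneg hA0]
  exact mul_le_mul_right (eLpNorm_trigPoly_le hτ N c) _

theorem hasSum_nat_geometric_tail {q : ℝ} (hq0 : 0 ≤ q) (hq1 : q < 1) (M : ℕ) :
    HasSum (fun n : ℕ => if M ≤ n then q ^ (n + 1) else 0) (q ^ M * (q / (1 - q))) := by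
  have h0 : HasSum (fun n : ℕ => q ^ (n + M + 1)) (q ^ M * (q / (1 - q))) := by
    have := (hasSum_geometric_of_lt_one hq0 hq1).mul_left (q ^ (M + 1))
    convert! this using 1
    · ext n; ring
    · rw [div_eq_mul_inv]; ring
  rw [← hasSum_nat_add_iff' M]
  have e : ∑ i ∈ Finset.range M, (if M ≤ i then q ^ (i + 1) else 0) = 0 :=
    Finset.sum_eq_zero fun i hi => if_neg (by have := Finset.mem_range.1 hi; omega)
  rw [e, sub_zero]
  refine h0.congr_fun fun n => ?_
  rw [if_pos (by omega)]

theorem sum_int_geometric_tail_le {q : ℝ} (hq0 : 0 ≤ q) (hq1 : q < 1) (M : ℕ) (F : Finset ℤ)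
    (hF : ∀ m ∈ F, M < m.natAbs) : ∑ m ∈ F, q ^ m.natAbs ≤ 2 * (q ^ M * (q / (1 - q))) := by
  set u : ℤ → ℝ := fun m => if M < m.natAbs then q ^ m.natAbs else 0 with hu
  have ht := hasSum_nat_geometric_tail hq0 hq1 M
  have h1 : HasSum (fun n : ℕ => u n) (q ^ M * (q / (1 - q))) := by
    rw [← hasSum_nat_add_iff' 1]
    have : u ((0 : ℕ) : ℤ) = 0 := by simp [hu]
    rw [Finset.sum_range_one, this, sub_zero]
    refine ht.congr_fun fun n => ?_
    simp only [hu, Int.natAbs_natCast, Nat.lt_succ_iff]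
  have h2 : HasSum (fun n : ℕ => u (-(n + 1 : ℤ))) (q ^ M * (q / (1 - q))) := by
    refine ht.congr_fun fun n => ?_
    have : (-(n + 1 : ℤ)).natAbs = n + 1 := by omega
    simp only [hu, this, Nat.lt_succ_iff]
  have h3 := HasSum.of_nat_of_neg_add_one h1 h2
  have h4 : ∑ m ∈ F, q ^ m.natAbs = ∑ m ∈ F, u m :=
    Finset.sum_congr rfl fun m hm => by simp only [hu, if_pos (hF m hm)]
  rw [h4, two_mul]
  refine sum_le_hasSum F (fun m _ => ?_) h3
  simp only [hu]; split_ifs <;> positivity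

theorem exp_neg_mesh_le : Real.exp (-(Real.pi / 2 * mesh)) ≤ 1 / 3 := by
  have hm : 0.7071 ≤ mesh := by
    have := mesh_sq
    have := mesh_pos
    nlinarith
  have h1 : (1.11 : ℝ) ≤ Real.pi / 2 * mesh := by nlinarith [Real.pi_gt_d4]
  have h2 : (3 : ℝ) ≤ Real.exp 1.11 := by
    have := Real.sum_le_exp_of_nonneg (x := 1.11) (by norm_num) 6
    refine le_trans ?_ this
    norm_num [Finset.sum_range_succ, Nat.factorial]
  rw [Real.exp_neg, inv_eq_one_div]
  exact one_div_le_one_div_of_le (by norm_num) (h2.trans (Real.exp_le_exp.2 h1))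

section Tail

variable {f : ℝ → ℂ} {T S τ : ℝ}

/-- The lattice points beside the rectangle, `|x| > T`. -/
theorem localNorm_side_le (hf : MemLp f 2 volume) (hf1 : ∀ p, ‖gabor f p‖ ≤ 1)
    (hT : ∃ m : ℕ, T = mesh * m) (hS : 0 ≤ S) (hτ : 0 < τ) (hκ : kappa S f ≠ ⊤)
    (B : Finset (ℤ × ℤ)) (hB : ∀ k ∈ B, T < |mesh * k.1|) :
    localNorm τ (∑ k ∈ B, gabor f (latticePt mesh k) • latShift k dualL : L2R) ≤
      ENNReal.ofReal (5 * Real.exp (-(Real.pi / 2) * (T - τ)) *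
        √(3.8 * (√2 * τ + 1) * (2 * S + (kappa S f).toReal ^ 2))) := by
  classical
  obtain ⟨M, rfl⟩ := hT
  have hm := mesh_pos
  -- Extension by zero allows summation over a full product of columns and rows.
  set c : ℤ × ℤ → ℂ := fun k => if k ∈ B then gabor f (latticePt mesh k) else 0 with hc
  set X := B.image Prod.fst
  set N := B.image Prod.snd
  set Z := 3.8 * (√2 * τ + 1) * (2 * S + (kappa S f).toReal ^ 2) with hZ
  have hZ0 : 0 ≤ Z := by positivity
  set q := Real.exp (-(Real.pi / 2 * mesh)) with hq
  have hsub : B ⊆ X ×ˢ N := fun k hk => Finset.mem_product.2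
    ⟨Finset.mem_image_of_mem _ hk, Finset.mem_image_of_mem _ hk⟩
  have h1 : ∑ k ∈ B, gabor f (latticePt mesh k) • latShift k dualL =
      ∑ m ∈ X, ∑ n ∈ N, c (m, n) • latShift (m, n) dualL := by
    rw [← Finset.sum_product', ← Finset.sum_subset hsub]
    · exact Finset.sum_congr rfl fun k hk => by simp only [hc, if_pos hk]
    · intro k _ hk; simp only [hc, if_neg hk, zero_smul]
  have hX : ∀ m ∈ X, M < m.natAbs := by
    intro m hmX
    obtain ⟨k, hk, rfl⟩ := Finset.mem_image.1 hmX
    have h2 := hB k hk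
    rw [abs_mul, abs_of_pos hm, mul_lt_mul_iff_right₀ hm] at h2
    have h3 : (M : ℤ) < |k.1| := by exact_mod_cast h2
    rw [Int.abs_eq_natAbs] at h3
    exact_mod_cast h3
  have hcol : ∀ m ∈ X, localNorm τ (∑ n ∈ N, c (m, n) • latShift (m, n) dualL : L2R) ≤
      ENNReal.ofReal (5 * Real.exp (Real.pi / 2 * τ) * √Z * q ^ m.natAbs) := by
    intro m _
    refine (localNorm_column_le hτ m N fun n => c (m, n)).trans (ENNReal.ofReal_le_ofReal ?_)
    have h2 : (2 * τ + √2) * ∑ n ∈ N, ‖c (m, n)‖ ^ 2 ≤ Z := by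
      have h3 : ∑ n ∈ N, ‖c (m, n)‖ ^ 2 ≤ ∑ n ∈ N, ‖gabor f (latticePt mesh (m, n))‖ ^ 2 := by
        refine Finset.sum_le_sum fun n _ => ?_
        simp only [hc]
        split_ifs
        · exact le_rfl
        · simp
      have h4 := h3.trans (sum_norm_gabor_sq_le hf hf1 hS hκ m N)
      have h5 : √2 * mesh = 1 := by rw [mesh]; field_simp
      have h6 : 2 * mesh = √2 := by
        have := Real.sq_sqrt (two_pos.le : (0:ℝ) ≤ 2)
        nlinarith [Real.sqrt_nonneg 2]
      calc _ ≤ (2 * τ + √2) * (3.8 * mesh * (2 * S + (kappa S f).toReal ^ 2)) := by gcongr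
        _ = 3.8 * ((2 * mesh) * τ + √2 * mesh) * (2 * S + (kappa S f).toReal ^ 2) := by ring
        _ = Z := by rw [h5, h6]
    have h7 : Real.exp (-(Real.pi / 2) * (mesh * |(m : ℝ)| - τ)) =
        Real.exp (Real.pi / 2 * τ) * q ^ m.natAbs := by
      rw [hq, ← Real.exp_nat_mul, ← Real.exp_add, Nat.cast_natAbs]
      congr 1; push_cast; ring
    rw [h7]
    calc _ ≤ 5 * (Real.exp (Real.pi / 2 * τ) * q ^ m.natAbs) * √Z := by gcongr
      _ = _ := by ring
  rw [h1]
  refine (localNorm_sum_le τ X _).trans ((Finset.sum_le_sum hcol).trans ?_)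
  rw [← ENNReal.ofReal_sum_of_nonneg fun m _ => by positivity]
  refine ENNReal.ofReal_le_ofReal ?_
  rw [← Finset.mul_sum]
  have hq3 : q ≤ 1 / 3 := exp_neg_mesh_le
  have hq0 : 0 < q := Real.exp_pos _
  have hqq : q / (1 - q) ≤ 1 / 2 := by
    rw [div_le_iff₀ (by linarith)]; linarith
  -- With q ≤ 1/3 the two geometric tails together are at most q^M, so summing the columns costs
  -- nothing beyond the first.
  have hsum : ∑ m ∈ X, q ^ m.natAbs ≤ q ^ M := by
    refine (sum_int_geometric_tail_le hq0.le (by linarith) M X hX).trans ?_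
    have : q ^ M * (q / (1 - q)) ≤ q ^ M * (1 / 2) := by gcongr
    linarith
  have hqM : Real.exp (-(Real.pi / 2) * (mesh * M - τ)) = Real.exp (Real.pi / 2 * τ) * q ^ M := by
    rw [hq, ← Real.exp_nat_mul, ← Real.exp_add]
    congr 1; ring
  rw [hqM]
  calc _ ≤ 5 * Real.exp (Real.pi / 2 * τ) * √Z * q ^ M := by gcongr
    _ = _ := by ring

/-- The lattice points above and below the rectangle, `|x| ≤ T` and `|ω| > S`. -/
theorem norm_above_le (hf : MemLp f 2 volume) (hT : ∃ m : ℕ, T = mesh * m)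
    (hS : ∃ n : ℕ, S = mesh * n) (hκ : kappa S f ≠ ⊤) (A : Finset (ℤ × ℤ))
    (hA : ∀ k ∈ A, |mesh * k.1| ≤ T ∧ S < |mesh * k.2|) :
    ‖(∑ k ∈ A, gabor f (latticePt mesh k) • latShift k dualL : L2R)‖ ≤
      √(3.8 * (2 * T + mesh)) * (kappa S f).toReal := by
  classical
  obtain ⟨M, rfl⟩ := hT
  have hm := mesh_pos
  -- No decay is used here: the global L² bound applies, with 2M + 1 columns and 𝔞(2M + 1) = 2T + 𝔞.
  refine (norm_sum_dual_le A _).trans ?_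
  rw [Real.sqrt_le_left (by positivity), mul_pow, Real.sq_sqrt (by positivity)]
  set N := A.image Prod.snd
  have hsub : A ⊆ Finset.Icc (-(M : ℤ)) M ×ˢ N := by
    intro k hk
    refine Finset.mem_product.2 ⟨?_, Finset.mem_image_of_mem _ hk⟩
    have h1 := (hA k hk).1
    rw [abs_mul, abs_of_pos hm, mul_le_mul_iff_right₀ hm] at h1
    have h2 : |k.1| ≤ (M : ℤ) := by exact_mod_cast h1
    rw [Finset.mem_Icc]; exact abs_le.1 h2
  have hN : ∀ n ∈ N, S < |mesh * n| := by
    intro n hn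
    obtain ⟨k, hk, rfl⟩ := Finset.mem_image.1 hn
    exact (hA k hk).2
  calc _ ≤ ∑ k ∈ Finset.Icc (-(M : ℤ)) M ×ˢ N, ‖gabor f (latticePt mesh k)‖ ^ 2 :=
        Finset.sum_le_sum_of_subset_of_nonneg hsub fun k _ _ => by positivity
    _ = ∑ m ∈ Finset.Icc (-(M : ℤ)) M, ∑ n ∈ N, ‖gabor f (latticePt mesh (m, n))‖ ^ 2 :=
        Finset.sum_product _ _ _
    _ ≤ ∑ m ∈ Finset.Icc (-(M : ℤ)) M, 3.8 * mesh * (kappa S f).toReal ^ 2 :=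
        Finset.sum_le_sum fun m _ => sum_norm_gabor_sq_le_of_gt hf hS hκ m N hN
    _ = _ := by
        rw [Finset.sum_const, Int.card_Icc, nsmul_eq_mul]
        have : ((((M : ℤ) + 1 - -(M : ℤ)).toNat : ℕ) : ℝ) = 2 * M + 1 := by
          have : ((M : ℤ) + 1 - -(M : ℤ)).toNat = 2 * M + 1 := by omega
          rw [this]; push_cast; ring
        rw [this]; ring

theorem truncation_numeric {K : ℝ} (hT : 0 < T) (hS : 0 < S) (hτ : 0 < τ) (hτT : τ < T)
    (hK : 0 ≤ K) : √(3.8 * (2 * T + mesh)) * K +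
      5 * Real.exp (-(Real.pi / 2) * (T - τ)) * √(3.8 * (√2 * τ + 1) * (2 * S + K ^ 2)) ≤
      18 * ((2 * T + 2) * K + 2 * √S * (τ + 1) * Real.exp (-(Real.pi / 2) * (T - τ))) := by
  have hm : mesh ≤ 0.7072 := by
    have := mesh_sq
    have := mesh_pos
    nlinarith
  have hs2 : √2 ≤ 1.5 := by rw [Real.sqrt_le_left (by norm_num)]; norm_num
  have h1 : √(3.8 * (2 * T + mesh)) ≤ 2 * (2 * T + 2) := by
    rw [Real.sqrt_le_left (by positivity)]; nlinarith
  have hSs := Real.sq_sqrt hS.le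
  have hS0 := Real.sqrt_nonneg S
  have h2 : √(3.8 * (√2 * τ + 1) * (2 * S + K ^ 2)) ≤ 2 * (τ + 1) * (1.5 * √S + K) := by
    rw [Real.sqrt_le_left (by positivity), mul_pow]
    refine mul_le_mul ?_ ?_ (by positivity) (by positivity)
    · nlinarith
    · nlinarith [mul_nonneg hS0 hK]
  set e := Real.exp (-(Real.pi / 2) * (T - τ)) with he
  have he0 : 0 < e := Real.exp_pos _
  have he1 : e ≤ 1 := by
    rw [he, Real.exp_le_one_iff]; nlinarith [Real.pi_pos]
  have h3 : e * ((τ + 1) * K) ≤ 1 * ((T + 1) * K) := by gcongr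
  have h4 : 0 ≤ √S * (τ + 1) * e := by positivity
  have h5 : 0 ≤ (T + 1) * K := by positivity
  calc _ ≤ 2 * (2 * T + 2) * K + 5 * e * (2 * (τ + 1) * (1.5 * √S + K)) := by gcongr
    _ = 4 * ((T + 1) * K) + 10 * (e * ((τ + 1) * K)) + 15 * (√S * (τ + 1) * e) := by ring
    _ ≤ 4 * ((T + 1) * K) + 10 * (1 * ((T + 1) * K)) + 15 * (√S * (τ + 1) * e) := by gcongr
    _ ≤ 36 * ((T + 1) * K) + 36 * (√S * (τ + 1) * e) := by linarith
    _ = _ := by ring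

/-- The error of the truncated frame expansion. -/
theorem localNorm_sub_sum_le (hf : MemLp f 2 volume) (hf1 : ∀ p, ‖gabor f p‖ ≤ 1)
    (hT : ∃ m : ℕ, T = mesh * m) (hS : ∃ n : ℕ, S = mesh * n) (hT0 : 0 < T) (hS0 : 0 < S)
    (hτ : 0 < τ) (hτT : τ < T) :
    localNorm τ (hf.toLp f - ∑ k ∈ setΛ T S, gabor f (latticePt mesh k) • latShift k dualL : L2R) ≤
      18 * (ENNReal.ofReal (2 * T + 2) * kappa S f +
        ENNReal.ofReal (2 * √S * (τ + 1) * Real.exp (-(Real.pi / 2) * (T - τ)))) := by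
  classical
  -- If κ_S is infinite, so is the right side, as its coefficient 2T + 2 is positive.
  by_cases hκ : kappa S f = ⊤
  · rw [hκ, ENNReal.mul_top (by rw [ne_eq, ENNReal.ofReal_eq_zero]; linarith), top_add,
      ENNReal.mul_top (by norm_num)]
    exact le_top
  set K := (kappa S f).toReal with hK
  have hK0 : 0 ≤ K := ENNReal.toReal_nonneg
  set F : L2R := hf.toLp f
  have hs := hasSum_dual F
  simp only [F, gabor_congr_ae hf.coeFn_toLp] at hs
  set u : ℤ × ℤ → L2R := fun k => gabor f (latticePt mesh k) • latShift k dualL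
  -- For each finite Φ containing Λ the extra points lie either above or below the rectangle or
  -- beside it. The rest of the expansion tends to 0 in L² as Φ grows.
  have hbound : ∀ Φ : Finset (ℤ × ℤ), setΛ T S ≤ Φ →
      localNorm τ (F - ∑ k ∈ setΛ T S, u k : L2R) ≤
        18 * (ENNReal.ofReal (2 * T + 2) * kappa S f +
        ENNReal.ofReal (2 * √S * (τ + 1) * Real.exp (-(Real.pi / 2) * (T - τ)))) +
        ‖F - ∑ k ∈ Φ, u k‖ₑ := by
    intro Φ hΦ
    set A := (Φ \ setΛ T S).filter fun k => |mesh * k.1| ≤ T with hAdef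
    set B := (Φ \ setΛ T S).filter fun k => ¬ |mesh * k.1| ≤ T with hBdef
    have e : F - ∑ k ∈ setΛ T S, u k = (∑ k ∈ A, u k + ∑ k ∈ B, u k) + (F - ∑ k ∈ Φ, u k) := by
      rw [hAdef, hBdef, Finset.sum_filter_add_sum_filter_not, ← Finset.sum_sdiff hΦ]
      abel
    have hA : ∀ k ∈ A, |mesh * k.1| ≤ T ∧ S < |mesh * k.2| := by
      intro k hk
      obtain ⟨hk1, hk2⟩ := Finset.mem_filter.1 hk
      refine ⟨hk2, ?_⟩
      by_contra h
      push Not at h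
      refine (Finset.mem_sdiff.1 hk1).2 ((mem_latticeRect mesh_pos k).2 ?_)
      exact ⟨abs_le.1 hk2, abs_le.1 h⟩
    have hB : ∀ k ∈ B, T < |mesh * k.1| := fun k hk => not_le.1 (Finset.mem_filter.1 hk).2
    have h1 := norm_above_le hf hT hS hκ A hA
    have h2 := localNorm_side_le hf hf1 hT hS0.le hτ hκ B hB
    have h3 := truncation_numeric hT0 hS0 hτ hτT hK0
    have h4 : localNorm τ (∑ k ∈ A, u k : L2R) ≤
        ENNReal.ofReal (√(3.8 * (2 * T + mesh)) * K) := by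
      refine (localNorm_le τ _).trans ?_
      rw [← ofReal_norm]
      exact ENNReal.ofReal_le_ofReal h1
    rw [e]
    refine (localNorm_add_le τ _ _).trans (add_le_add ?_ (localNorm_le τ _))
    refine (localNorm_add_le τ _ _).trans ((add_le_add h4 h2).trans ?_)
    have hm := mesh_pos
    rw [← ENNReal.ofReal_add (by positivity) (by positivity)]
    refine (ENNReal.ofReal_le_ofReal h3).trans (le_of_eq ?_)
    rw [ENNReal.ofReal_mul (by norm_num), ENNReal.ofReal_add (by positivity) (by positivity),
      ENNReal.ofReal_mul (by positivity), hK, ENNReal.ofReal_toReal hκ, ENNReal.ofReal_ofNat]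
  have hlim : Tendsto (fun Φ : Finset (ℤ × ℤ) =>
      18 * (ENNReal.ofReal (2 * T + 2) * kappa S f +
        ENNReal.ofReal (2 * √S * (τ + 1) * Real.exp (-(Real.pi / 2) * (T - τ)))) +
        ‖F - ∑ k ∈ Φ, u k‖ₑ) atTop (𝓝 (18 * (ENNReal.ofReal (2 * T + 2) * kappa S f +
        ENNReal.ofReal (2 * √S * (τ + 1) * Real.exp (-(Real.pi / 2) * (T - τ)))) + 0)) := by
    refine tendsto_const_nhds.add ?_
    have h1 : Tendsto (fun Φ : Finset (ℤ × ℤ) => ∑ k ∈ Φ, u k) atTop (𝓝 F) := hs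
    have h2 := (tendsto_const_nhds (x := F)).sub h1
    have h3 := h2.enorm
    rwa [sub_self, enorm_zero] at h3
  rw [add_zero] at hlim
  refine ge_of_tendsto hlim ?_
  filter_upwards [eventually_ge_atTop (setΛ T S)] with Φ hΦ
  exact hbound Φ hΦ

end Tail

/-! ### Consequences of the calibration -/

theorem gaborEnergy_le {f : ℝ → ℂ} (hf1 : ∀ p, ‖gabor f p‖ ≤ 1) (Λ : Finset (ℤ × ℤ)) :
    gaborEnergy f Λ ≤ Λ.card := by
  rw [gaborEnergy]
  refine (Finset.sum_le_card_nsmul Λ _ 1 fun k _ => ?_).trans (by simp)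
  exact pow_le_one₀ (norm_nonneg _) (hf1 _)

theorem nine_le_card_setΛ {T S : ℝ} (hT : ∃ m : ℕ, T = mesh * m) (hS : ∃ n : ℕ, S = mesh * n)
    (hT0 : 0 < T) (hS0 : 0 < S) : 9 ≤ (setΛ T S).card := by
  have key : ∀ X : ℝ, (∃ m : ℕ, X = mesh * m) → 0 < X → mesh ≤ X := by
    rintro X ⟨m, rfl⟩ h
    have hm := mesh_pos
    have : (0 : ℝ) < m := by
      by_contra h'
      have : (m : ℝ) = 0 := le_antisymm (not_lt.1 h') (Nat.cast_nonneg m)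
      rw [this, mul_zero] at h
      exact lt_irrefl _ h
    have h1 : (1 : ℝ) ≤ m := by exact_mod_cast (by exact_mod_cast this : 0 < m)
    nlinarith
  have hsub : (Finset.Icc (-1 : ℤ) 1 ×ˢ Finset.Icc (-1 : ℤ) 1) ⊆ setΛ T S := by
    intro k hk
    rw [Finset.mem_product, Finset.mem_Icc, Finset.mem_Icc] at hk
    have hm := mesh_pos
    have h1 := key T hT hT0
    have h2 := key S hS hS0
    rw [mem_latticeRect hm]
    obtain ⟨⟨a, b⟩, c, d⟩ := hk
    have a' : (-1 : ℝ) ≤ k.1 := by exact_mod_cast a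
    have b' : (k.1 : ℝ) ≤ 1 := by exact_mod_cast b
    have c' : (-1 : ℝ) ≤ k.2 := by exact_mod_cast c
    have d' : (k.2 : ℝ) ≤ 1 := by exact_mod_cast d
    simp only [latticePt, Set.mem_prod, Set.mem_Icc]
    refine ⟨⟨?_, ?_⟩, ?_, ?_⟩ <;> nlinarith
  exact (Finset.card_le_card hsub).trans' (by simp)

/-- The ratio 3.1/13.3 gives 0.2331. Positivity of ε forces both terms of the minimum to be
positive, so the energy and the gap need no separate assumption. The minimum is at most 1/n ≤ 1/9,
whence the absolute bound on ε. -/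
theorem calibration_numeric {E n g r ε ε' x : ℝ} (hE0 : 0 ≤ E) (hEn : E ≤ n) (hn9 : 9 ≤ n)
    (hg0 : 0 ≤ g) (hr : 0 < r) (hx1 : 1 ≤ x) (hε : 0 < ε)
    (hle : ε ≤ (x⁻¹ / (1.33 * 10 ^ 5) * min (E / n ^ 2) (g / (192 * r ^ 2))) ^ 2)
    (heq : ε' = 3.1 * 10 ^ 4 * √ε * x) :
    0 < E ∧ 0 < g ∧ ε' ≤ 0.2331 * (E / n ^ 2) ∧ ε' ≤ 0.2331 * (g / (192 * r ^ 2)) ∧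
      ε ≤ 7 / 10 ^ 13 := by
  have hm1 : min (E / n ^ 2) (g / (192 * r ^ 2)) ≤ E / n ^ 2 := min_le_left _ _
  have hm2 : min (E / n ^ 2) (g / (192 * r ^ 2)) ≤ g / (192 * r ^ 2) := min_le_right _ _
  have hm0 : 0 ≤ min (E / n ^ 2) (g / (192 * r ^ 2)) := le_min (by positivity) (by positivity)
  generalize min (E / n ^ 2) (g / (192 * r ^ 2)) = m at hle hm1 hm2 hm0
  have hx0 : 0 < x := by linarith
  have hc0 : 0 ≤ x⁻¹ / (1.33 * 10 ^ 5) * m := by positivity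
  have hsq : √ε ≤ x⁻¹ / (1.33 * 10 ^ 5) * m := (Real.sqrt_le_left hc0).2 hle
  have hsp : 0 < √ε := Real.sqrt_pos.2 hε
  have hmpos : 0 < m := by
    refine hm0.lt_of_ne fun h => ?_
    rw [← h, mul_zero] at hsq
    linarith
  have hεm : ε' ≤ 0.2331 * m := by
    rw [heq]
    calc 3.1 * 10 ^ 4 * √ε * x ≤ 3.1 * 10 ^ 4 * (x⁻¹ / (1.33 * 10 ^ 5) * m) * x := by gcongr
      _ = 3.1 * 10 ^ 4 / (1.33 * 10 ^ 5) * m * (x⁻¹ * x) := by ring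
      _ = 3.1 * 10 ^ 4 / (1.33 * 10 ^ 5) * m := by rw [inv_mul_cancel₀ hx0.ne', mul_one]
      _ ≤ _ := by gcongr; norm_num
  have hm9 : m ≤ 1 / 9 := by
    refine hm1.trans ?_
    rw [div_le_div_iff₀ (by positivity) (by norm_num)]; nlinarith
  refine ⟨?_, ?_, hεm.trans (by gcongr), hεm.trans (by gcongr), ?_⟩
  · refine hE0.lt_of_ne fun h => ?_
    rw [← h, zero_div] at hm1
    linarith
  · refine hg0.lt_of_ne fun h => ?_
    rw [← h, zero_div] at hm2
    linarith
  · refine hle.trans ?_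
    have : x⁻¹ / (1.33 * 10 ^ 5) * m ≤ 1 / (1.33 * 10 ^ 5) * (1 / 9) := by
      gcongr
      exact inv_le_one_of_one_le₀ hx1
    calc _ ≤ (1 / (1.33 * 10 ^ 5) * (1 / 9) : ℝ) ^ 2 := by gcongr
      _ ≤ _ := by norm_num

section Calibration

variable {f : ℝ → ℂ} {T S R r s ε ε' : ℝ}

theorem WellCalibrated.bounds (h : WellCalibrated f T S R r s ε ε')
    (hf1 : ∀ p, ‖gabor f p‖ ≤ 1) (hcard : 9 ≤ (setΛ T S).card) :
    0 < gaborEnergy f (setΛ T S) ∧ 0 < signalGap f (setΛ T S) r ∧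
      ε' ≤ 0.2331 * (gaborEnergy f (setΛ T S) / ((setΛ T S).card : ℝ) ^ 2) ∧
      ε' ≤ 0.2331 * (signalGap f (setΛ T S) r / (192 * r ^ 2)) ∧ ε ≤ 7 / 10 ^ 13 := by
  have hE0 : 0 ≤ gaborEnergy f (setΛ T S) := Finset.sum_nonneg fun k _ => by positivity
  have hg0 : 0 ≤ signalGap f (setΛ T S) r :=
    spectralGap_nonneg _ _ fun u => by rw [spectrogram]; positivity
  have hexp : Real.exp (-(17 * Real.pi / 32) * r ^ 2) =
      (Real.exp (17 * Real.pi / 32 * r ^ 2))⁻¹ := by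
    rw [← Real.exp_neg]; congr 1; ring
  have hle := h.ε_le
  rw [hexp] at hle
  exact calibration_numeric hE0 (gaborEnergy_le hf1 _) (by exact_mod_cast hcard) hg0 h.r_pos
    (Real.one_le_exp (by positivity)) h.ε_pos hle h.ε'_eq

/-- The smallness of ε gives L ≥ 27 and √L ≥ 5.1, hence s ≤ 0.3/5.1 = 1/17. The bound s√L ≤ 0.3 also
gives 1/s ≥ (10/3)√L, so R ≥ (r + 1/s)/2 provides the margin for sampling and continuation. -/
theorem WellCalibrated.sampling (h : WellCalibrated f T S R r s ε ε') (hε : ε ≤ 7 / 10 ^ 13) :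
    0 ≤ Real.log (2 / (3 * ε)) ∧ 17 * s ≤ 1 ∧ Real.log (2 / (3 * ε)) * s ^ 2 ≤ 0.09 ∧
      5 / 3 * √(Real.log (2 / (3 * ε))) + r / 2 ≤ R := by
  have hε0 := h.ε_pos
  have hs := h.s_pos
  set L := Real.log (2 / (3 * ε)) with hL
  have hL27 : 27 ≤ L := by
    rw [hL, Real.le_log_iff_exp_le (by positivity)]
    have h1 := Real.exp_one_lt_d9
    have h2 : Real.exp 27 = Real.exp 1 ^ 27 := by rw [← Real.exp_nat_mul]; norm_num
    rw [h2, le_div_iff₀ (by positivity)]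
    calc Real.exp 1 ^ 27 * (3 * ε) ≤ 2.7183 ^ 27 * (3 * (7 / 10 ^ 13)) := by
          gcongr; linarith
      _ ≤ 2 := by norm_num
  have hL0 : 0 < L := by linarith
  have hsq := Real.sq_sqrt hL0.le
  have hsq5 : 5.1 ≤ √L := Real.le_sqrt_of_sq_le (by norm_num; linarith)
  have hsL : s * √L ≤ 0.3 := by
    rw [← le_div_iff₀ (by positivity)]; exact h.s_le
  refine ⟨hL0.le, by nlinarith, ?_, ?_⟩
  · calc L * s ^ 2 = (s * √L) ^ 2 := by rw [mul_pow, hsq]; ring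
      _ ≤ 0.3 ^ 2 := by gcongr
      _ ≤ _ := by norm_num
  · have h1 := (le_max_right _ _).trans h.R_ge
    have h2 : 10 / 3 * √L ≤ s⁻¹ := by
      rw [← one_div, le_div_iff₀ hs]; nlinarith
    linarith

/-! ### Accuracy of the evaluation step -/

theorem evaluation_sub (G H : ℂ × ℂ → ℂ) (p u : ℝ × ℝ) :
    evaluation G p u - evaluation H p u = evaluation (fun z => G z - H z) p u := by
  simp only [evaluation]; ring

theorem norm_evaluation (G : ℂ × ℂ → ℂ) (p u : ℝ × ℝ) :
    ‖evaluation G p u‖ = ‖G (((p.1 + u.1 / 2 : ℝ) : ℂ) + ((-(u.2 / 2) : ℝ) : ℂ) * Complex.I,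
      ((p.2 + u.2 / 2 : ℝ) : ℂ) + ((u.1 / 2 : ℝ) : ℂ) * Complex.I)‖ *
      Real.exp (-(Real.pi / 2) * (u.1 ^ 2 + u.2 ^ 2)) := by
  rw [evaluation, norm_mul]
  congr 1
  · congr 2
    ext1
    · push_cast; ring
    · push_cast; ring
  · rw [Complex.norm_exp]
    congr 1
    have : (-(Real.pi / 2 : ℂ) * ((u.1 : ℂ) ^ 2 + (u.2 : ℂ) ^ 2) -
        Real.pi * Complex.I * (2 * p.1 + u.1) * u.2) =
        ((-(Real.pi / 2) * (u.1 ^ 2 + u.2 ^ 2) : ℝ) : ℂ) +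
        ((-Real.pi * (2 * p.1 + u.1) * u.2 : ℝ) : ℂ) * Complex.I := by
      push_cast; ring
    rw [this, Complex.add_re, Complex.ofReal_re, Complex.re_ofReal_mul, Complex.I_re]; ring

/-- The difference of F_A and the extension of 𝒮f has growth constant 196·0.4 + 1 < 80. At the grid
points it is at most ε + ε/2 = e^{-L}. The evaluation point lies above the midpoint of two points of
the rectangle, with imaginary part of length |u|/2 ≤ r/2. The continuation and evaluation exponents
combine to 33π/32 - π/2 = 17π/32, and 100·80·1.3 < 3.1·10⁴. -/
theorem norm_evaluation_sub_le (hf : MemLp f 2 volume) (hf1 : ∀ p, ‖gabor f p‖ ≤ 1)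
    (h : WellCalibrated f T S R r s ε ε') (hε : ε ≤ 7 / 10 ^ 13) {σ : setΩ T S R s → ℝ}
    (hσ : ∀ k : setΩ T S R s, |σ k - spectrogram f (latticePt s k)| ≤ ε / 2)
    {A : Matrix (setΓ T S R) (setΓ T S R) ℂ} (hA : Feasible₁ s ε σ A) (hAm : maxDiag A ≤ 0.4)
    (k k' : setΛ T S) (hkk : dist₂ (latticePt mesh k) (latticePt mesh k') ≤ r) :
    ‖evaluation (ansatz A) (latticePt mesh k) (latticePt mesh k' - latticePt mesh k) -
      gabor f (latticePt mesh k') * conj (gabor f (latticePt mesh k))‖ ≤ ε' := by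
  obtain ⟨hL0, hs17, hLs, hR⟩ := h.sampling hε
  have hε0 := h.ε_pos
  have hr := h.r_pos
  set L := Real.log (2 / (3 * ε)) with hL
  set B := bargmann f
  set D : ℂ × ℂ → ℂ := fun z => ansatz A z - crossExt B B z with hD
  have hDd : Differentiable ℂ D := (differentiable_ansatz A).sub
    (differentiable_crossExt (differentiable_bargmann hf) (differentiable_bargmann hf))
  have hpf : ∀ p, phaseFun B p = gabor f p := fun p => (gabor_eq_phaseFun f p).symm
  have heL : Real.exp (-L) = 3 / 2 * ε := by
    rw [Real.exp_neg, hL, Real.exp_log (by positivity)]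
    field_simp
  have hM : ∀ x₁ y₁ x₂ y₂ : ℝ, ‖D (x₁ + y₁ * Complex.I, x₂ + y₂ * Complex.I)‖ ≤
      80 * Real.exp (2 * Real.pi * (y₁ ^ 2 + y₂ ^ 2)) := by
    intro x₁ y₁ x₂ y₂
    have h1 := norm_ansatz_le hA.1 hAm (by norm_num) x₁ y₁ x₂ y₂
    have h2 := norm_crossExt B B x₁ y₁ x₂ y₂
    rw [hpf, hpf] at h2
    have h3 : ‖gabor f (x₁ + y₂, x₂ - y₁)‖ * ‖gabor f (x₁ - y₂, x₂ + y₁)‖ ≤ 1 :=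
      mul_le_one₀ (hf1 _) (norm_nonneg _) (hf1 _)
    refine (norm_sub_le _ _).trans ?_
    rw [h2]
    have he := Real.exp_pos (2 * Real.pi * (y₁ ^ 2 + y₂ ^ 2))
    nlinarith
  have hsamp : ∀ n m : ℤ, |s * n| ≤ T + R → |s * m| ≤ S + R →
      ‖D (((s * n : ℝ) : ℂ), ((s * m : ℝ) : ℂ))‖ ≤ 80 * Real.exp (-L) := by
    intro n m hn hm
    have hmem : (n, m) ∈ setΩ T S R s :=
      (mem_latticeRect h.s_pos _).2 ⟨abs_le.1 hn, abs_le.1 hm⟩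
    have h1 := hA.2 ⟨(n, m), hmem⟩
    have h2 := hσ ⟨(n, m), hmem⟩
    simp only [latticePt] at h1 h2
    have h3 : crossExt B B (((s * n : ℝ) : ℂ), ((s * m : ℝ) : ℂ)) =
        ((spectrogram f (s * n, s * m) : ℝ) : ℂ) := by
      rw [crossExt_ofReal, hpf, Complex.mul_conj, Complex.normSq_eq_norm_sq, spectrogram]
    rw [heL]
    simp only [hD]
    rw [h3]
    set σ' := σ ⟨(n, m), hmem⟩
    have h4 : ‖((σ' : ℂ)) - ((spectrogram f (s * n, s * m) : ℝ) : ℂ)‖ ≤ ε / 2 := by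
      rw [← Complex.ofReal_sub, Complex.norm_real]; exact h2
    calc _ ≤ ‖ansatz A (((s * n : ℝ) : ℂ), ((s * m : ℝ) : ℂ)) - (σ' : ℂ)‖ +
          ‖((σ' : ℂ)) - ((spectrogram f (s * n, s * m) : ℝ) : ℂ)‖ := norm_sub_le_norm_sub_add_norm_sub _ _ _
      _ ≤ ε + ε / 2 := add_le_add h1 h4
      _ ≤ _ := by linarith
  set p := latticePt mesh k with hp
  set q := latticePt mesh k' with hq
  set u := q - p with hu
  have hev : gabor f q * conj (gabor f p) = evaluation (crossExt B B) p u := by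
    rw [evaluation_crossExt, hpf, hpf, hu, add_sub_cancel]
  rw [hev, evaluation_sub, norm_evaluation]
  have hpm := (mem_latticeRect mesh_pos _).1 k.2
  have hqm := (mem_latticeRect mesh_pos _).1 k'.2
  rw [← hp, Set.mem_prod, Set.mem_Icc, Set.mem_Icc] at hpm
  rw [← hq, Set.mem_prod, Set.mem_Icc, Set.mem_Icc] at hqm
  have hd : u.1 ^ 2 + u.2 ^ 2 ≤ r ^ 2 := by
    rw [dist₂, Real.sqrt_le_left hr.le] at hkk
    calc _ = (p.1 - q.1) ^ 2 + (p.2 - q.2) ^ 2 := by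
          simp only [hu, Prod.fst_sub, Prod.snd_sub]; ring
      _ ≤ _ := hkk
  have hmain := norm_le_of_lattice_samples hDd h.s_pos hs17 hLs hL0 hM hr.le hR hsamp
    (x₁ := p.1 + u.1 / 2) (x₂ := p.2 + u.2 / 2) (y₁ := -(u.2 / 2)) (y₂ := u.1 / 2)
    (by simp only [hu, Prod.fst_sub]; rw [abs_le]; constructor <;> linarith [hpm.1.1, hpm.1.2, hqm.1.1, hqm.1.2])
    (by simp only [hu, Prod.snd_sub]; rw [abs_le]; constructor <;> linarith [hpm.2.1, hpm.2.2, hqm.2.1, hqm.2.2])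
    (by nlinarith)
  refine (mul_le_mul_of_nonneg_right hmain (Real.exp_pos _).le).trans ?_
  have hhalf : Real.exp (-L / 2) ≤ 1.3 * √ε := by
    have h1 : Real.exp (-L / 2) = √(Real.exp (-L)) := by
      rw [Real.exp_half]
    rw [h1, heL, Real.sqrt_le_left (by positivity), mul_pow, Real.sq_sqrt hε0.le]
    nlinarith
  rw [h.ε'_eq, Real.exp_add, mul_assoc, mul_assoc (Real.exp (-L / 2)), ← Real.exp_add]
  have hpi := Real.pi_pos
  calc _ ≤ 100 * 80 * (1.3 * √ε * Real.exp (17 * Real.pi / 32 * r ^ 2)) := by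
        gcongr
        nlinarith
    _ ≤ _ := by
        have : 0 ≤ √ε * Real.exp (17 * Real.pi / 32 * r ^ 2) := by positivity
        nlinarith

end Calibration

/-! ### Existence of outputs -/

theorem isClosed_posSemidef {V : Type*} [Fintype V] : IsClosed {A : Matrix V V ℂ | A.PosSemidef} := by
  have : {A : Matrix V V ℂ | A.PosSemidef} = {A | A.conjTranspose = A} ∩
      ⋂ x : V → ℂ, {A | 0 ≤ star x ⬝ᵥ A.mulVec x} := by
    ext A
    simp only [Set.mem_ofPred_eq, Set.mem_inter_iff, Set.mem_iInter]
    exact Matrix.posSemidef_iff_dotProduct_mulVec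
  rw [this]
  refine (isClosed_eq (by fun_prop) continuous_id).inter (isClosed_iInter fun x => ?_)
  exact isClosed_le continuous_const (by fun_prop)

theorem continuous_maxDiag {Γ : Finset (ℤ × ℤ)} (hΓ : Γ.Nonempty) :
    Continuous (maxDiag : Matrix Γ Γ ℂ → ℝ) := by
  have : Nonempty Γ := hΓ.to_subtype
  have : (maxDiag : Matrix Γ Γ ℂ → ℝ) = fun A =>
      Finset.univ.sup' Finset.univ_nonempty fun k : Γ => (A k k).re := by
    ext A
    rw [maxDiag, Finset.sup'_univ_eq_ciSup]
  rw [this]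
  exact Continuous.finset_sup'_apply _ fun k _ => Complex.continuous_re.comp (by fun_prop)

/-- A sublevel set of the objective is closed, and bounded because the diagonal dominates all
entries of a positive semidefinite matrix; so the minimum is attained. -/
theorem exists_solves₁ {Γ Ω : Finset (ℤ × ℤ)} (hΓ : Γ.Nonempty) {s ε : ℝ} {σ : Ω → ℝ}
    (hfeas : ∃ A : Matrix Γ Γ ℂ, Feasible₁ s ε σ A) : ∃ A : Matrix Γ Γ ℂ, Solves₁ s ε σ A := by
  obtain ⟨A₀, hA₀⟩ := hfeas
  set C : Set (Matrix Γ Γ ℂ) := {A | Feasible₁ s ε σ A} ∩ {A | maxDiag A ≤ maxDiag A₀} with hC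
  have hansatz : ∀ z, Continuous fun A : Matrix Γ Γ ℂ => ansatz A z := by
    intro z
    unfold ansatz
    fun_prop
  have hCc : IsClosed C := by
    refine IsClosed.inter ?_ (isClosed_le (continuous_maxDiag hΓ) continuous_const)
    refine isClosed_posSemidef.inter ?_
    have : {A : Matrix Γ Γ ℂ | ∀ k : Ω, ‖ansatz A (((latticePt s k).1 : ℂ), ((latticePt s k).2 : ℂ)) -
        (σ k : ℂ)‖ ≤ ε} = ⋂ k : Ω, {A | ‖ansatz A (((latticePt s k).1 : ℂ), ((latticePt s k).2 : ℂ)) -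
        (σ k : ℂ)‖ ≤ ε} := by
      ext A; simp
    change IsClosed {A : Matrix Γ Γ ℂ | ∀ k : Ω, ‖ansatz A (((latticePt s k).1 : ℂ),
      ((latticePt s k).2 : ℂ)) - (σ k : ℂ)‖ ≤ ε}
    rw [this]
    exact isClosed_iInter fun k => isClosed_le (((hansatz _).sub continuous_const).norm)
      continuous_const
  have hK : IsCompact (Set.univ.pi fun _ : Γ => Set.univ.pi fun _ : Γ =>
      Metric.closedBall (0 : ℂ) (maxDiag A₀)) :=
    isCompact_univ_pi fun _ => isCompact_univ_pi fun _ => isCompact_closedBall _ _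
  have hCK : C ⊆ Set.univ.pi fun _ : Γ => Set.univ.pi fun _ : Γ =>
      Metric.closedBall (0 : ℂ) (maxDiag A₀) := by
    intro A hA k _ l _
    rw [mem_closedBall_zero_iff]
    exact (norm_entry_le_maxDiag hA.1.1 k l).trans hA.2
  obtain ⟨A, hA, hmin⟩ := (hK.of_isClosed_subset hCc hCK).exists_isMinOn ⟨A₀, hA₀, le_refl (maxDiag A₀)⟩
    (continuous_maxDiag hΓ).continuousOn
  refine ⟨A, hA.1, fun A' hA' => ?_⟩
  by_cases h : maxDiag A' ≤ maxDiag A₀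
  · exact hmin ⟨hA', h⟩
  · exact hA.2.trans (not_le.1 h).le

theorem exists_isTopEigenvector {Λ : Finset (ℤ × ℤ)} (hΛ : Λ.Nonempty) {Y : Matrix Λ Λ ℂ}
    (hY : Y.IsHermitian) : ∃ v, IsTopEigenvector Y v := by
  classical
  have : Nonempty Λ := hΛ.to_subtype
  obtain ⟨i, hi⟩ := Finite.exists_max hY.eigenvalues
  refine ⟨(hY.eigenvectorBasis i).ofLp, ?_, hY.eigenvalues i, ?_, fun ν w hw hν => ?_⟩
  · have h1 := hY.eigenvectorBasis.orthonormal.1 i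
    rw [← EuclideanSpace.norm_sq_eq, h1, one_pow]
  · rw [hY.mulVec_eigenvectorBasis i]
    ext u; simp
  · have h1 := star_dotProduct_mulVec_eq hY w
    rw [hν, dotProduct_smul, star_dotProduct_self_eq, ← sum_norm_sq_eigenvector hY w, smul_eq_mul,
      ← Complex.ofReal_mul] at h1
    have h2 := Complex.ofReal_injective h1
    have hpos : 0 < ∑ i, ‖star (hY.eigenvectorBasis i).ofLp ⬝ᵥ w‖ ^ 2 := by
      rw [sum_norm_sq_eigenvector hY w]
      obtain ⟨u, hu⟩ := Function.ne_iff.1 hw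
      exact Finset.sum_pos' (fun u _ => by positivity)
        ⟨u, Finset.mem_univ u, by have := norm_pos_iff.2 hu; positivity⟩
    refine le_of_mul_le_mul_right ?_ hpos
    rw [h2, Finset.mul_sum]
    exact Finset.sum_le_sum fun j _ => mul_le_mul_of_nonneg_right (hi j) (sq_nonneg _)

/-- The error is continuous in the phase factor, which ranges over the compact unit circle. -/
theorem exists_min_phaseError {g f : ℝ → ℂ} (hg : MemLp g 2 volume) (hf : MemLp f 2 volume) (τ : ℝ) :
    ∃ θ₀ : ℝ, ∀ θ : ℝ, phaseError τ g f θ₀ ≤ phaseError τ g f θ := by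
  set μ := (volume : Measure ℝ).restrict (Set.Ioo (-τ) τ)
  have hg' : MemLp g 2 μ := hg.restrict _
  have hf' : MemLp f 2 μ := hf.restrict _
  have key : ∀ θ : ℝ, phaseError τ g f θ =
      ‖hg'.toLp g - Complex.exp (Complex.I * θ) • hf'.toLp f‖ₑ := by
    intro θ
    rw [Lp.enorm_def, phaseError]
    refine eLpNorm_congr_ae ?_
    filter_upwards [Lp.coeFn_sub (hg'.toLp g) (Complex.exp (Complex.I * θ) • hf'.toLp f),
      Lp.coeFn_smul (Complex.exp (Complex.I * θ)) (hf'.toLp f), hg'.coeFn_toLp, hf'.coeFn_toLp]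
      with t h1 h2 h3 h4
    rw [h1, Pi.sub_apply, h2, Pi.smul_apply, h3, h4, smul_eq_mul]
  obtain ⟨z, hz, hmin⟩ := (isCompact_sphere (0 : ℂ) 1).exists_isMinOn ⟨1, by simp⟩
    (f := fun z : ℂ => ‖hg'.toLp g - z • hf'.toLp f‖ₑ) (by fun_prop)
  refine ⟨Complex.arg z, fun θ => ?_⟩
  have hz1 : ‖z‖ = 1 := by simpa using hz
  have hze : Complex.exp (Complex.I * Complex.arg z) = z := by
    conv_rhs => rw [← Complex.norm_mul_exp_arg_mul_I z, hz1, Complex.ofReal_one, one_mul]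
    rw [mul_comm]
  rw [key, key, hze]
  refine hmin ?_
  rw [mem_sphere_zero_iff_norm, mul_comm, Complex.norm_exp_ofReal_mul_I]

/-! ### Synthesis from the dual window -/

/-- Extension by zero of a vector of coefficients indexed by a finite set. -/
noncomputable def extendZero {Λ : Finset (ℤ × ℤ)} (v : Λ → ℂ) (k : ℤ × ℤ) : ℂ :=
  if h : k ∈ Λ then v ⟨k, h⟩ else 0

theorem extendZero_coe {Λ : Finset (ℤ × ℤ)} (v : Λ → ℂ) (k : Λ) : extendZero v k = v k := by
  simp [extendZero]

theorem ae_eq_sum_latShift {Λ : Finset (ℤ × ℤ)} (a : ℂ) (v : Λ → ℂ) {ψ : ℝ → ℂ}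
    (hψ : IsCanonicalDualWindow ψ) :
    (fun t : ℝ => a * ∑ k : Λ, v k * tfShift (latticePt mesh k) ψ t) =ᵐ[volume]
      (∑ k ∈ Λ, (a * extendZero v k) • latShift k dualL : L2R) := by
  have h1 := coeFn_sum_smul Λ (fun k => a * extendZero v k) (fun k => latShift k dualL)
    (fun k => tfShift (latticePt mesh k) ψ) fun k =>
      (coeFn_latShift_dualL k).trans (tfShift_congr_ae _ hψ.ae_eq_dualL.symm)
  filter_upwards [h1] with t ht
  rw [ht, Finset.mul_sum, ← Finset.sum_coe_sort Λ]
  refine Finset.sum_congr rfl fun k _ => ?_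
  rw [extendZero_coe, mul_assoc]

/-- The local error of a synthesized signal is controlled by the error of its coefficients and
the local truncation error. -/
theorem localNorm_synthesis_sub_le (τ : ℝ) (F : L2R) (Λ : Finset (ℤ × ℤ)) (a b : ℤ × ℤ → ℂ)
    {c : ℂ} (hc : ‖c‖ = 1) :
    localNorm τ (∑ k ∈ Λ, b k • latShift k dualL - c • F : L2R) ≤
      ENNReal.ofReal √(∑ k ∈ Λ, ‖b k - c * a k‖ ^ 2) +
        localNorm τ (F - ∑ k ∈ Λ, a k • latShift k dualL : L2R) := by
  set D : L2R := F - ∑ k ∈ Λ, a k • latShift k dualL with hD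
  have hsplit : ∑ k ∈ Λ, b k • latShift k dualL - c • F =
      ∑ k ∈ Λ, (b k - c * a k) • latShift k dualL + (-c) • D := by
    simp only [hD, sub_smul, Finset.sum_sub_distrib, smul_sub, mul_smul, ← Finset.smul_sum,
      neg_smul]
    abel
  rw [hsplit]
  refine (localNorm_add_le _ _ _).trans (add_le_add ?_ (le_of_eq ?_))
  · refine (localNorm_le _ _).trans ?_
    rw [← ofReal_norm]
    exact ENNReal.ofReal_le_ofReal (norm_sum_dual_le _ _)
  · rw [localNorm_congr_ae (Lp.coeFn_smul (-c) D), localNorm, eLpNorm_const_smul, ← ofReal_norm,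
      norm_neg, hc, ENNReal.ofReal_one, one_mul]

/-- Constants: √31000 < 177 and 17π/64 < 0.84. -/
theorem sqrt_mul_le_coeffBound {f : ℝ → ℂ} {Λ : Finset (ℤ × ℤ)} {r ε ε' : ℝ} (hr : 0 < r)
    (hε : 0 < ε) (h : ε' = 3.1 * 10 ^ 4 * √ε * Real.exp (17 * Real.pi / 32 * r ^ 2)) :
    √ε' * (1 + 20 * r * √(gaborEnergy f Λ / signalGap f Λ r)) ≤ coeffBound f Λ r ε := by
  have hroot : (ε ^ (1 / 4 : ℝ)) ^ 2 = √ε := by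
    rw [← Real.rpow_natCast, ← Real.rpow_mul hε.le, Real.sqrt_eq_rpow]; norm_num
  have hexp : Real.exp (17 * Real.pi / 32 * r ^ 2) ≤ Real.exp (0.84 * r ^ 2) ^ 2 := by
    rw [← Real.exp_nat_mul, Real.exp_le_exp]
    have := Real.pi_lt_d4
    push_cast
    nlinarith [sq_nonneg r]
  have hsq : √ε' ≤ 177 * Real.exp (0.84 * r ^ 2) * ε ^ (1 / 4 : ℝ) := by
    refine (Real.sqrt_le_left (by positivity)).2 ?_
    rw [h, mul_pow, mul_pow, hroot]
    calc 3.1 * 10 ^ 4 * √ε * Real.exp (17 * Real.pi / 32 * r ^ 2)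
        ≤ 177 ^ 2 * √ε * Real.exp (0.84 * r ^ 2) ^ 2 := by gcongr; norm_num
      _ = _ := by ring
  calc _ ≤ 177 * Real.exp (0.84 * r ^ 2) * ε ^ (1 / 4 : ℝ) *
        (1 + 20 * r * √(gaborEnergy f Λ / signalGap f Λ r)) := by gcongr
    _ = _ := by rw [coeffBound]; ring

theorem zero_mem_latticeRect {c X Y : ℝ} (hc : 0 < c) (hX : 0 ≤ X) (hY : 0 ≤ Y) :
    (0 : ℤ × ℤ) ∈ latticeRect c X Y := by
  rw [mem_latticeRect hc]
  simp [latticePt, hX, hY]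

/-! ### Existence and accuracy of the output -/

section Output

variable {f : ℝ → ℂ} {T S R r s ε ε' τ : ℝ} {σ : setΩ T S R s → ℝ}

theorem WellCalibrated.exists_feasible (h : WellCalibrated f T S R r s ε ε')
    (hf : MemLp f 2 volume) (hf1 : ∀ p, ‖gabor f p‖ ≤ 1) (hε : ε ≤ 7 / 10 ^ 13)
    (hσ : ∀ k : setΩ T S R s, |σ k - spectrogram f (latticePt s k)| ≤ ε / 2) :
    ∃ A : Matrix (setΓ T S R) (setΓ T S R) ℂ, Feasible₁ s ε σ A ∧ maxDiag A ≤ 0.4 := by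
  refine GaborPR.exists_feasible hf hf1 h.s_pos h.ε_pos ?_ ((le_max_left _ _).trans h.R_ge) σ hσ
  have := Real.exp_neg_one_gt_d9
  refine hε.trans (le_trans ?_ this.le)
  norm_num

/-- The matrix aa* of true samples is feasible for the second program whichever solution of the
first is used, since the evaluation step is accurate to ε'. -/
theorem exists_isAlgorithmOutput (hf : MemLp f 2 volume) (hf1 : ∀ p, ‖gabor f p‖ ≤ 1)
    (h : WellCalibrated f T S R r s ε ε') (hε : ε ≤ 7 / 10 ^ 13)
    (hσ : ∀ k : setΩ T S R s, |σ k - spectrogram f (latticePt s k)| ≤ ε / 2) :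
    ∃ g : ℝ → ℂ, IsAlgorithmOutput (setΛ T S) (setΓ T S R) s r ε ε' σ g := by
  obtain ⟨A₀, hA₀, hA₀m⟩ := h.exists_feasible hf hf1 hε hσ
  have hT := h.T_pos
  have hS := h.S_pos
  have hR := h.R_pos
  have hΓ : (setΓ T S R).Nonempty :=
    ⟨0, zero_mem_latticeRect mesh_pos (by positivity) (by positivity)⟩
  have hΛ : (setΛ T S).Nonempty := ⟨0, zero_mem_latticeRect mesh_pos hT.le hS.le⟩
  obtain ⟨A, hA⟩ := exists_solves₁ hΓ ⟨A₀, hA₀⟩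
  set a : setΛ T S → ℂ := fun k => gabor f (latticePt mesh k)
  have hY : (Matrix.vecMulVec a (star a)).PosSemidef := Matrix.posSemidef_vecMulVec_self_star a
  obtain ⟨v, hv⟩ := exists_isTopEigenvector hΛ hY.isHermitian
  refine ⟨_, A, Matrix.vecMulVec a (star a), v, dualL, hA, ⟨hY, fun k k' hkk => ?_⟩, hv,
    isCanonicalDualWindow_dualL, EventuallyEq.rfl⟩
  rw [norm_sub_rev]
  exact norm_evaluation_sub_le hf hf1 h hε hσ hA.1 ((hA.2 _ hA₀).trans hA₀m) k k' hkk

/-- Comparison with the known feasible matrix bounds the diagonal of any minimizer by 0.4, so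
evaluation is accurate to ε'. Both Y and aa* are then within ε' of the same values, hence within 2ε'
of each other. -/
theorem IsAlgorithmOutput.exists_localNorm_le (hf : MemLp f 2 volume)
    (hf1 : ∀ p, ‖gabor f p‖ ≤ 1) (h : WellCalibrated f T S R r s ε ε')
    (hcard : 9 ≤ (setΛ T S).card)
    (hσ : ∀ k : setΩ T S R s, |σ k - spectrogram f (latticePt s k)| ≤ ε / 2)
    {g : ℝ → ℂ} (hg : IsAlgorithmOutput (setΛ T S) (setΓ T S R) s r ε ε' σ g) (τ : ℝ) :
    MemLp g 2 volume ∧ ∃ θ : ℝ, phaseError τ g f θ ≤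
      ENNReal.ofReal (coeffBound f (setΛ T S) r ε) +
        localNorm τ (hf.toLp f -
          ∑ k ∈ setΛ T S, gabor f (latticePt mesh k) • latShift k dualL : L2R) := by
  obtain ⟨A, Y, v, ψ, hA, hY, hv, hψ, hg⟩ := hg
  obtain ⟨hE, hgap, hη1, hη2, hε⟩ := h.bounds hf1 hcard
  obtain ⟨A₀, hA₀, hA₀m⟩ := h.exists_feasible hf hf1 hε hσ
  have hAm : maxDiag A ≤ 0.4 := (hA.2 _ hA₀).trans hA₀m
  obtain ⟨c, hc, hcv⟩ := exists_phase_samples_close h.r_pos h.ε'_pos hcard hE hgap hη1 hη2 hY.1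
    (fun k k' hkk => by
      have h1 := hY.2 k k' hkk
      have h2 := norm_evaluation_sub_le hf hf1 h hε hσ hA.1 hAm k k' hkk
      calc _ ≤ _ + _ := norm_sub_le_norm_sub_add_norm_sub _ _ _
        _ ≤ ε' + ε' := add_le_add h1 h2
        _ = 2 * ε' := by ring) hv
  have hg' := hg.trans (ae_eq_sum_latShift _ v hψ)
  refine ⟨(memLp_congr_ae hg').2 (Lp.memLp _), Complex.arg c, ?_⟩
  have hcarg : Complex.exp (Complex.I * (Complex.arg c : ℂ)) = c := by
    have := Complex.norm_mul_exp_arg_mul_I c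
    rwa [hc, Complex.ofReal_one, one_mul, mul_comm] at this
  have hae : (fun t => g t - Complex.exp (Complex.I * (Complex.arg c : ℂ)) * f t) =ᵐ[volume]
      (∑ k ∈ setΛ T S, (((√Y.trace.re : ℝ) : ℂ) * extendZero v k) • latShift k dualL -
        c • hf.toLp f : L2R) := by
    filter_upwards [hg', Lp.coeFn_sub (∑ k ∈ setΛ T S,
      (((√Y.trace.re : ℝ) : ℂ) * extendZero v k) • latShift k dualL) (c • hf.toLp f),
      Lp.coeFn_smul c (hf.toLp f), hf.coeFn_toLp] with t h1 h2 h3 h4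
    rw [h2, Pi.sub_apply, h3, Pi.smul_apply, h4, h1, hcarg, smul_eq_mul]
  have hsum : ∑ k ∈ setΛ T S, ‖((√Y.trace.re : ℝ) : ℂ) * extendZero v k -
      c * gabor f (latticePt mesh k)‖ ^ 2 =
      ∑ k : setΛ T S, ‖((√Y.trace.re : ℝ) : ℂ) * v k - c * gabor f (latticePt mesh k)‖ ^ 2 := by
    rw [← Finset.sum_coe_sort]
    exact Finset.sum_congr rfl fun k _ => by rw [extendZero_coe]
  refine (localNorm_congr_ae (τ := τ) hae).le.trans ((localNorm_synthesis_sub_le τ _ _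
    (fun k => gabor f (latticePt mesh k)) _ hc).trans ?_)
  gcongr
  rw [hsum]
  exact hcv.trans (sqrt_mul_le_coeffBound h.r_pos h.ε_pos h.ε'_eq)

end Output

end GaborPR

/-! ### The main theorem -/

theorem theorem3 (f : ℝ → ℂ) (hf : MeasureTheory.MemLp f 2 MeasureTheory.volume)
    (hSf : MeasureTheory.eLpNorm (GaborPR.spectrogram f) ⊤ MeasureTheory.volume ≤ 1)
    (T S R r s ε ε' τ : ℝ)
    (hT : ∃ m : ℕ, T = GaborPR.mesh * m) (hS : ∃ n : ℕ, S = GaborPR.mesh * n)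
    (hτ : 0 < τ) (hτT : τ < T)
    (hcal : GaborPR.WellCalibrated f T S R r s ε ε')
    (σ : GaborPR.setΩ T S R s → ℝ)
    (hσ : ∀ k : GaborPR.setΩ T S R s,
      |σ k - GaborPR.spectrogram f (GaborPR.latticePt s k)| ≤ ε / 2) :
    (∃ fstar : ℝ → ℂ,
      GaborPR.IsAlgorithmOutput (GaborPR.setΛ T S) (GaborPR.setΓ T S R) s r ε ε' σ fstar) ∧
    ∀ fstar : ℝ → ℂ,
      GaborPR.IsAlgorithmOutput (GaborPR.setΛ T S) (GaborPR.setΓ T S R) s r ε ε' σ fstar →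
      ∃ θ₀ : ℝ,
        (∀ θ : ℝ, GaborPR.phaseError τ fstar f θ₀ ≤ GaborPR.phaseError τ fstar f θ) ∧
        GaborPR.phaseError τ fstar f θ₀ ≤
          18 * (ENNReal.ofReal (GaborPR.coeffBound f (GaborPR.setΛ T S) r ε) +
            ENNReal.ofReal (2 * T + 2) * GaborPR.kappa S f +
            ENNReal.ofReal (2 * √S * (τ + 1) * Real.exp (-(Real.pi / 2) * (T - τ)))) := by
  have hf1 := GaborPR.norm_gabor_le_one hf hSf
  have hcard := GaborPR.nine_le_card_setΛ hT hS hcal.T_pos hcal.S_pos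
  obtain ⟨-, -, -, -, hε⟩ := hcal.bounds hf1 hcard
  refine ⟨GaborPR.exists_isAlgorithmOutput hf hf1 hcal hε hσ, fun fstar hout => ?_⟩
  obtain ⟨hmem, θ, hθ⟩ := hout.exists_localNorm_le hf hf1 hcal hcard hσ τ
  obtain ⟨θ₀, hθ₀⟩ := GaborPR.exists_min_phaseError hmem hf τ
  refine ⟨θ₀, hθ₀, (hθ₀ θ).trans (hθ.trans ?_)⟩
  rw [add_assoc, mul_add]
  -- The coefficient error enters with constant 1; the factor 18 is needed only for the truncation.
  refine add_le_add (le_mul_of_one_le_left zero_le (by norm_num)) ?_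
  exact GaborPR.localNorm_sub_sum_le hf hf1 hT hS hcal.T_pos hcal.S_pos hτ hτT
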